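/- **Setting.** Let $r\ge 6$ be an integer, $T>0$, $p\in\mathbb R$. For $s\ge1$, $C^{s}[0,2\pi]$ denotes the $2\pi$-periodic functions whose derivatives up to order $s-1$ are continuous and periodic and whose $s$-th derivative exists almost everywhere and has bounded variation on $[0,2\pi]$ (the derivative of order $s-1$ being the indefinite integral of the $s$-th). Let $L(t)>0$ and $\theta(\alpha,t)$, $0\le t\le T$, be a regular solution of the $\theta$–$L$ system of Airy flow $$L_t=0,\qquad \theta_t=\Big(\frac{2\pi}{L}\Big)^3\Big[\theta_{\alpha\alpha\alpha}+\frac{\theta_\alpha^3}{2}\Big],$$ such that $\theta(\cdot,t)-p\,\alpha$ belongs to $C^{r+3}[0,2\pi]$ boundedly in $t\in[0,T]$ (the total variations over $[0,2\pi]$ of the derivatives of order $r+3$ are bounded uniformly in $t$), and such that $\theta(\alpha,\cdot)$ is three times continuously differentiable on $[0,T]$ for every $\alpha$. Here $p$ is the rotation index of the curve: $p=0$ when $\theta$ itself is periodic, $p=\pm1$ for simple closed curves. **Scheme.** Let $N$ be an even positive integer, $h=2\pi/N$, $\alpha_k=kh$, $\Delta t>0$, $t_j=j\Delta t$; the indices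 $k,m$ run over $-N/2+1,\dots,N/2$. For a grid function $f$ put $$\widehat{f}_m=\frac1N\sum_k f_k e^{-im\alpha_k},\qquad (S_hf)_k=\sum_m im\,\widehat f_m e^{im\alpha_k}.$$ Write $\widetilde\theta^{\,j}_k=p\,\alpha_k+u^j_k$, $NL^j_k=\frac12\big(\frac{2\pi}{L}\big)^3\big(p+(S_hu^j)_k\big)^3$ and $$\gamma_m=\Delta t\Big(\frac{2\pi m}{L}\Big)^3,\qquad \zeta^1_m=\frac{1-i\gamma_m}{1+i\gamma_m},\qquad \zeta^2_m=\frac{1-i\gamma_m}{1+\gamma_m^2}.$$ The CNADB approximation $\widetilde\theta^{\,j}$ starts from the exact values $\widetilde\theta^{\,0}_k=\theta(\alpha_k,0)$; its first step is the average of the Euler step of the Crank–Nicolson scheme and the integrating factor Euler step of the Adams–Bashforth scheme, $$\widehat{u^1}_m=\tfrac12\,\widehat{u^0}_m\big[e^{-i\gamma_m}+(1-i\gamma_m)\big]+\tfrac{\Delta t}{2}\,\widehat{NL^0}_m\big[1+e^{-i\gamma_m}\big],$$ and the later steps, $j\ge1$, are of Crank–Nicolson type, $$\widehat{u^{j+1}}_m=\zeta^1_m\,\widehat{u^{j-1}}_m+2\Delta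 t\,\zeta^2_m\,\widehat{NL^j}_m .$$ **Claim.** There are constants $h_0>0$, $C_0>0$ and $C$, which depend on the solution, on $r$ and on $T$ but not on $N$, $\Delta t$ and $j$, such that whenever $h\le h_0$ and $\Delta t/h\le C_0$, $$\|\widetilde\theta^{\,j}-\theta(\cdot,t_j)\|_{l^2}\le C\,(h^r+\Delta t^2)\qquad\text{for all } j\ge 0 \text{ with } t_j\le T,$$ where $\|f\|_{l^2}^2=\sum_{k}|f_k|^2h$. -/

import Mathlib

namespace Airy

noncomputable section

/-- `f` is `2π`-periodic, its derivatives up to order `r - 1` are continuous and periodic, and its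
`r`-th derivative exists almost everywhere, in the sense that the derivative of order `r - 1` is the
indefinite integral of a function `g` whose total variation on `[0, 2π]` is at most `V`
(used for `1 ≤ r`). -/
def InClassC (r : ℕ) (V : NNReal) (f : ℝ → ℝ) : Prop :=
  Function.Periodic f (2 * Real.pi) ∧ ContDiff ℝ ((r - 1 : ℕ) : ℕ∞) f ∧
    ∃ g : ℝ → ℝ, eVariationOn g (Set.Icc 0 (2 * Real.pi)) ≤ (V : ENNReal) ∧
      ∀ x ∈ Set.Icc (0 : ℝ) (2 * Real.pi),
        iteratedDeriv (r - 1) f x = iteratedDeriv (r - 1) f 0 + ∫ y in (0 : ℝ)..x, g y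

/-- `(θ, L)`, written `θ t α` and `L t`, is a regular solution on `[0, T]` of
`L_t = 0`, `θ_t = (2π/L)³ (θ_ααα + θ_α³/2)`, where `θ` increases by `2πp` over one period
(`p` is the rotation index of the curve; `p = 0` is the case of periodic `θ`).
The periodic part of `θ(·,t)` is of class `C^{r+3}`, boundedly in `t ∈ [0, T]`, and `θ` is three times
continuously differentiable with respect to time. -/
structure IsRegularSolution (r : ℕ) (T p : ℝ) (L : ℝ → ℝ) (θ : ℝ → ℝ → ℝ) : Prop where
  length_pos : ∀ t ∈ Set.Icc 0 T, 0 < L t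
  length_eq : ∀ t ∈ Set.Icc 0 T, HasDerivWithinAt L 0 (Set.Icc 0 T) t
  angle_eq : ∀ t ∈ Set.Icc 0 T, ∀ α : ℝ,
    HasDerivWithinAt (fun s => θ s α)
      ((2 * Real.pi / L t) ^ 3 * (iteratedDeriv 3 (θ t) α + deriv (θ t) α ^ 3 / 2))
      (Set.Icc 0 T) t
  space_reg : ∃ V : NNReal, ∀ t ∈ Set.Icc 0 T, InClassC (r + 3) V (fun α => θ t α - p * α)
  time_reg : ∀ α : ℝ, ContDiffOn ℝ 3 (fun t => θ t α) (Set.Icc 0 T)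

/-- The indices `-N/2 + 1, …, N/2` (for even `N`), both of grid points and of wave numbers. -/
def idx (N : ℕ) : Finset ℤ := Finset.Ioc (-((N : ℤ) / 2)) ((N : ℤ) / 2)

/-- The mesh size `h = 2π/N`. -/
def mesh (N : ℕ) : ℝ := 2 * Real.pi / N

/-- The grid point `α_k = k h`. -/
def node (N : ℕ) (k : ℤ) : ℝ := k * mesh N

/-- The discrete Fourier coefficients of a grid function. -/
def dft (N : ℕ) (f : ℤ → ℂ) (m : ℤ) : ℂ :=
  1 / (N : ℂ) * ∑ k ∈ idx N, f k * Complex.exp (-Complex.I * m * node N k)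

/-- The grid function with given discrete Fourier coefficients. -/
def idft (N : ℕ) (c : ℤ → ℂ) (k : ℤ) : ℂ :=
  ∑ m ∈ idx N, c m * Complex.exp (Complex.I * m * node N k)

/-- The spectral derivative `S_h`. -/
def specDeriv (N : ℕ) (f : ℤ → ℂ) : ℤ → ℂ :=
  idft N (fun m => Complex.I * m * dft N f m)

/-- The nonlinear term `(2π/L)³ (S_h θ)³ / 2` of the grid function `θ = pα + u`, computed in physical
space; the linear part `pα` contributes `p` to the derivative. -/
def nonlin (N : ℕ) (L p : ℝ) (u : ℤ → ℂ) (k : ℤ) : ℂ :=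
  (2 * Real.pi / L : ℂ) ^ 3 * (p + specDeriv N u k) ^ 3 / 2

/-- `γ_m = Δt (2πm/L)³`. -/
def gam (L dt : ℝ) (m : ℤ) : ℝ := dt * (2 * Real.pi * m / L) ^ 3

/-- `ζ¹_m = (1 - iγ_m)/(1 + iγ_m)`. -/
def zeta1 (L dt : ℝ) (m : ℤ) : ℂ :=
  (1 - Complex.I * gam L dt m) / (1 + Complex.I * gam L dt m)

/-- `ζ²_m = (1 - iγ_m)/(1 + γ_m²)`. -/
def zeta2 (L dt : ℝ) (m : ℤ) : ℂ :=
  (1 - Complex.I * gam L dt m) / (1 + (gam L dt m : ℂ) ^ 2)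

/-- The periodic part of the CNADB approximation: initial values `u₀`, a first step that averages the
Euler step and the integrating factor Euler step, then the two-step Crank-Nicolson type scheme. -/
def cnadbPer (N : ℕ) (L p dt : ℝ) (u₀ : ℤ → ℂ) : ℕ → ℤ → ℂ
  | 0 => u₀
  | 1 => idft N fun m =>
      dft N u₀ m * (1 / 2) *
          (Complex.exp (-Complex.I * gam L dt m) + (1 - Complex.I * gam L dt m)) +
        dft N (nonlin N L p u₀) m * (dt / 2) * (1 + Complex.exp (-Complex.I * gam L dt m))
  | j + 2 => idft N fun m =>
      zeta1 L dt m * dft N (cnadbPer N L p dt u₀ j) m +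
        2 * dt * zeta2 L dt m * dft N (nonlin N L p (cnadbPer N L p dt u₀ (j + 1))) m

/-- The CNADB approximation at time step `j` and grid index `k` that starts from the exact values of
the angle `θ₀` at the grid points. -/
def cnadb (N : ℕ) (L p dt : ℝ) (θ₀ : ℝ → ℝ) (j : ℕ) (k : ℤ) : ℂ :=
  p * node N k +
    cnadbPer N L p dt (fun l => ((θ₀ (node N l) - p * node N l : ℝ) : ℂ)) j k

/-- The discrete `l²` norm of a grid function. -/
def l2norm (N : ℕ) (f : ℤ → ℂ) : ℝ := Real.sqrt (∑ k ∈ idx N, ‖f k‖ ^ 2 * mesh N)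

end

end Airy

/-! The proof is consistency plus stability for the Fourier coefficients of the error, measured with
the weight `wgt N m = 1 + |m|/√N`.

Consistency. A function of class C^{r+3} has Fourier coefficients O(|m|^{-(r+4)}), so sampling and
truncation errors are high powers of 1/N. On the Fourier side the flow reads û' = -i c m³ û + (cubic
term), with c = (2π/L)³, so each time difference costs three powers of m. From r + 4 ≥ 10 the decay
falls to 7, 4 and 1. The last power gives the two-step formula a defect O(Δt³/(1+|m|))
(`Flow.norm_two_step_le`), which is still O(Δt³) in the weighted norm.

Linear stability. After multiplication by 1 + iγ_m the scheme gives b - a + D(b + a) = 2Δt(Be + F)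
for consecutive errors a, e, b. Here D = diag(iγ_m) is skew, and B is the spectral derivative
followed by multiplication by (3c/2)v². Pairing with b + a removes D. The kernel α(m-n)·in of B,
conjugated by the weight, splits into three parts. The skew part S has norm O(N) and is absorbed
into a modified energy, as for leapfrog, when ΔtN is small. The part M is bounded because α decays.
The aliasing part H lives on the pairs |m-n| > N/2, is Hermitian of norm O(N), and would destroy the
estimate.

Dispersion makes H harmless. Its dominant pairs have m ≈ -n at the ends of the spectrum, where m³
and n³ have opposite signs, so the interaction is not resonant. The corrector Q is, up to a constant
factor, H divided by m³ - n³. It has norm O(N^{-2}) and satisfies 2ΔtH + DQ = O(Δt)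
(`norm_kerHQ_le`). Adding ⟨Qe, e'⟩ to the energy therefore trades H for bounded terms
(`energy_sub_energy`, `two_step_stability`).

Nonlinearity. The remainder is quadratic in the derivative of the error. If ε is the weighted norm,
the remainder is O(N²ε·ε), hence O(ε) as long as N²ε ≤ 1 (`Flow.norm_nonlinear_remainder_le`). The
weight saves half a power of N here, and this is decisive: the error is of size Δt² ≤ C₀²h², so N²ε
≤ 1 holds for small C₀ with no power to spare. This smallness is propagated inside the stability
induction. -/

namespace Airy
-- Fourier coefficients and their decay.
noncomputable section
open MeasureTheory

/-- The character `x ↦ e^{imx}`. -/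
def ex (m : ℤ) (x : ℝ) : ℂ := Complex.exp (Complex.I * m * x)

/-- The Fourier coefficients of a function on `[0, 2π]`. -/
def fc (f : ℝ → ℂ) (m : ℤ) : ℂ :=
  1 / (2 * Real.pi : ℂ) * ∫ x in (0 : ℝ)..(2 * Real.pi), f x * ex (-m) x

lemma ex_add (m n : ℤ) (x : ℝ) : ex (m + n) x = ex m x * ex n x := by
  rw [ex, ex, ex, ← Complex.exp_add]; congr 1; push_cast; ring

@[simp] lemma ex_zero (x : ℝ) : ex 0 x = 1 := by simp [ex]

@[simp] lemma ex_at_zero (m : ℤ) : ex m 0 = 1 := by simp [ex]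

@[simp] lemma norm_ex (m : ℤ) (x : ℝ) : ‖ex m x‖ = 1 := by
  rw [ex, show Complex.I * (m : ℂ) * (x : ℂ) = ((m * x : ℝ) : ℂ) * Complex.I by push_cast; ring,
    Complex.norm_exp_ofReal_mul_I]

lemma ex_two_pi (m : ℤ) : ex m (2 * Real.pi) = 1 := by
  rw [ex, Complex.exp_eq_one_iff]
  exact ⟨m, by push_cast; ring⟩

lemma hasDerivAt_ex (m : ℤ) (x : ℝ) : HasDerivAt (ex m) (Complex.I * m * ex m x) x := by
  have h : HasDerivAt (fun y : ℝ => Complex.I * m * (y : ℂ)) (Complex.I * m * 1) x :=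
    (Complex.ofRealCLM.hasDerivAt (x := x)).const_mul _
  exact h.cexp.congr_deriv (by rw [ex]; ring)

lemma continuous_ex (m : ℤ) : Continuous (ex m) := by unfold ex; fun_prop

/-- Integration by parts; periodicity kills the boundary term. The countable exceptional set is
there for the top derivative, which has bounded variation and may jump. -/
lemma fc_eq_of_hasDerivAt {f f' : ℝ → ℂ} (hf : ContinuousOn f (Set.uIcc 0 (2 * Real.pi)))
    {s : Set ℝ} (hs : s.Countable)
    (hd : ∀ x ∈ Set.Ioo (0 : ℝ) (2 * Real.pi) \ s, HasDerivAt f (f' x) x)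
    (hi : IntervalIntegrable f' volume 0 (2 * Real.pi)) (hp : f (2 * Real.pi) = f 0) (m : ℤ) :
    fc f' m = Complex.I * m * fc f m := by
  have hpi : (0 : ℝ) ≤ 2 * Real.pi := by positivity
  have e1 : ContinuousOn (ex (-m)) (Set.uIcc 0 (2 * Real.pi)) := (continuous_ex _).continuousOn
  have h1 : IntervalIntegrable (fun x => f' x * ex (-m) x) volume 0 (2 * Real.pi) :=
    hi.mul_continuousOn e1
  have h2 : IntervalIntegrable (fun x => f x * ex (-m) x) volume 0 (2 * Real.pi) :=
    (hf.mul e1).intervalIntegrable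
  have h := integral_eq_of_hasDerivAt_off_countable (a := 0) (b := 2 * Real.pi)
    (fun x => f x * ex (-m) x)
    (fun x => f' x * ex (-m) x + -(Complex.I * m) * (f x * ex (-m) x)) hs (hf.mul e1)
    (by
      intro x hx
      rw [min_eq_left hpi, max_eq_right hpi] at hx
      have h0 := (hd x hx).mul (hasDerivAt_ex (-m) x)
      refine h0.congr_deriv ?_
      push_cast; ring)
    (h1.add (h2.const_mul _))
  rw [intervalIntegral.integral_add h1 (h2.const_mul _), intervalIntegral.integral_const_mul] at h
  simp only [ex_two_pi, ex_at_zero, hp, sub_self] at h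
  rw [fc, fc]
  linear_combination (1 / (2 * Real.pi : ℂ)) * h

lemma integral_ex_eq_zero {n : ℤ} (hn : n ≠ 0) {a b : ℝ} (h : ex n b = ex n a) :
    ∫ x in a..b, ex n x = 0 := by
  have h0 : Complex.I * (n : ℂ) ≠ 0 := by simp [hn]
  have := integral_exp_mul_complex (a := a) (b := b) h0
  simp only [ex] at *
  rw [this, h, sub_self, zero_div]

lemma integral_ex (n : ℤ) : ∫ x in (0 : ℝ)..(2 * Real.pi), ex n x = if n = 0 then 2 * Real.pi else 0 := by
  split_ifs with h
  · subst h; simp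
  · exact integral_ex_eq_zero h (by rw [ex_two_pi, ex_at_zero])

lemma intervalIntegrable_of_boundedVariation {g : ℝ → ℝ} {a b : ℝ} (hab : a ≤ b)
    (hg : BoundedVariationOn g (Set.Icc a b)) : IntervalIntegrable g volume a b := by
  obtain ⟨p, q, hp, hq, rfl⟩ := hg.locallyBoundedVariationOn.exists_monotoneOn_sub_monotoneOn
  rw [← Set.uIcc_of_le hab] at hp hq
  exact hp.intervalIntegrable.sub hq.intervalIntegrable

lemma countable_not_continuousAt {g : ℝ → ℝ} {a b : ℝ}
    (hg : BoundedVariationOn g (Set.Icc a b)) :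
    {x | x ∈ Set.Ioo a b ∧ ¬ ContinuousAt g x}.Countable := by
  obtain ⟨p, q, hp, hq, rfl⟩ := hg.locallyBoundedVariationOn.exists_monotoneOn_sub_monotoneOn
  refine (hp.countable_not_continuousWithinAt.union hq.countable_not_continuousWithinAt).mono ?_
  rintro x ⟨hx, hc⟩
  by_contra hcon
  simp only [Set.mem_union, Set.mem_ofPred_eq, not_or, not_and, not_not] at hcon
  have hm := Set.Ioo_subset_Icc_self hx
  have hn := Icc_mem_nhds hx.1 hx.2
  exact hc (((hcon.1 hm).continuousAt hn).sub ((hcon.2 hm).continuousAt hn))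

/-- A function of bounded variation is a difference of monotone functions, hence continuous off a
countable set, and its primitive is differentiable at every point of continuity. -/
lemma fc_of_primitive {F g : ℝ → ℝ} (hg : BoundedVariationOn g (Set.Icc 0 (2 * Real.pi)))
    (hF : ∀ x ∈ Set.Icc (0 : ℝ) (2 * Real.pi), F x = F 0 + ∫ y in (0 : ℝ)..x, g y)
    (hp : F (2 * Real.pi) = F 0) (m : ℤ) :
    fc (fun x => g x) m = Complex.I * m * fc (fun x => F x) m := by
  have hpi : (0 : ℝ) ≤ 2 * Real.pi := by positivity
  have hi := intervalIntegrable_of_boundedVariation hpi hg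
  have hcont : ContinuousOn F (Set.uIcc 0 (2 * Real.pi)) := by
    have h1 : IntegrableOn g (Set.uIcc 0 (2 * Real.pi)) := by
      rw [Set.uIcc_of_le hpi]
      exact (intervalIntegrable_iff_integrableOn_Icc_of_le hpi).1 hi
    have := intervalIntegral.continuousOn_primitive_interval h1
    refine (continuousOn_const (c := F 0)|>.add this).congr ?_
    intro x hx
    rw [Set.uIcc_of_le hpi] at hx
    exact hF x hx
  refine fc_eq_of_hasDerivAt (Complex.continuous_ofReal.comp_continuousOn hcont)
    (countable_not_continuousAt hg) ?_ ⟨hi.1.ofReal, hi.2.ofReal⟩ (by simp [hp]) m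
  rintro x ⟨hx, hx'⟩
  have hc : ContinuousAt g x := by
    by_contra hc; exact hx' ⟨hx, hc⟩
  refine HasDerivAt.ofReal_comp ?_
  have hix : IntervalIntegrable g volume 0 x :=
    hi.mono_set (by
      rw [Set.uIcc_of_le hpi, Set.uIcc_of_le hx.1.le]; exact Set.Icc_subset_Icc_right hx.2.le)
  have hsm : StronglyMeasurableAtFilter g (nhds x) volume := by
    refine ⟨Set.Ioc 0 (2 * Real.pi), Ioc_mem_nhds hx.1 hx.2, ?_⟩
    exact hi.aestronglyMeasurable_restrict_uIoc.mono_measure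
      (by rw [Set.uIoc_of_le hpi])
  have h1 := (intervalIntegral.integral_hasDerivAt_right hix hsm hc).const_add (F 0)
  refine h1.congr_of_eventuallyEq ?_
  filter_upwards [Icc_mem_nhds hx.1 hx.2] with y hy using hF y hy

/-- Cut `[0, 2π]` into |m| full periods of the character. On each period the character has mean
zero, so a value of `g` may be subtracted and the integral is at most the variation there times the
length. The variations add up to at most `V`. -/
lemma norm_fc_le_of_boundedVariation {g : ℝ → ℝ} {V : NNReal}
    (hg : eVariationOn g (Set.Icc 0 (2 * Real.pi)) ≤ (V : ENNReal)) {m : ℤ} (hm : m ≠ 0) :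
    ‖fc (fun x => g x) m‖ ≤ V / |(m : ℝ)| := by
  have hpi : (0 : ℝ) ≤ 2 * Real.pi := by positivity
  have hbv : BoundedVariationOn g (Set.Icc 0 (2 * Real.pi)) := ne_top_of_le_ne_top (by simp) hg
  have hi := intervalIntegrable_of_boundedVariation hpi hbv
  set n : ℕ := m.natAbs with hn
  have hn0 : (0 : ℝ) < n := by
    have : 0 < n := Int.natAbs_pos.2 hm
    exact_mod_cast this
  have hnm : |(m : ℝ)| = n := by rw [hn, Nat.cast_natAbs]; simp
  set δ : ℝ := 2 * Real.pi / n with hδ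
  have hδ0 : 0 ≤ δ := by positivity
  set a : ℕ → ℝ := fun k => k * δ with ha
  have hmono : Monotone a := fun i j hij => by
    simp only [ha]; gcongr
  have hnδ : a n = 2 * Real.pi := by simp only [ha, hδ]; field_simp
  have ha0 : a 0 = 0 := by simp [ha]
  have hstep : ∀ k, a (k + 1) - a k = δ := fun k => by simp only [ha]; push_cast; ring
  have hsub : ∀ k < n, Set.Icc (a k) (a (k + 1)) ⊆ Set.Icc 0 (2 * Real.pi) := by
    intro k hk
    rw [← hnδ, ← ha0]
    exact Set.Icc_subset_Icc (hmono (Nat.zero_le k)) (hmono hk)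
  have hik : ∀ k < n, IntervalIntegrable (fun x => (g x : ℂ)) volume (a k) (a (k + 1)) := by
    intro k hk
    have h1 : IntervalIntegrable g volume (a k) (a (k + 1)) := hi.mono_set (by
      rw [Set.uIcc_of_le hpi, Set.uIcc_of_le (hmono (Nat.le_succ k))]; exact hsub k hk)
    exact ⟨h1.1.ofReal, h1.2.ofReal⟩
  have hie : ∀ k < n, IntervalIntegrable (fun x => (g x : ℂ) * ex (-m) x) volume (a k) (a (k + 1)) :=
    fun k hk => (hik k hk).mul_continuousOn (continuous_ex _).continuousOn
  have hexk : ∀ k, ex (-m) (a (k + 1)) = ex (-m) (a k) := by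
    intro k
    have h1 : ex (-m) δ = 1 := by
      rw [ex, Complex.exp_eq_one_iff]
      refine ⟨-Int.sign m, ?_⟩
      have h2 : (m : ℂ) = Int.sign m * n := by
        have h4 := congrArg (Int.cast (R := ℂ)) (Int.sign_mul_natAbs m).symm
        rwa [Int.cast_mul, Int.cast_natCast] at h4
      have hn' : (n : ℂ) ≠ 0 := by exact_mod_cast hn0.ne'
      simp only [hδ]; push_cast; rw [h2]; field_simp
    have h3 : a (k + 1) = a k + δ := by linarith [hstep k]
    rw [h3, ex, show Complex.I * ((-m : ℤ) : ℂ) * ((a k + δ : ℝ) : ℂ) =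
      Complex.I * ((-m : ℤ) : ℂ) * (a k : ℂ) + Complex.I * ((-m : ℤ) : ℂ) * (δ : ℂ) by
        push_cast; ring, Complex.exp_add]
    change _ * ex (-m) δ = _
    rw [h1, mul_one, ex]
  have hpiece : ∀ k < n, ‖∫ x in (a k)..(a (k + 1)), (g x : ℂ) * ex (-m) x‖ ≤
      (eVariationOn g (Set.Icc (a k) (a (k + 1)))).toReal * δ := by
    intro k hk
    have hz := integral_ex_eq_zero (n := -m) (by simpa using hm) (hexk k)
    have e1 : ∫ x in (a k)..(a (k + 1)), (g x : ℂ) * ex (-m) x =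
        ∫ x in (a k)..(a (k + 1)), ((g x : ℂ) - g (a k)) * ex (-m) x := by
      have hc : IntervalIntegrable (fun x => (g (a k) : ℂ) * ex (-m) x) volume (a k) (a (k + 1)) :=
        (continuous_const.mul (continuous_ex _)).intervalIntegrable _ _
      simp_rw [sub_mul]
      rw [intervalIntegral.integral_sub (hie k hk) hc, intervalIntegral.integral_const_mul, hz]
      simp
    rw [e1]
    refine (intervalIntegral.norm_integral_le_of_norm_le_const (C :=
      (eVariationOn g (Set.Icc (a k) (a (k + 1)))).toReal) ?_).trans ?_
    · intro x hx
      have hkk := hmono (Nat.le_succ k)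
      rw [Set.uIoc_of_le hkk] at hx
      have hbk : BoundedVariationOn g (Set.Icc (a k) (a (k + 1))) := hbv.mono (hsub k hk)
      rw [norm_mul, norm_ex, mul_one, ← Complex.ofReal_sub, Complex.norm_real, Real.norm_eq_abs,
        ← Real.dist_eq]
      exact hbk.dist_le (Set.Ioc_subset_Icc_self hx) ⟨le_rfl, hkk⟩
    · rw [hstep k, abs_of_nonneg hδ0]
  have hsum := intervalIntegral.sum_integral_adjacent_intervals hie
  rw [ha0, hnδ] at hsum
  have hvar : ∑ k ∈ Finset.range n, (eVariationOn g (Set.Icc (a k) (a (k + 1)))).toReal ≤ V := by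
    rw [← ENNReal.toReal_sum (fun k hk => hbv.mono (hsub k (Finset.mem_range.1 hk))),
      eVariationOn.sum' g hmono, ha0, hnδ]
    exact ENNReal.toReal_le_coe_of_le_coe hg
  rw [fc, ← hsum, norm_mul, hnm]
  have hb : ‖∑ k ∈ Finset.range n, ∫ x in (a k)..(a (k + 1)), (g x : ℂ) * ex (-m) x‖ ≤ V * δ := by
    refine (norm_sum_le _ _).trans ((Finset.sum_le_sum fun k hk =>
      hpiece k (Finset.mem_range.1 hk)).trans ?_)
    rw [← Finset.sum_mul]; gcongr
  have hc : ‖(1 / (2 * Real.pi : ℂ))‖ = 1 / (2 * Real.pi) := by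
    rw [norm_div]; simp [abs_of_pos Real.pi_pos]
  rw [hc]
  calc 1 / (2 * Real.pi) * _ ≤ 1 / (2 * Real.pi) * (V * δ) := by gcongr
    _ = V / n := by simp only [hδ]; field_simp

lemma InClassC.iteratedDeriv_two_pi {s : ℕ} {V : NNReal} {f : ℝ → ℝ} (hf : InClassC s V f) (k : ℕ) :
    Function.Periodic (iteratedDeriv k f) (2 * Real.pi) := by
  intro x
  have h := iteratedDeriv_comp_add_const k f (2 * Real.pi)
  rw [show (fun z => f (z + 2 * Real.pi)) = f from funext hf.1] at h
  exact (congrFun h x).symm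

lemma InClassC.fc_iteratedDeriv {s : ℕ} {V : NNReal} {f : ℝ → ℝ} (hf : InClassC (s + 1) V f) (m : ℤ)
    {k : ℕ} (hks : k ≤ s) : fc (fun x => ((iteratedDeriv k f x : ℝ) : ℂ)) m =
      (Complex.I * m) ^ k * fc (fun x => f x) m := by
  have hcd := hf.2.1
  simp only [Nat.add_sub_cancel] at hcd
  induction k with
  | zero => simp
  | succ k ih =>
    have hc : Continuous (iteratedDeriv (k + 1) f) :=
      hcd.continuous_iteratedDeriv (k + 1) (by exact_mod_cast hks)
    have hdf : Differentiable ℝ (iteratedDeriv k f) :=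
      hcd.differentiable_iteratedDeriv k (by exact_mod_cast hks)
    have := fc_eq_of_hasDerivAt (f := fun x => ((iteratedDeriv k f x : ℝ) : ℂ))
      (f' := fun x => ((iteratedDeriv (k + 1) f x : ℝ) : ℂ)) (s := ∅)
      (Complex.continuous_ofReal.comp hdf.continuous).continuousOn Set.countable_empty
      (fun x _ => by
        refine HasDerivAt.ofReal_comp ?_
        rw [iteratedDeriv_succ]; exact (hdf x).hasDerivAt)
      ((Complex.continuous_ofReal.comp hc).intervalIntegrable _ _)
      (by have := hf.iteratedDeriv_two_pi k 0; rw [zero_add] at this; rw [this]) m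
    rw [this, ih (by omega)]; ring

/-- The Fourier coefficients of a function of class `C^s` decay like `|m|^{-(s+1)}`. -/
lemma InClassC.norm_fc_le {s : ℕ} {V : NNReal} {f : ℝ → ℝ} (hf : InClassC (s + 1) V f) {m : ℤ}
    (hm : m ≠ 0) : ‖fc (fun x => f x) m‖ ≤ V / |(m : ℝ)| ^ (s + 2) := by
  have hP := hf.iteratedDeriv_two_pi s 0
  have hk := hf.fc_iteratedDeriv m le_rfl
  obtain ⟨-, -, g, hV, hg⟩ := hf
  simp only [Nat.add_sub_cancel] at hg
  have hbv : BoundedVariationOn g (Set.Icc 0 (2 * Real.pi)) := ne_top_of_le_ne_top (by simp) hV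
  rw [zero_add] at hP
  -- The exponent s + 2 counts s classical derivatives, one more for the primitive of `g`, and one
  -- for the bounded variation of `g`.
  have hgF := fc_of_primitive hbv hg hP m
  rw [hk] at hgF
  have hb := norm_fc_le_of_boundedVariation hV hm
  have hm0 : 0 < |(m : ℝ)| := by simpa using hm
  have hI : ‖Complex.I * (m : ℂ)‖ = |(m : ℝ)| := by simp
  rw [hgF, norm_mul, hI, norm_mul, norm_pow, hI, le_div_iff₀ hm0] at hb
  rw [le_div_iff₀ (by positivity)]
  calc _ = |(m : ℝ)| * (|(m : ℝ)| ^ s * ‖fc (fun x => (f x : ℂ)) m‖) * |(m : ℝ)| := by ring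
    _ ≤ V := hb

/-- Fourier inversion. -/
lemma hasSum_fc {f : ℝ → ℂ} (hf : Continuous f) (hp : Function.Periodic f (2 * Real.pi))
    (hs : Summable (fc f)) (x : ℝ) : HasSum (fun m => fc f m * ex m x) (f x) := by
  have : Fact (0 < 2 * Real.pi) := ⟨by positivity⟩
  let F : C(AddCircle (2 * Real.pi), ℂ) := ⟨hp.lift, hf.quotient_lift _⟩
  have hF : ∀ y : ℝ, F (y : AddCircle (2 * Real.pi)) = f y := fun y => rfl
  have hex : ∀ (m : ℤ) (y : ℝ), (fourier m) (y : AddCircle (2 * Real.pi)) = ex m y := by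
    intro m y
    rw [fourier_coe_apply, ex]
    congr 1
    have : (Real.pi : ℂ) ≠ 0 := by exact_mod_cast Real.pi_ne_zero
    push_cast; field_simp
  have hco : fourierCoeff (⇑F) = fc f := by
    funext m
    rw [fourierCoeff_eq_intervalIntegral F m 0, fc, zero_add, Complex.real_smul]
    congr 1
    · push_cast; rfl
    · refine intervalIntegral.integral_congr fun y _ => ?_
      simp only [hF, hex, smul_eq_mul]; ring
  have h := has_pointwise_sum_fourier_series_of_summable (f := F) (by rw [hco]; exact hs) x
  simpa [hco, hF, hex] using h

/-- The Fourier coefficients of an absolutely convergent Fourier series. -/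
lemma fc_of_hasSum {c : ℤ → ℂ} (hc : Summable fun m => ‖c m‖) {f : ℝ → ℂ}
    (hf : ∀ x, HasSum (fun m => c m * ex m x) (f x)) (m : ℤ) : fc f m = c m := by
  have h : HasSum (fun n => ∫ x in (0 : ℝ)..(2 * Real.pi), c n * ex n x * ex (-m) x)
      (∫ x in (0 : ℝ)..(2 * Real.pi), f x * ex (-m) x) := by
    refine intervalIntegral.hasSum_integral_of_dominated_convergence (fun n _ => ‖c n‖) ?_ ?_ ?_ ?_ ?_
    · intro n
      exact ((continuous_const.mul (continuous_ex n)).mul (continuous_ex _)).aestronglyMeasurable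
    · intro n; filter_upwards with x _; simp
    · filter_upwards with x _ using hc
    · exact intervalIntegrable_const
    · filter_upwards with x _ using (hf x).mul_right _
  have h2 : ∀ n, ∫ x in (0 : ℝ)..(2 * Real.pi), c n * ex n x * ex (-m) x =
      if n = m then c m * (2 * Real.pi) else 0 := by
    intro n
    simp_rw [mul_assoc, ← ex_add]
    rw [intervalIntegral.integral_const_mul, integral_ex]
    by_cases h : n = m
    · simp [h]
    · rw [if_neg (by omega), if_neg h]; simp
  simp_rw [h2] at h
  have h3 := h.unique (hasSum_ite_eq m (c m * (2 * Real.pi : ℂ)))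
  have : (Real.pi : ℂ) ≠ 0 := by exact_mod_cast Real.pi_ne_zero
  rw [fc, h3]; field_simp

end
end Airy

/-! ### The algebra of functions with polynomially decaying Fourier coefficients. -/

namespace Airy
noncomputable section
open MeasureTheory

/-- The weight `1 + |m|`. -/
def wt (m : ℤ) : ℝ := 1 + |(m : ℝ)|

lemma one_le_wt (m : ℤ) : 1 ≤ wt m := by unfold wt; linarith [abs_nonneg (m : ℝ)]

lemma wt_pos (m : ℤ) : 0 < wt m := by linarith [one_le_wt m]

lemma abs_le_wt (m : ℤ) : |(m : ℝ)| ≤ wt m := by unfold wt; linarith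

lemma wt_le_two_mul_abs {m : ℤ} (hm : m ≠ 0) : wt m ≤ 2 * |(m : ℝ)| := by
  have : (1 : ℝ) ≤ |(m : ℝ)| := by exact_mod_cast Int.one_le_abs hm
  unfold wt; linarith

lemma wt_le_add (m l : ℤ) : wt m ≤ wt l + wt (m - l) := by
  have h := abs_add_le (l : ℝ) ((m - l : ℤ) : ℝ)
  rw [show (l : ℝ) + ((m - l : ℤ) : ℝ) = m by push_cast; ring] at h
  unfold wt; linarith

lemma summable_inv_wt_sq : Summable fun m : ℤ => 1 / wt m ^ 2 := by
  have h : Summable fun m : ℤ => 1 / (m : ℝ) ^ 2 := Real.summable_one_div_int_pow.2 (by norm_num)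
  refine Summable.of_norm_bounded_eventually h ?_
  have : ∀ᶠ m : ℤ in Filter.cofinite, m ≠ 0 := by
    filter_upwards [(Set.finite_singleton (0 : ℤ)).eventually_cofinite_notMem] with m hm using hm
  filter_upwards [this] with m hm
  have hw := wt_pos m
  have hm' : 0 < |(m : ℝ)| := by simpa using hm
  rw [Real.norm_of_nonneg (by positivity), ← sq_abs (m : ℝ)]
  gcongr
  exact abs_le_wt m

/-- The sum of `1 / (1 + |m|)²`. -/
def wsum : ℝ := ∑' m : ℤ, 1 / wt m ^ 2

lemma one_le_wsum : 1 ≤ wsum := by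
  have := summable_inv_wt_sq.le_tsum 0 (fun m _ => by have := wt_pos m; positivity)
  simpa [wt, wsum] using this

lemma sum_inv_wt_sq_le (s : Finset ℤ) : ∑ m ∈ s, 1 / wt m ^ 2 ≤ wsum :=
  summable_inv_wt_sq.sum_le_tsum s (fun m _ => by have := wt_pos m; positivity)

lemma inv_wt_pow_le {s t : ℕ} (h : s ≤ t) (m : ℤ) : 1 / wt m ^ t ≤ 1 / wt m ^ s := by
  have := wt_pos m
  gcongr
  exact one_le_wt m

lemma div_wt_pow_le {s t : ℕ} {K : ℝ} (hK : 0 ≤ K) (h : s ≤ t) (m : ℤ) :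
    K / wt m ^ t ≤ K / wt m ^ s := by
  have := mul_le_mul_of_nonneg_left (inv_wt_pow_le h m) hK
  simpa [div_eq_mul_inv] using this

lemma summable_of_decay {c : ℤ → ℂ} {s : ℕ} {K : ℝ} (hs : 2 ≤ s) (h : ∀ m, ‖c m‖ ≤ K / wt m ^ s) :
    Summable fun m => ‖c m‖ := by
  have hK : 0 ≤ K := by simpa [wt] using (norm_nonneg _).trans (h 0)
  refine Summable.of_nonneg_of_le (fun m => norm_nonneg _)
    (fun m => (h m).trans (div_wt_pow_le hK hs m)) ?_
  simpa [div_eq_mul_inv] using summable_inv_wt_sq.mul_left K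

lemma tsum_norm_le_of_decay {c : ℤ → ℂ} {s : ℕ} {K : ℝ} (hs : 2 ≤ s)
    (h : ∀ m, ‖c m‖ ≤ K / wt m ^ s) : ∑' m, ‖c m‖ ≤ K * wsum := by
  have hK : 0 ≤ K := by simpa [wt] using (norm_nonneg _).trans (h 0)
  rw [wsum, ← tsum_mul_left]
  refine (summable_of_decay hs h).tsum_le_tsum (fun m => ?_) (summable_inv_wt_sq.mul_left K)
  simpa [div_eq_mul_inv] using (h m).trans (div_wt_pow_le hK hs m)

/-- `f` is the sum of its Fourier series, and its Fourier coefficients are bounded by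
`K / (1 + |m|)^s`. -/
structure WC (s : ℕ) (K : ℝ) (f : ℝ → ℂ) : Prop where
  sum : ∀ x, HasSum (fun m => fc f m * ex m x) (f x)
  decay : ∀ m, ‖fc f m‖ ≤ K / wt m ^ s

namespace WC
variable {s t : ℕ} {K K' : ℝ} {f g : ℝ → ℂ}

/-- By uniqueness of coefficients, any absolutely convergent trigonometric expansion is the Fourier
series. Sums and products are therefore handled by exhibiting an expansion. -/
lemma of_hasSum (hs : 2 ≤ s) {c : ℤ → ℂ} (hf : ∀ x, HasSum (fun m => c m * ex m x) (f x))
    (h : ∀ m, ‖c m‖ ≤ K / wt m ^ s) : WC s K f := by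
  have := fc_of_hasSum (summable_of_decay hs h) hf
  constructor
  · simpa [this] using hf
  · simpa [this] using h

lemma nonneg (h : WC s K f) : 0 ≤ K := by simpa [wt] using (norm_nonneg _).trans (h.decay 0)

lemma mono (h : WC s K f) (hts : t ≤ s) (hK : K ≤ K') : WC t K' f :=
  ⟨h.sum, fun m => (h.decay m).trans ((div_wt_pow_le h.nonneg hts m).trans (by
    have := wt_pos m; gcongr))⟩

lemma summable (h : WC s K f) (hs : 2 ≤ s) : Summable fun m => ‖fc f m‖ :=
  summable_of_decay hs h.decay

lemma norm_le (h : WC s K f) (hs : 2 ≤ s) (x : ℝ) : ‖f x‖ ≤ K * wsum := by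
  rw [← (h.sum x).tsum_eq]
  refine (norm_tsum_le_tsum_norm ?_).trans ?_
  · simpa using h.summable hs
  · simpa using tsum_norm_le_of_decay hs h.decay

lemma hasSum_add (hf : WC s K f) (hg : WC t K' g) (x : ℝ) :
    HasSum (fun m => (fc f m + fc g m) * ex m x) (f x + g x) := by
  simpa [add_mul] using (hf.sum x).add (hg.sum x)

lemma fc_add (hf : WC s K f) (hg : WC t K' g) (hs : 2 ≤ s) (ht : 2 ≤ t) (m : ℤ) :
    fc (fun x => f x + g x) m = fc f m + fc g m :=
  fc_of_hasSum (c := fun m => fc f m + fc g m) (Summable.of_nonneg_of_le (fun _ => norm_nonneg _)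
    (fun _ => norm_add_le _ _) ((hf.summable hs).add (hg.summable ht))) (hf.hasSum_add hg) m

lemma add (hs : 2 ≤ s) (hf : WC s K f) (hg : WC s K' g) : WC s (K + K') (fun x => f x + g x) :=
  of_hasSum hs (hf.hasSum_add hg) fun m =>
    (norm_add_le _ _).trans (by rw [add_div]; exact add_le_add (hf.decay m) (hg.decay m))

lemma hasSum_const_mul (hf : WC s K f) (a : ℂ) (x : ℝ) :
    HasSum (fun m => (a * fc f m) * ex m x) (a * f x) := by
  simpa [mul_assoc] using (hf.sum x).mul_left a

lemma fc_const_mul (hf : WC s K f) (hs : 2 ≤ s) (a : ℂ) (m : ℤ) :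
    fc (fun x => a * f x) m = a * fc f m :=
  fc_of_hasSum (c := fun m => a * fc f m) (by simpa using (hf.summable hs).mul_left ‖a‖)
    (hf.hasSum_const_mul a) m

lemma const_mul (hs : 2 ≤ s) (hf : WC s K f) (a : ℂ) : WC s (‖a‖ * K) (fun x => a * f x) :=
  of_hasSum hs (hf.hasSum_const_mul a) fun m => by
    rw [norm_mul, mul_div_assoc]
    exact mul_le_mul_of_nonneg_left (hf.decay m) (norm_nonneg a)

lemma sub (hs : 2 ≤ s) (hf : WC s K f) (hg : WC s K' g) : WC s (K + K') (fun x => f x - g x) := by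
  simpa [sub_eq_add_neg] using hf.add hs (hg.const_mul hs (-1))

lemma fc_sub (hf : WC s K f) (hg : WC t K' g) (hs : 2 ≤ s) (ht : 2 ≤ t) (m : ℤ) :
    fc (fun x => f x - g x) m = fc f m - fc g m := by
  have := hf.fc_add (hg.const_mul ht (-1)) hs ht m
  rw [hg.fc_const_mul ht] at this
  simpa [sub_eq_add_neg] using this

/-- The coefficients of the product are a convolution. Since `wt n ≤ wt l + wt (n - l)`, the larger
of the two weights is at least `wt n / 2`, which yields the decay in n at the price `2 ^ s`. The
other factor is summable because s ≥ 2, and the two cases together give `2 * wsum`. -/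
lemma mul (hs : 2 ≤ s) (hf : WC s K f) (hg : WC s K' g) :
    WC s (2 ^ (s + 1) * wsum * K * K') (fun x => f x * g x) := by
  have hsf := hf.summable hs
  have hsg := hg.summable hs
  -- The pair (n, l) goes to (l, n - l), so that summing over l for fixed n collects the terms of
  -- frequency n.
  let e : ℤ × ℤ ≃ ℤ × ℤ :=
    { toFun := fun p => (p.2, p.1 - p.2)
      invFun := fun p => (p.1 + p.2, p.1)
      left_inv := fun p => by ext <;> simp
      right_inv := fun p => by ext <;> simp }
  have hprod : Summable fun p : ℤ × ℤ => ‖fc f p.1‖ * ‖fc g p.2‖ :=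
    hsf.mul_of_nonneg hsg (fun _ => norm_nonneg _) (fun _ => norm_nonneg _)
  have hprod' : Summable fun p : ℤ × ℤ => ‖fc f p.2 * fc g (p.1 - p.2)‖ := by
    have := (e.summable_iff).2 hprod
    simpa [Function.comp_def, e] using this
  have hrow : ∀ n, Summable fun l => ‖fc f l * fc g (n - l)‖ := fun n => hprod'.prod_factor n
  have hK := hf.nonneg
  have hK' := hg.nonneg
  refine of_hasSum (c := fun n => ∑' l, fc f l * fc g (n - l)) hs (fun x => ?_) (fun n => ?_)
  · have hA : Summable fun m => ‖fc f m * ex m x‖ := by simpa using hsf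
    have hB : Summable fun m => ‖fc g m * ex m x‖ := by simpa using hsg
    have h1 : HasSum (fun p : ℤ × ℤ => fc f p.1 * ex p.1 x * (fc g p.2 * ex p.2 x)) (f x * g x) := by
      have hs := summable_mul_of_summable_norm hA hB
      have := tsum_mul_tsum_of_summable_norm hA hB
      rw [(hf.sum x).tsum_eq, (hg.sum x).tsum_eq] at this
      rw [this]; exact hs.hasSum
    have h2 := (e.hasSum_iff).2 h1
    have h3 := h2.prod_fiberwise (g := fun n => (∑' l, fc f l * fc g (n - l)) * ex n x) ?_
    · exact h3
    · intro n
      have := ((hrow n).of_norm.hasSum).mul_right (ex n x)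
      have hfun : (fun l => fc f l * fc g (n - l) * ex n x) = fun l =>
          ((fun p : ℤ × ℤ => fc f p.1 * ex p.1 x * (fc g p.2 * ex p.2 x)) ∘ e) (n, l) := by
        funext l
        change _ = fc f l * ex l x * (fc g (n - l) * ex (n - l) x)
        rw [show ex n x = ex l x * ex (n - l) x by rw [← ex_add]; congr 1; ring]
        ring
      rw [hfun] at this
      exact this
  · have hterm : ∀ l, ‖fc f l * fc g (n - l)‖ ≤
        2 ^ s * K * K' / wt n ^ s * (1 / wt l ^ 2 + 1 / wt (n - l) ^ 2) := by
      intro l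
      have hl := wt_pos l
      have hnl := wt_pos (n - l)
      have hn := wt_pos n
      have hkey : 1 / wt l ^ s * (1 / wt (n - l) ^ s) ≤
          2 ^ s / wt n ^ s * (1 / wt l ^ 2 + 1 / wt (n - l) ^ 2) := by
        have hadd := wt_le_add n l
        rcases le_total (wt l) (wt (n - l)) with h | h
        · have h1 : 1 / wt (n - l) ^ s ≤ 2 ^ s / wt n ^ s := by
            rw [div_le_div_iff₀ (by positivity) (by positivity), one_mul, ← mul_pow]
            gcongr; linarith
          have h2 := inv_wt_pow_le hs l
          calc _ ≤ 1 / wt l ^ 2 * (2 ^ s / wt n ^ s) := by gcongr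
            _ = 2 ^ s / wt n ^ s * (1 / wt l ^ 2) := mul_comm _ _
            _ ≤ _ := by gcongr; linarith [show 0 ≤ 1 / wt (n - l) ^ 2 by positivity]
        · have h1 : 1 / wt l ^ s ≤ 2 ^ s / wt n ^ s := by
            rw [div_le_div_iff₀ (by positivity) (by positivity), one_mul, ← mul_pow]
            gcongr; linarith
          have h2 := inv_wt_pow_le hs (n - l)
          calc _ ≤ 2 ^ s / wt n ^ s * (1 / wt (n - l) ^ 2) := by gcongr
            _ ≤ _ := by gcongr; linarith [show 0 ≤ 1 / wt l ^ 2 by positivity]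
      rw [norm_mul]
      calc _ ≤ K / wt l ^ s * (K' / wt (n - l) ^ s) :=
            mul_le_mul (hf.decay l) (hg.decay _) (norm_nonneg _) (by positivity)
        _ = K * K' * (1 / wt l ^ s * (1 / wt (n - l) ^ s)) := by field_simp
        _ ≤ K * K' * (2 ^ s / wt n ^ s * (1 / wt l ^ 2 + 1 / wt (n - l) ^ 2)) := by gcongr
        _ = _ := by ring
    have hshift : HasSum (fun l => 1 / wt (n - l) ^ 2) wsum :=
      ((Equiv.subLeft n).hasSum_iff (f := fun l => 1 / wt l ^ 2)).2 summable_inv_wt_sq.hasSum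
    have hbd := (summable_inv_wt_sq.hasSum.add hshift).mul_left (2 ^ s * K * K' / wt n ^ s)
    refine (norm_tsum_le_tsum_norm (hrow n)).trans (((hrow n).tsum_le_tsum hterm hbd.summable).trans ?_)
    rw [hbd.tsum_eq, ← wsum]
    apply le_of_eq; ring

lemma pow_three (hs : 2 ≤ s) (hf : WC s K f) :
    WC s (2 ^ (s + 1) * wsum * (2 ^ (s + 1) * wsum * K * K) * K) (fun x => f x ^ 3) := by
  have := (hf.mul hs hf).mul hs hf
  simpa [pow_succ] using this

end WC

end
end Airy

/-! ### The discrete Fourier transform: orthogonality, Parseval and aliasing. -/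

namespace Airy
noncomputable section
open MeasureTheory

section Discrete
variable {N : ℕ}

lemma dft_eq (f : ℤ → ℂ) (m : ℤ) :
    dft N f m = 1 / (N : ℂ) * ∑ k ∈ idx N, f k * ex (-m) (node N k) := by
  simp [dft, ex]

lemma idft_eq (c : ℤ → ℂ) (k : ℤ) : idft N c k = ∑ m ∈ idx N, c m * ex m (node N k) := rfl

lemma specDeriv_eq (f : ℤ → ℂ) (k : ℤ) :
    specDeriv N f k = ∑ m ∈ idx N, Complex.I * m * dft N f m * ex m (node N k) := rfl

lemma ex_node_comm (m k : ℤ) : ex m (node N k) = ex k (node N m) := by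
  simp only [ex, node]; congr 1; push_cast; ring

lemma ex_node_add (m k l : ℤ) : ex m (node N (k + l)) = ex m (node N k) * ex m (node N l) := by
  rw [ex_node_comm, ex_add, ex_node_comm, ex_node_comm (N := N) l]

lemma ex_mul_node (hN : 0 < N) (q k : ℤ) : ex (N * q) (node N k) = 1 := by
  have : (N : ℂ) ≠ 0 := by exact_mod_cast hN.ne'
  rw [ex, Complex.exp_eq_one_iff]
  refine ⟨q * k, ?_⟩
  simp only [node, mesh]; push_cast; field_simp

lemma ex_node_one_ne {m : ℤ} (hN : 0 < N) (h : ¬ (N : ℤ) ∣ m) : ex m (node N 1) ≠ 1 := by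
  intro he
  rw [ex, Complex.exp_eq_one_iff] at he
  obtain ⟨n, hn⟩ := he
  apply h
  refine ⟨n, ?_⟩
  have h1 : (N : ℂ) ≠ 0 := by exact_mod_cast hN.ne'
  have h2 : (Real.pi : ℂ) ≠ 0 := by exact_mod_cast Real.pi_ne_zero
  simp only [node, mesh] at hn
  push_cast at hn
  field_simp at hn
  exact_mod_cast hn

lemma sum_idx {E : Type*} [AddCommMonoid E] (he : Even N) (f : ℤ → E) :
    ∑ k ∈ idx N, f k = ∑ i ∈ Finset.range N, f ((1 - (N : ℤ) / 2) + i) := by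
  obtain ⟨M, rfl⟩ := he
  symm
  refine Finset.sum_bij (fun i _ => (1 - ((M + M : ℕ) : ℤ) / 2) + i) ?_ ?_ ?_ ?_
  · intro i hi
    simp only [Finset.mem_range] at hi
    simp only [idx, Finset.mem_Ioc]; omega
  · intro i _ j _ h; simpa using h
  · intro k hk
    simp only [idx, Finset.mem_Ioc] at hk
    refine ⟨(k - (1 - ((M + M : ℕ) : ℤ) / 2)).toNat, ?_, ?_⟩
    · simp only [Finset.mem_range]; omega
    · omega
  · intros; rfl

lemma card_idx (he : Even N) : (idx N).card = N := by
  have := sum_idx he (fun _ => 1)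
  simpa using this

lemma sum_ex_node (hN : 0 < N) (he : Even N) (m : ℤ) :
    ∑ k ∈ idx N, ex m (node N k) = if (N : ℤ) ∣ m then (N : ℂ) else 0 := by
  split_ifs with h
  · obtain ⟨q, rfl⟩ := h
    simp [ex_mul_node hN, card_idx he]
  · rw [sum_idx he]
    have hp : ∀ i : ℕ, ex m (node N i) = ex m (node N 1) ^ i := by
      intro i
      induction i with
      | zero => simp [node]
      | succ i ih => push_cast; rw [ex_node_add, ih, pow_succ]
    simp_rw [ex_node_add, hp, ← Finset.mul_sum]
    have h1 : ex m (node N N) = 1 := by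
      rw [ex_node_comm]
      simpa using ex_mul_node hN 1 m
    rw [geom_sum_eq (ex_node_one_ne hN h), ← hp, h1, sub_self, zero_div, mul_zero]

lemma idx_dvd_iff {m n : ℤ} (hm : m ∈ idx N) (hn : n ∈ idx N) : (N : ℤ) ∣ n - m ↔ n = m := by
  simp only [idx, Finset.mem_Ioc] at hm hn
  constructor
  · intro h
    have h2 : |n - m| < N := by rw [abs_lt]; constructor <;> omega
    have := Int.eq_zero_of_abs_lt_dvd h h2
    omega
  · rintro rfl; simp

lemma abs_le_of_mem_idx {m : ℤ} (hm : m ∈ idx N) : |(m : ℝ)| ≤ N / 2 := by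
  simp only [idx, Finset.mem_Ioc] at hm
  have h1 : 2 * m ≤ N := by omega
  have h2 : -(N : ℤ) ≤ 2 * m := by omega
  have h1' : 2 * (m : ℝ) ≤ N := by exact_mod_cast h1
  have h2' : -(N : ℝ) ≤ 2 * m := by exact_mod_cast h2
  rw [abs_le]; constructor <;> linarith

lemma dft_idft (hN : 0 < N) (he : Even N) (c : ℤ → ℂ) {m : ℤ} (hm : m ∈ idx N) :
    dft N (idft N c) m = c m := by
  have hN' : (N : ℂ) ≠ 0 := by exact_mod_cast hN.ne'
  rw [dft_eq]
  simp_rw [idft_eq, Finset.sum_mul]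
  rw [Finset.sum_comm]
  have : ∀ n ∈ idx N, ∑ k ∈ idx N, c n * ex n (node N k) * ex (-m) (node N k) =
      if n = m then c m * N else 0 := by
    intro n hn
    simp_rw [mul_assoc, ← ex_add]
    rw [← Finset.mul_sum, sum_ex_node hN he, ← sub_eq_add_neg]
    by_cases h : n = m
    · subst h; simp
    · rw [if_neg (by rwa [idx_dvd_iff hm hn]), if_neg h, mul_zero]
  rw [Finset.sum_congr rfl this, Finset.sum_ite_eq' , if_pos hm]
  field_simp

lemma idft_dft (hN : 0 < N) (he : Even N) (f : ℤ → ℂ) {k : ℤ} (hk : k ∈ idx N) :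
    idft N (dft N f) k = f k := by
  have hN' : (N : ℂ) ≠ 0 := by exact_mod_cast hN.ne'
  rw [idft_eq]
  simp_rw [dft_eq, Finset.mul_sum, Finset.sum_mul]
  rw [Finset.sum_comm]
  have : ∀ l ∈ idx N, ∑ m ∈ idx N, 1 / (N : ℂ) * (f l * ex (-m) (node N l)) * ex m (node N k) =
      if l = k then f k else 0 := by
    intro l hl
    have h1 : ∀ m : ℤ, 1 / (N : ℂ) * (f l * ex (-m) (node N l)) * ex m (node N k) =
        1 / (N : ℂ) * f l * ex (k - l) (node N m) := by
      intro m
      have h2 : ex (-m) (node N l) = ex (-l) (node N m) := by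
        simp only [ex, node]; congr 1; push_cast; ring
      rw [h2, ex_node_comm (N := N) m k, sub_eq_add_neg, ex_add]; ring
    simp_rw [h1]
    rw [← Finset.mul_sum, sum_ex_node hN he]
    by_cases h : l = k
    · subst h; simp; field_simp
    · rw [if_neg (by rw [idx_dvd_iff hl hk]; exact fun h' => h h'.symm), if_neg h, mul_zero]
  rw [Finset.sum_congr rfl this, Finset.sum_ite_eq', if_pos hk]

lemma conj_ex (m : ℤ) (x : ℝ) : (starRingEnd ℂ) (ex m x) = ex (-m) x := by
  rw [ex, ← Complex.exp_conj, ex]; congr 1; simp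

/-- This symmetry, applied to the real coefficient of the linearised equation, is what makes the
operators S skew and Q symmetric. -/
lemma dft_conj (f : ℤ → ℂ) (hf : ∀ k, (starRingEnd ℂ) (f k) = f k) (m : ℤ) :
    (starRingEnd ℂ) (dft N f m) = dft N f (-m) := by
  rw [dft_eq, dft_eq]
  simp [conj_ex, hf, map_sum]

lemma sum_norm_idft_sq (hN : 0 < N) (he : Even N) (c : ℤ → ℂ) :
    ∑ k ∈ idx N, ‖idft N c k‖ ^ 2 = N * ∑ m ∈ idx N, ‖c m‖ ^ 2 := by
  have h : ((∑ k ∈ idx N, ‖idft N c k‖ ^ 2 : ℝ) : ℂ) = ((N * ∑ m ∈ idx N, ‖c m‖ ^ 2 : ℝ) : ℂ) := by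
    push_cast
    simp_rw [← Complex.conj_mul', idft_eq, map_sum, map_mul, conj_ex, Finset.sum_mul_sum]
    rw [Finset.sum_comm, Finset.mul_sum]
    refine Finset.sum_congr rfl fun m hm => ?_
    rw [Finset.sum_comm]
    have : ∀ n ∈ idx N, ∑ k ∈ idx N, (starRingEnd ℂ) (c m) * ex (-m) (node N k) *
        (c n * ex n (node N k)) = if n = m then (starRingEnd ℂ) (c m) * c m * N else 0 := by
      intro n hn
      have h1 : ∀ k, (starRingEnd ℂ) (c m) * ex (-m) (node N k) * (c n * ex n (node N k)) =
          (starRingEnd ℂ) (c m) * c n * ex (n - m) (node N k) := by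
        intro k; rw [sub_eq_add_neg, ex_add]; ring
      simp_rw [h1]
      rw [← Finset.mul_sum, sum_ex_node hN he]
      by_cases h : n = m
      · subst h; simp
      · rw [if_neg (by rwa [idx_dvd_iff hm hn]), if_neg h, mul_zero]
    rw [Finset.sum_congr rfl this, Finset.sum_ite_eq', if_pos hm]; ring
  exact_mod_cast h

lemma sum_norm_sq_eq (hN : 0 < N) (he : Even N) (f : ℤ → ℂ) :
    ∑ k ∈ idx N, ‖f k‖ ^ 2 = N * ∑ m ∈ idx N, ‖dft N f m‖ ^ 2 := by
  rw [← sum_norm_idft_sq hN he]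
  exact Finset.sum_congr rfl fun k hk => by rw [idft_dft hN he f hk]

lemma l2norm_eq (hN : 0 < N) (he : Even N) (f : ℤ → ℂ) :
    l2norm N f = Real.sqrt (2 * Real.pi * ∑ m ∈ idx N, ‖dft N f m‖ ^ 2) := by
  have hN' : (N : ℝ) ≠ 0 := by exact_mod_cast hN.ne'
  rw [l2norm, ← Finset.sum_mul, sum_norm_sq_eq hN he, mesh]
  congr 1; field_simp

lemma dft_sub (f g : ℤ → ℂ) (m : ℤ) : dft N (fun k => f k - g k) m = dft N f m - dft N g m := by
  simp only [dft_eq, sub_mul, Finset.sum_sub_distrib, mul_sub]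

/-- Aliasing. -/
lemma WC.hasSum_dft {s : ℕ} {K : ℝ} {f : ℝ → ℂ} (hf : WC s K f) (hN : 0 < N) (he : Even N) (m : ℤ) :
    HasSum (fun q : ℤ => fc f (m + N * q)) (dft N (fun k => f (node N k)) m) := by
  have hN' : (N : ℂ) ≠ 0 := by exact_mod_cast hN.ne'
  have h1 : HasSum (fun n => 1 / (N : ℂ) * ∑ k ∈ idx N, fc f n * ex n (node N k) * ex (-m) (node N k))
      (dft N (fun k => f (node N k)) m) := by
    rw [dft_eq]
    exact (hasSum_sum fun k _ => (hf.sum (node N k)).mul_right _).mul_left _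
  have h2 : ∀ n, 1 / (N : ℂ) * ∑ k ∈ idx N, fc f n * ex n (node N k) * ex (-m) (node N k) =
      if (N : ℤ) ∣ n - m then fc f n else 0 := by
    intro n
    simp_rw [mul_assoc, ← ex_add]
    rw [← Finset.mul_sum, sum_ex_node hN he, ← sub_eq_add_neg]
    split_ifs
    · field_simp
    · simp
  simp_rw [h2] at h1
  have hinj : Function.Injective fun q : ℤ => m + N * q := by
    intro a b hab
    simpa [hN.ne'] using hab
  have h3 := (hinj.hasSum_iff (f := fun n => if (N : ℤ) ∣ n - m then fc f n else 0) (by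
    intro n hn
    rw [if_neg]
    rintro ⟨q, hq⟩
    exact hn ⟨q, by simp only; omega⟩)).2 h1
  simpa [Function.comp_def] using h3

/-- The error is the sum of the aliases m + Nq with q ≠ 0. As |m| ≤ N/2, these satisfy |m + Nq| ≥
N|q|/2, hence `wt (m + N * q) ≥ N * wt q / 4`; two powers of `wt q` suffice for the sum over q. -/
lemma WC.norm_dft_sub_fc_le {s : ℕ} {K : ℝ} {f : ℝ → ℂ} (hf : WC s K f) (hs : 2 ≤ s) (hN : 0 < N)
    (he : Even N) {m : ℤ} (hm : m ∈ idx N) :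
    ‖dft N (fun k => f (node N k)) m - fc f m‖ ≤ K * 4 ^ s * wsum / N ^ s := by
  have hN' : (0 : ℝ) < N := by exact_mod_cast hN
  have hK := hf.nonneg
  have h := (hf.hasSum_dft hN he m).sub (hasSum_ite_eq 0 (fc f m))
  have hb : ∀ q : ℤ, ‖fc f (m + N * q) - (if q = 0 then fc f m else 0)‖ ≤
      K * 4 ^ s / N ^ s * (1 / wt q ^ 2) := by
    intro q
    have hq := wt_pos q
    by_cases hq0 : q = 0
    · subst hq0; simp; positivity
    · rw [if_neg hq0, sub_zero]
      refine (hf.decay _).trans ?_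
      have hlow : N * wt q / 4 ≤ wt (m + N * q) := by
        have h1 := wt_le_two_mul_abs hq0
        have h2 : |(N * q : ℝ)| ≤ |(m + N * q : ℝ)| + |(m : ℝ)| := by
          have := abs_sub (m + N * q : ℝ) m
          simpa using this
        have h3 := abs_le_of_mem_idx hm
        rw [abs_mul, abs_of_pos hN'] at h2
        have h4 : (1 : ℝ) ≤ |(q : ℝ)| := by exact_mod_cast Int.one_le_abs hq0
        unfold wt at h1 ⊢
        push_cast
        nlinarith
      have hw := wt_pos (m + N * q)
      calc K / wt (m + N * q) ^ s ≤ K / (N * wt q / 4) ^ s := by gcongr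
        _ = K * 4 ^ s / N ^ s * (1 / wt q ^ s) := by rw [div_pow, mul_pow]; field_simp
        _ ≤ _ := by
          have := inv_wt_pow_le hs q
          gcongr
  have hsum := summable_inv_wt_sq.mul_left (K * 4 ^ s / N ^ s)
  have hn : Summable fun q : ℤ => ‖fc f (m + N * q) - (if q = 0 then fc f m else 0)‖ :=
    Summable.of_nonneg_of_le (fun _ => norm_nonneg _) hb hsum
  rw [← h.tsum_eq]
  refine (norm_tsum_le_tsum_norm hn).trans ((hn.tsum_le_tsum hb hsum).trans ?_)
  rw [tsum_mul_left, ← wsum]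
  apply le_of_eq; ring

/-- The distance of `l` to the multiples of `N`, when `|l| ≤ N`. -/
def cdist (N : ℕ) (l : ℤ) : ℝ := min |(l : ℝ)| (N - |(l : ℝ)|)

lemma cdist_nonneg {l : ℤ} (hl : |(l : ℝ)| ≤ N) : 0 ≤ cdist N l :=
  le_min (abs_nonneg _) (by linarith)

/-- Here `l` will be a difference of two wave numbers, so it ranges up to N and the decay can only
be in the distance to the nearest multiple of N. Two of the s + 2 powers are spent on the sum over
the aliases. -/
lemma WC.norm_dft_le {s : ℕ} {K : ℝ} {f : ℝ → ℂ} (hf : WC (s + 2) K f) (hN : 0 < N)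
    (he : Even N) {l : ℤ} (hl : |(l : ℝ)| ≤ N) :
    ‖dft N (fun k => f (node N k)) l‖ ≤ 4 * wsum * K / (1 + cdist N l) ^ s := by
  have hN' : (1 : ℝ) ≤ N := by exact_mod_cast hN
  have hK := hf.nonneg
  have hd := cdist_nonneg hl
  have h := hf.hasSum_dft hN he l
  have hb : ∀ q : ℤ, ‖fc f (l + N * q)‖ ≤ 4 * K / (1 + cdist N l) ^ s * (1 / wt q ^ 2) := by
    intro q
    have hq := wt_pos q
    refine (hf.decay _).trans ?_
    have h2 : |(N * q : ℝ)| ≤ |(l + N * q : ℝ)| + |(l : ℝ)| := by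
      have := abs_sub (l + N * q : ℝ) l
      simpa using this
    rw [abs_mul, abs_of_pos (by linarith)] at h2
    have hlow : 1 + cdist N l ≤ wt (l + N * q) ∧ wt q / 2 ≤ wt (l + N * q) := by
      unfold wt cdist
      push_cast
      by_cases hq0 : q = 0
      · subst hq0
        simp only [Int.cast_zero, mul_zero, add_zero, abs_zero]
        exact ⟨by linarith [min_le_left |(l : ℝ)| (N - |(l : ℝ)|)], by linarith [abs_nonneg (l : ℝ)]⟩
      · have h4 : (1 : ℝ) ≤ |(q : ℝ)| := by exact_mod_cast Int.one_le_abs hq0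
        refine ⟨?_, by nlinarith⟩
        have := min_le_right |(l : ℝ)| (N - |(l : ℝ)|)
        nlinarith
    have hw := wt_pos (l + N * q)
    calc K / wt (l + N * q) ^ (s + 2) = K / (wt (l + N * q) ^ s * wt (l + N * q) ^ 2) := by
          rw [pow_add]
      _ ≤ K / ((1 + cdist N l) ^ s * (wt q / 2) ^ 2) := by
          gcongr
          · exact hlow.1
          · exact hlow.2
      _ = _ := by field_simp; ring
  have hsum := summable_inv_wt_sq.mul_left (4 * K / (1 + cdist N l) ^ s)
  have hn : Summable fun q : ℤ => ‖fc f (l + N * q)‖ :=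
    Summable.of_nonneg_of_le (fun _ => norm_nonneg _) hb hsum
  rw [← h.tsum_eq]
  refine (norm_tsum_le_tsum_norm hn).trans ((hn.tsum_le_tsum hb hsum).trans ?_)
  rw [tsum_mul_left, ← wsum]
  apply le_of_eq; ring

/-- The multiples of N that can be nearest to n - m are -N, 0 and N; each contributes one translate
of the convergent series. -/
lemma sum_inv_cdist_sq_le (s : Finset ℤ) (n : ℤ)
    (hl : ∀ m ∈ s, |((n - m : ℤ) : ℝ)| ≤ N) :
    ∑ m ∈ s, 1 / (1 + cdist N (n - m)) ^ 2 ≤ 3 * wsum := by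
  have hterm : ∀ m ∈ s, 1 / (1 + cdist N (n - m)) ^ 2 ≤
      1 / wt (n - m) ^ 2 + 1 / wt (n - m - N) ^ 2 + 1 / wt (n - m + N) ^ 2 := by
    intro m hm
    have h1 := wt_pos (n - m)
    have h2 := wt_pos (n - m - N)
    have h3 := wt_pos (n - m + N)
    have hm' := hl m hm
    have p1 : 0 ≤ 1 / wt (n - m) ^ 2 := by positivity
    have p2 : 0 ≤ 1 / wt (n - m - N) ^ 2 := by positivity
    have p3 : 0 ≤ 1 / wt (n - m + N) ^ 2 := by positivity
    unfold cdist
    rcases min_choice |((n - m : ℤ) : ℝ)| (N - |((n - m : ℤ) : ℝ)|) with h | h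
    · rw [h]; change 1 / wt (n - m) ^ 2 ≤ _; linarith
    · rw [h]
      rcases abs_cases ((n - m : ℤ) : ℝ) with ⟨ha, _⟩ | ⟨ha, _⟩
      · have : 1 + (N - |((n - m : ℤ) : ℝ)|) = wt (n - m - N) := by
          rw [wt, ha, abs_of_nonpos]
          · push_cast; ring
          · push_cast at *; linarith
        rw [this]; linarith
      · have : 1 + (N - |((n - m : ℤ) : ℝ)|) = wt (n - m + N) := by
          rw [wt, ha, abs_of_nonneg]
          · push_cast; ring
          · push_cast at *; linarith
        rw [this]; linarith
  have hshift : ∀ a : ℤ, ∑ m ∈ s, 1 / wt (a - m) ^ 2 ≤ wsum := by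
    intro a
    have : HasSum (fun l => 1 / wt (a - l) ^ 2) wsum :=
      ((Equiv.subLeft a).hasSum_iff (f := fun l => 1 / wt l ^ 2)).2 summable_inv_wt_sq.hasSum
    exact sum_le_hasSum s (fun m _ => by have := wt_pos (a - m); positivity) this
  refine (Finset.sum_le_sum hterm).trans ?_
  rw [Finset.sum_add_distrib, Finset.sum_add_distrib]
  have h1 := hshift n
  have h2 := hshift (n - N)
  have h3 := hshift (n + N)
  have e2 : ∀ m : ℤ, n - m - N = n - N - m := fun m => by ring
  have e3 : ∀ m : ℤ, n - m + N = n + N - m := fun m => by ring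
  simp_rw [e2, e3]
  linarith

end Discrete

end
end Airy

/-! ### Fourier series of derivatives and differentiation of coefficients in time. -/

namespace Airy
noncomputable section
open MeasureTheory

lemma WC.const (s : ℕ) (hs : 2 ≤ s) (a : ℂ) : WC s ‖a‖ (fun _ => a) := by
  refine WC.of_hasSum (c := fun m => if m = 0 then a else 0) hs (fun x => ?_) (fun m => ?_)
  · have := hasSum_ite_eq (0 : ℤ) a
    convert this using 2 with m
    split_ifs with h
    · simp [h]
    · simp
  · by_cases h : m = 0
    · subst h; simp [wt]
    · have := wt_pos m
      simp only [h, if_false, norm_zero]; positivity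

lemma fc_const (a : ℂ) (m : ℤ) : fc (fun _ => a) m = if m = 0 then a else 0 := by
  refine fc_of_hasSum (c := fun m => if m = 0 then a else 0) ?_ (fun x => ?_) m
  · refine summable_of_ne_finset_zero (s := {0}) fun m hm => ?_
    simp only [Finset.mem_singleton] at hm; simp [hm]
  · have := hasSum_ite_eq (0 : ℤ) a
    convert this using 2 with m
    split_ifs with h
    · simp [h]
    · simp

/-- Derivatives of functions of class `C^{s+1}` have absolutely convergent Fourier series. -/
lemma InClassC.wc_iteratedDeriv {s k : ℕ} {V : NNReal} {f : ℝ → ℝ} (hf : InClassC (s + 1) V f)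
    (hk : k ≤ s) (hk0 : 0 < k) :
    WC (s + 2 - k) (V * 2 ^ (s + 2)) (fun x => ((iteratedDeriv k f x : ℝ) : ℂ)) := by
  have hdec : ∀ m, ‖fc (fun x => ((iteratedDeriv k f x : ℝ) : ℂ)) m‖ ≤
      V * 2 ^ (s + 2) / wt m ^ (s + 2 - k) := by
    intro m
    rw [hf.fc_iteratedDeriv m hk]
    have hw := wt_pos m
    by_cases hm : m = 0
    -- Since k > 0 the mean of the derivative vanishes; the mean of `f` itself is not controlled by
    -- its variation.
    · subst hm; simp [hk0.ne']; positivity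
    · have hm0 : 0 < |(m : ℝ)| := by simpa using hm
      have hI : ‖Complex.I * (m : ℂ)‖ = |(m : ℝ)| := by simp
      rw [norm_mul, norm_pow, hI]
      calc |(m : ℝ)| ^ k * ‖fc (fun x => (f x : ℂ)) m‖ ≤ wt m ^ k * (V / (wt m / 2) ^ (s + 2)) := by
            have h2 := wt_le_two_mul_abs hm
            refine mul_le_mul (by gcongr; exact abs_le_wt m) ((hf.norm_fc_le hm).trans ?_)
              (norm_nonneg _) (by positivity)
            gcongr; linarith
        _ = _ := by
          rw [div_pow, show s + 2 = s + 2 - k + k by omega, pow_add (wt m)]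
          simp only [Nat.add_sub_cancel]
          field_simp
  have hcd := hf.2.1
  simp only [Nat.add_sub_cancel] at hcd
  have hc : Continuous (iteratedDeriv k f) :=
    hcd.continuous_iteratedDeriv k (by exact_mod_cast hk)
  exact ⟨hasSum_fc (Complex.continuous_ofReal.comp hc)
    (fun x => by simp only [hf.iteratedDeriv_two_pi k x])
    (summable_of_decay (by omega) hdec).of_norm, hdec⟩

/-- Differentiation of Fourier coefficients with respect to a parameter. -/
lemma hasDerivWithinAt_fc {T B : ℝ} {u u' : ℝ → ℝ → ℝ}
    (hcont : ∀ t ∈ Set.Icc 0 T, Continuous (u t))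
    (hd : ∀ t ∈ Set.Icc 0 T, ∀ x, HasDerivWithinAt (fun s => u s x) (u' t x) (Set.Icc 0 T) t)
    (hB : ∀ t ∈ Set.Icc 0 T, ∀ x, ‖u' t x‖ ≤ B) (m : ℤ) {t : ℝ} (ht : t ∈ Set.Icc 0 T) :
    HasDerivWithinAt (fun s => fc (fun x => u s x) m) (fc (fun x => u' t x) m) (Set.Icc 0 T) t := by
  refine HasDerivWithinAt.const_mul _ ?_
  rw [hasDerivWithinAt_iff_tendsto_slope]
  have hev : ∀ᶠ s in nhdsWithin t (Set.Icc 0 T \ {t}), s ∈ Set.Icc 0 T \ {t} :=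
    self_mem_nhdsWithin
  have hint : ∀ s ∈ Set.Icc 0 T, Continuous (fun x => (u s x : ℂ) * ex (-m) x) := fun s hs =>
    (Complex.continuous_ofReal.comp (hcont s hs)).mul (continuous_ex _)
  have key : Filter.Tendsto (fun s => ∫ x in (0 : ℝ)..(2 * Real.pi),
      slope (fun s => (u s x : ℂ) * ex (-m) x) t s) (nhdsWithin t (Set.Icc 0 T \ {t}))
      (nhds (∫ x in (0 : ℝ)..(2 * Real.pi), (u' t x : ℂ) * ex (-m) x)) := by
    refine intervalIntegral.tendsto_integral_filter_of_dominated_convergence (fun _ => B) ?_ ?_ ?_ ?_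
    · filter_upwards [hev] with s hs
      have : Continuous (fun x => slope (fun s => (u s x : ℂ) * ex (-m) x) t s) := by
        simp only [slope_def_module]
        exact ((hint s hs.1).sub (hint t ht)).const_smul _
      exact this.aestronglyMeasurable
    · filter_upwards [hev] with s hs
      filter_upwards with x _
      -- The mean value inequality bounds the difference quotients by `B` uniformly in x, which
      -- provides the dominating function.
      have h1 := (convex_Icc 0 T).norm_image_sub_le_of_norm_hasDerivWithin_le
        (f := fun s => u s x) (f' := fun s => u' s x) (fun r hr => hd r hr x)
        (fun r hr => hB r hr x) ht hs.1
      have hst : 0 < ‖s - t‖ := norm_pos_iff.2 (sub_ne_zero.2 hs.2)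
      rw [slope_def_module, norm_smul, ← sub_mul, norm_mul, norm_ex, mul_one, norm_inv,
        ← Complex.ofReal_sub, Complex.norm_real]
      rw [inv_mul_le_iff₀ hst]; linarith
    · exact intervalIntegrable_const
    · filter_upwards with x _
      have h1 := ((hd t ht x).ofReal_comp).mul_const (ex (-m) x)
      exact hasDerivWithinAt_iff_tendsto_slope.1 h1
  refine key.congr' ?_
  filter_upwards [hev] with s hs
  simp only [slope_def_module]
  rw [intervalIntegral.integral_smul, intervalIntegral.integral_sub]
  · exact (hint s hs.1).intervalIntegrable _ _
  · exact (hint t ht).intervalIntegrable _ _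

end
end Airy

/-! ### The flow in Fourier variables. -/

namespace Airy
noncomputable section
open MeasureTheory

/-- The nonlinear term of the flow with tangent angle derivative `v`. -/
def cubic (c : ℝ) (v : ℝ → ℝ → ℂ) (t x : ℝ) : ℂ := (c / 2 : ℂ) * v t x ^ 3

/-- The time derivative of the Fourier coefficients. -/
def rate (c : ℝ) (u v : ℝ → ℝ → ℂ) (t : ℝ) (m : ℤ) : ℂ :=
  -(Complex.I * (c * m ^ 3 : ℝ)) * fc (u t) m + fc (cubic c v t) m

/-- The periodic part `u` and the space derivative `v` of a regular solution, described by their Fourier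
coefficients. -/
structure Flow (r : ℕ) (T p c K : ℝ) (u v : ℝ → ℝ → ℂ) : Prop where
  one_le : 1 ≤ K
  wcu : ∀ t ∈ Set.Icc 0 T, WC (r + 4) K (u t)
  wcv : ∀ t ∈ Set.Icc 0 T, WC (r + 3) K (v t)
  fcv : ∀ t ∈ Set.Icc 0 T, ∀ m, fc (v t) m = (if m = 0 then (p : ℂ) else 0) + Complex.I * m * fc (u t) m
  real : ∀ t x, (starRingEnd ℂ) (v t x) = v t x
  deriv : ∀ t ∈ Set.Icc 0 T, ∀ m,
    HasDerivWithinAt (fun s => fc (u s) m) (rate c u v t m) (Set.Icc 0 T) t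

variable {r : ℕ} {T p : ℝ} {L : ℝ → ℝ} {θ : ℝ → ℝ → ℝ}

lemma IsRegularSolution.length_const (h : IsRegularSolution r T p L θ) {t : ℝ} (ht : t ∈ Set.Icc 0 T) :
    L t = L 0 := by
  have h0 : (0 : ℝ) ∈ Set.Icc 0 T := ⟨le_rfl, ht.1.trans ht.2⟩
  have := (convex_Icc 0 T).norm_image_sub_le_of_norm_hasDerivWithin_le (f := L) (f' := fun _ => 0)
    (C := 0) (fun r hr => h.length_eq r hr) (by simp) h0 ht
  rw [zero_mul, norm_le_zero_iff, sub_eq_zero] at this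
  exact this

/-- All coefficients with m ≠ 0 are bounded by the uniform variation. The mean of the periodic part
escapes that bound and is controlled through the equation, by its initial value plus T times the
size of its time derivative. -/
lemma IsRegularSolution.flow (h : IsRegularSolution r T p L θ) (hr : 6 ≤ r)
    (hT : 0 < T) : ∃ K, Flow r T p ((2 * Real.pi / L 0) ^ 3) K (fun t x => ((θ t x - p * x : ℝ) : ℂ))
      (fun t x => ((deriv (θ t) x : ℝ) : ℂ)) := by
  obtain ⟨V, hV⟩ := h.space_reg
  set c : ℝ := (2 * Real.pi / L 0) ^ 3 with hc
  set u : ℝ → ℝ → ℝ := fun t x => θ t x - p * x with hu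
  have hVu : ∀ t ∈ Set.Icc 0 T, InClassC (r + 2 + 1) V (u t) := hV
  have hcd : ∀ t ∈ Set.Icc 0 T, ContDiff ℝ ((r + 2 : ℕ) : ℕ∞) (u t) := fun t ht => (hV t ht).2.1
  have hθ : ∀ t, θ t = fun x => u t x + p * x := fun t => by funext x; simp [hu]
  have hdiff : ∀ t ∈ Set.Icc 0 T, Differentiable ℝ (u t) := fun t ht =>
    (hcd t ht).differentiable (by simp)
  have hd1 : ∀ t ∈ Set.Icc 0 T, ∀ x, deriv (θ t) x = p + iteratedDeriv 1 (u t) x := by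
    intro t ht x
    rw [hθ t, iteratedDeriv_one]
    have := ((hdiff t ht x).hasDerivAt.add ((hasDerivAt_id x).const_mul p)).deriv
    simp only [mul_one] at this
    rw [add_comm, ← this]; rfl
  have hd3 : ∀ t ∈ Set.Icc 0 T, ∀ x, iteratedDeriv 3 (θ t) x = iteratedDeriv 3 (u t) x := by
    intro t ht x
    have h1 : deriv (θ t) = fun x => p + deriv (u t) x := by
      funext y; rw [hd1 t ht, iteratedDeriv_one]
    rw [show (3 : ℕ) = 2 + 1 from rfl, iteratedDeriv_succ', iteratedDeriv_succ' (n := 2), h1,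
      show (2 : ℕ) = 1 + 1 from rfl, iteratedDeriv_succ', iteratedDeriv_succ' (n := 1)]
    congr 1
    funext y; simp
  have hw1 : ∀ t ∈ Set.Icc 0 T,
      WC (r + 3) (V * 2 ^ (r + 4)) (fun x => ((iteratedDeriv 1 (u t) x : ℝ) : ℂ)) := fun t ht =>
    (hVu t ht).wc_iteratedDeriv (k := 1) (by omega) (by omega)
  have hw3 : ∀ t ∈ Set.Icc 0 T,
      WC (r + 1) (V * 2 ^ (r + 4)) (fun x => ((iteratedDeriv 3 (u t) x : ℝ) : ℂ)) := fun t ht =>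
    (hVu t ht).wc_iteratedDeriv (k := 3) (by omega) (by omega)
  set v : ℝ → ℝ → ℂ := fun t x => ((deriv (θ t) x : ℝ) : ℂ) with hv
  have hveq : ∀ t ∈ Set.Icc 0 T, v t = fun x => (p : ℂ) + ((iteratedDeriv 1 (u t) x : ℝ) : ℂ) := by
    intro t ht; funext x; simp only [hv, hd1 t ht]; push_cast; rfl
  set Kv : ℝ := ‖(p : ℂ)‖ + V * 2 ^ (r + 4) with hKv
  have hwv : ∀ t ∈ Set.Icc 0 T, WC (r + 3) Kv (v t) := by
    intro t ht
    rw [hveq t ht]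
    exact (WC.const (r + 3) (by omega) (p : ℂ)).add (by omega) (hw1 t ht)
  have hKv0 : 0 ≤ Kv := (hwv 0 ⟨le_rfl, hT.le⟩).nonneg
  obtain ⟨K3, hK3⟩ : ∃ K3, ∀ t ∈ Set.Icc 0 T, WC (r + 3) K3 (cubic c v t) :=
    ⟨_, fun t ht => ((hwv t ht).pow_three (by omega)).const_mul (by omega) (c / 2 : ℂ)⟩
  set R : ℝ → ℝ → ℝ := fun t x => c * (iteratedDeriv 3 (θ t) x + deriv (θ t) x ^ 3 / 2) with hR
  have hReq : ∀ t ∈ Set.Icc 0 T, (fun x => (R t x : ℂ)) =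
      fun x => (c : ℂ) * ((iteratedDeriv 3 (u t) x : ℝ) : ℂ) + cubic c v t x := by
    intro t ht; funext x
    simp only [hR, hd3 t ht, cubic, hv]; push_cast; ring
  have hwc3 : ∀ t ∈ Set.Icc 0 T, WC (r + 1) (‖(c : ℂ)‖ * (V * 2 ^ (r + 4)))
      (fun x => (c : ℂ) * ((iteratedDeriv 3 (u t) x : ℝ) : ℂ)) := fun t ht =>
    (hw3 t ht).const_mul (by omega) _
  obtain ⟨KR, hKR⟩ : ∃ KR, ∀ t ∈ Set.Icc 0 T, WC (r + 1) KR (fun x => (R t x : ℂ)) := by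
    refine ⟨‖(c : ℂ)‖ * (V * 2 ^ (r + 4)) + K3, fun t ht => ?_⟩
    rw [hReq t ht]
    exact (hwc3 t ht).add (by omega) ((hK3 t ht).mono (by omega) le_rfl)
  have hLc : ∀ t ∈ Set.Icc 0 T, ∀ x, HasDerivWithinAt (fun s => u s x) (R t x) (Set.Icc 0 T) t := by
    intro t ht x
    have := (h.angle_eq t ht x).sub_const (p * x)
    rwa [h.length_const ht] at this
  have hderiv := fun m t (ht : t ∈ Set.Icc 0 T) => hasDerivWithinAt_fc (T := T) (u := u) (u' := R)
    (B := KR * wsum) (fun t ht => (hdiff t ht).continuous) hLc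
    (fun t ht x => by
      have := (hKR t ht).norm_le (by omega) x
      rwa [Complex.norm_real] at this) m ht
  have hfc1 : ∀ t ∈ Set.Icc 0 T, ∀ m, fc (v t) m =
      (if m = 0 then (p : ℂ) else 0) + Complex.I * m * fc (fun x => (u t x : ℂ)) m := by
    intro t ht m
    rw [hveq t ht, (WC.const (r + 3) (by omega) (p : ℂ)).fc_add (hw1 t ht) (by omega) (by omega),
      fc_const, (hVu t ht).fc_iteratedDeriv m (by omega), pow_one]
  have h0T : (0 : ℝ) ∈ Set.Icc 0 T := ⟨le_rfl, hT.le⟩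
  set K : ℝ := 1 + Kv + V * 2 ^ (r + 4) + (‖fc (fun x => (u 0 x : ℂ)) 0‖ + KR * T) with hK
  have hKR0 : 0 ≤ KR := (hKR 0 h0T).nonneg
  -- The zeroth coefficient of the right-hand side of the equation is at most `KR`.
  have hz : ∀ t ∈ Set.Icc 0 T, ‖fc (fun x => (u t x : ℂ)) 0‖ ≤
      ‖fc (fun x => (u 0 x : ℂ)) 0‖ + KR * T := by
    intro t ht
    have h1 := (convex_Icc 0 T).norm_image_sub_le_of_norm_hasDerivWithin_le
      (fun s hs => hderiv 0 s hs) (C := KR) (fun s hs => by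
        simpa [wt] using (hKR s hs).decay 0) h0T ht
    have h2 : ‖t - 0‖ ≤ T := by rw [sub_zero, Real.norm_of_nonneg ht.1]; exact ht.2
    have h3 := norm_le_norm_add_norm_sub' (fc (fun x => (u t x : ℂ)) 0) (fc (fun x => (u 0 x : ℂ)) 0)
    have h4 : KR * ‖t - 0‖ ≤ KR * T := by gcongr
    linarith
  have hdec : ∀ t ∈ Set.Icc 0 T, ∀ m, ‖fc (fun x => (u t x : ℂ)) m‖ ≤ K / wt m ^ (r + 4) := by
    intro t ht m
    have hw := wt_pos m
    by_cases hm : m = 0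
    · subst hm
      have := hz t ht
      have hV0 : 0 ≤ (V : ℝ) * 2 ^ (r + 4) := by positivity
      simp only [wt, Int.cast_zero, abs_zero, add_zero, one_pow, div_one]
      linarith
    · have hm0 : 0 < |(m : ℝ)| := by simpa using hm
      have h2 := wt_le_two_mul_abs hm
      refine ((hVu t ht).norm_fc_le hm).trans ?_
      have h3 : 0 ≤ ‖fc (fun x => (u 0 x : ℂ)) 0‖ + KR * T := by positivity
      calc (V : ℝ) / |(m : ℝ)| ^ (r + 2 + 2) ≤ V / (wt m / 2) ^ (r + 4) := by
            gcongr; linarith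
        _ = V * 2 ^ (r + 4) / wt m ^ (r + 4) := by rw [div_pow]; field_simp
        _ ≤ _ := by gcongr; linarith
  have hK1 : 1 ≤ K := by
    have h3 : 0 ≤ ‖fc (fun x => (u 0 x : ℂ)) 0‖ + KR * T := by positivity
    have hV0 : 0 ≤ (V : ℝ) * 2 ^ (r + 4) := by positivity
    linarith
  have hKvK : Kv ≤ K := by
    have h3 : 0 ≤ ‖fc (fun x => (u 0 x : ℂ)) 0‖ + KR * T := by positivity
    have hV0 : 0 ≤ (V : ℝ) * 2 ^ (r + 4) := by positivity
    linarith
  refine ⟨K, hK1, ?_, fun t ht => (hwv t ht).mono le_rfl hKvK, hfc1, fun t x => ?_, fun t ht m => ?_⟩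
  · intro t ht
    refine ⟨hasSum_fc (Complex.continuous_ofReal.comp (hdiff t ht).continuous)
      (fun x => ?_) (summable_of_decay (by omega) (hdec t ht)).of_norm, hdec t ht⟩
    have := (hV t ht).1 x
    simp only at this
    rw [this]
  · exact Complex.conj_ofReal _
  · have := hderiv m t ht
    rw [hReq t ht, (hwc3 t ht).fc_add (hK3 t ht) (by omega) (by omega),
      (hw3 t ht).fc_const_mul (by omega), (hVu t ht).fc_iteratedDeriv m (by omega)] at this
    convert this using 1
    rw [rate]
    congr 1
    rw [mul_pow, show Complex.I ^ 3 = -Complex.I by rw [pow_succ, Complex.I_sq]; ring]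
    simp only [hu]; push_cast; ring

end
end Airy

/-! ### Time differences of the solution and consistency in time. -/

namespace Airy
noncomputable section

section Calculus
variable {U Y : ℝ → ℂ} {T t δ A : ℝ}

lemma hasDerivWithinAt_add_shift (hU : ∀ t ∈ Set.Icc 0 T, HasDerivWithinAt U (Y t) (Set.Icc 0 T) t)
    (h0 : 0 ≤ t) (h1 : t + δ ≤ T) {s : ℝ} (hs : s ∈ Set.Icc 0 δ) :
    HasDerivWithinAt (fun s => U (t + s)) (Y (t + s)) (Set.Icc 0 δ) s := by
  have hm : Set.MapsTo (fun s => t + s) (Set.Icc 0 δ) (Set.Icc 0 T) := fun x hx =>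
    ⟨by linarith [hx.1], by linarith [hx.2]⟩
  have := (hU (t + s) (hm hs)).scomp s ((hasDerivWithinAt_id s (Set.Icc 0 δ)).const_add t) hm
  rw [one_smul] at this
  exact this

lemma hasDerivWithinAt_sub_shift (hU : ∀ t ∈ Set.Icc 0 T, HasDerivWithinAt U (Y t) (Set.Icc 0 T) t)
    (h0 : 0 ≤ t - δ) (h1 : t ≤ T) {s : ℝ} (hs : s ∈ Set.Icc 0 δ) :
    HasDerivWithinAt (fun s => U (t - s)) (-Y (t - s)) (Set.Icc 0 δ) s := by
  have hm : Set.MapsTo (fun s => t - s) (Set.Icc 0 δ) (Set.Icc 0 T) := fun x hx =>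
    ⟨by linarith [hx.2], by linarith [hx.1]⟩
  have := (hU (t - s) (hm hs)).scomp s ((hasDerivWithinAt_id s (Set.Icc 0 δ)).const_sub t) hm
  rw [neg_smul, one_smul] at this
  exact this

lemma norm_le_of_deriv_bound {f f' : ℝ → ℂ} {C : ℝ} (hδ : 0 ≤ δ)
    (hf : ∀ s ∈ Set.Icc 0 δ, HasDerivWithinAt f (f' s) (Set.Icc 0 δ) s)
    (hb : ∀ s ∈ Set.Icc 0 δ, ‖f' s‖ ≤ C) (h0 : f 0 = 0) : ‖f δ‖ ≤ C * δ := by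
  have := (convex_Icc 0 δ).norm_image_sub_le_of_norm_hasDerivWithin_le hf hb
    (Set.left_mem_Icc.2 hδ) (Set.right_mem_Icc.2 hδ)
  rwa [h0, sub_zero, sub_zero, Real.norm_of_nonneg hδ] at this

/-- The derivative in s of U(t+s) + U(t-s) - 2U(t) is Y(t+s) - Y(t-s), so a Lipschitz bound for the
first derivative is enough. -/
lemma norm_symm_second_diff_le (hU : ∀ t ∈ Set.Icc 0 T, HasDerivWithinAt U (Y t) (Set.Icc 0 T) t)
    (hA : 0 ≤ A) (hY : ∀ a ∈ Set.Icc 0 T, ∀ b ∈ Set.Icc 0 T, ‖Y a - Y b‖ ≤ A * |a - b|)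
    (hδ : 0 ≤ δ) (h0 : 0 ≤ t - δ) (h1 : t + δ ≤ T) :
    ‖U (t + δ) + U (t - δ) - 2 * U t‖ ≤ 2 * A * δ ^ 2 := by
  have := norm_le_of_deriv_bound (C := A * (2 * δ)) (f := fun s => U (t + s) + U (t - s) - 2 * U t) hδ
    (fun s hs => ((hasDerivWithinAt_add_shift hU (by linarith) h1 hs).add
      (hasDerivWithinAt_sub_shift hU h0 (by linarith) hs)).sub_const _)
    (fun s hs => by
      have := hY (t + s) ⟨by linarith [hs.1], by linarith [hs.2]⟩ (t - s)
        ⟨by linarith [hs.2], by linarith [hs.1]⟩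
      rw [← sub_eq_add_neg]
      refine this.trans ?_
      have e : |t + s - (t - s)| ≤ 2 * δ := by
        rw [abs_of_nonneg (by linarith [hs.1])]; linarith [hs.2]
      gcongr)
    (by simp; ring)
  refine this.trans (le_of_eq ?_); ring

/-- The derivative in s of U(t+s) - U(t-s) - 2sY(t) is the second difference of Y; integrating its
bound gains one more power of δ. -/
lemma norm_centered_diff_le (hU : ∀ t ∈ Set.Icc 0 T, HasDerivWithinAt U (Y t) (Set.Icc 0 T) t)
    (hA : 0 ≤ A) (hδ : 0 ≤ δ) (h0 : 0 ≤ t - δ) (h1 : t + δ ≤ T)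
    (hY : ∀ s ∈ Set.Icc 0 δ, ‖Y (t + s) + Y (t - s) - 2 * Y t‖ ≤ A * s ^ 2) :
    ‖U (t + δ) - U (t - δ) - 2 * δ * Y t‖ ≤ A * δ ^ 3 := by
  have := norm_le_of_deriv_bound (C := A * δ ^ 2)
    (f := fun s => U (t + s) - U (t - s) - 2 * s * Y t) hδ
    (fun s hs => ((hasDerivWithinAt_add_shift hU (by linarith) h1 hs).sub
      (hasDerivWithinAt_sub_shift hU h0 (by linarith) hs)).sub
      ((((Complex.ofRealCLM.hasDerivAt (x := s)).const_mul 2).mul_const (Y t)).hasDerivWithinAt))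
    (fun s hs => by
      have h := hY s hs
      have e : Y (t + s) - -Y (t - s) - 2 * Complex.ofRealCLM 1 * Y t =
        Y (t + s) + Y (t - s) - 2 * Y t := by simp
      rw [e]
      refine h.trans ?_
      have := hs.1
      have := hs.2
      gcongr)
    (by simp)
  refine this.trans (le_of_eq ?_); ring

lemma norm_forward_diff_le (hU : ∀ t ∈ Set.Icc 0 T, HasDerivWithinAt U (Y t) (Set.Icc 0 T) t)
    (hA : 0 ≤ A) (hY : ∀ a ∈ Set.Icc 0 T, ∀ b ∈ Set.Icc 0 T, ‖Y a - Y b‖ ≤ A * |a - b|)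
    (hδ : 0 ≤ δ) (h0 : 0 ≤ t) (h1 : t + δ ≤ T) :
    ‖U (t + δ) - U t - δ * Y t‖ ≤ A * δ ^ 2 := by
  have := norm_le_of_deriv_bound (C := A * δ)
    (f := fun s => U (t + s) - U t - s * Y t) hδ
    (fun s hs => ((hasDerivWithinAt_add_shift hU h0 h1 hs).sub_const _).sub
      (((Complex.ofRealCLM.hasDerivAt (x := s)).mul_const (Y t)).hasDerivWithinAt))
    (fun s hs => by
      have h := hY (t + s) ⟨by linarith [hs.1], by linarith [hs.2]⟩ t ⟨h0, by linarith⟩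
      simp only [Complex.ofRealCLM_apply, Complex.ofReal_one, one_mul]
      refine h.trans ?_
      have e : |t + s - t| ≤ δ := by rw [add_sub_cancel_left, abs_of_nonneg hs.1]; exact hs.2
      gcongr)
    (by simp)
  refine this.trans (le_of_eq ?_); ring

end Calculus

section TimeRegularity
variable {r : ℕ} {T p c K : ℝ} {u v : ℝ → ℝ → ℂ}

lemma mul_abs_cube_div_le {s : ℕ} {A : ℝ} (hA : 0 ≤ A) (m : ℤ) :
    |(m : ℝ)| ^ 3 * (A / wt m ^ (s + 3)) ≤ A / wt m ^ s := by
  have hw := wt_pos m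
  calc |(m : ℝ)| ^ 3 * (A / wt m ^ (s + 3)) ≤ wt m ^ 3 * (A / wt m ^ (s + 3)) := by
        gcongr; exact abs_le_wt m
    _ = A / wt m ^ s := by rw [pow_add]; field_simp

lemma mul_abs_div_le {s : ℕ} {A : ℝ} (hA : 0 ≤ A) (m : ℤ) :
    |(m : ℝ)| * (A / wt m ^ (s + 1)) ≤ A / wt m ^ s := by
  have hw := wt_pos m
  calc |(m : ℝ)| * (A / wt m ^ (s + 1)) ≤ wt m * (A / wt m ^ (s + 1)) := by
        gcongr; exact abs_le_wt m
    _ = A / wt m ^ s := by rw [pow_succ]; field_simp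

lemma norm_symbol (c : ℝ) (m : ℤ) :
    ‖Complex.I * ((c * (m : ℝ) ^ 3 : ℝ) : ℂ)‖ = |c| * |(m : ℝ)| ^ 3 := by
  rw [norm_mul, Complex.norm_I, one_mul, Complex.norm_real, Real.norm_eq_abs, abs_mul, abs_pow]

lemma Flow.wc_cubic (F : Flow r T p c K u v) : ∃ B, ∀ t ∈ Set.Icc 0 T, WC (r + 3) B (cubic c v t) :=
  ⟨_, fun t ht => ((F.wcv t ht).pow_three (by omega)).const_mul (by omega) (c / 2 : ℂ)⟩

/-- First rung of the ladder 10, 7, 4, 1 of decay exponents: the symbol m³ takes three powers from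
the coefficients of `u`, and r ≥ 6 ensures r + 4 ≥ 10. The cubic term decays faster than is needed
at each rung. -/
lemma Flow.norm_rate_le (F : Flow r T p c K u v) (hr : 6 ≤ r) :
    ∃ A, 0 ≤ A ∧ ∀ t ∈ Set.Icc 0 T, ∀ m, ‖rate c u v t m‖ ≤ A / wt m ^ 7 := by
  obtain ⟨B, hB⟩ := F.wc_cubic
  have hK : 0 ≤ K := by linarith [F.one_le]
  refine ⟨|c| * K + |B|, by positivity, fun t ht m => ?_⟩
  have hw := wt_pos m
  have h1 := (F.wcu t ht).mono (t := 10) (by omega) le_rfl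
  have h2 := (hB t ht).mono (t := 7) (by omega) (le_abs_self B)
  refine (norm_add_le _ _).trans ?_
  rw [norm_mul, norm_neg, norm_symbol, add_div]
  refine add_le_add ?_ (h2.decay m)
  calc |c| * |(m : ℝ)| ^ 3 * ‖fc (u t) m‖ ≤ |c| * |(m : ℝ)| ^ 3 * (K / wt m ^ (7 + 3)) := by
        gcongr; exact h1.decay m
    _ = |c| * (|(m : ℝ)| ^ 3 * (K / wt m ^ (7 + 3))) := by ring
    _ ≤ |c| * (K / wt m ^ 7) := by
        have := mul_abs_cube_div_le (s := 7) hK m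
        gcongr
    _ = _ := by ring

lemma Flow.norm_fc_sub_le (F : Flow r T p c K u v) (hr : 6 ≤ r) :
    ∃ A, 0 ≤ A ∧ ∀ t ∈ Set.Icc 0 T, ∀ s ∈ Set.Icc 0 T, ∀ m,
      ‖fc (u t) m - fc (u s) m‖ ≤ A * |t - s| / wt m ^ 7 := by
  obtain ⟨A, hA, h⟩ := F.norm_rate_le hr
  refine ⟨A, hA, fun t ht s hs m => ?_⟩
  have := (convex_Icc 0 T).norm_image_sub_le_of_norm_hasDerivWithin_le
    (fun x hx => F.deriv x hx m) (fun x hx => h x hx m) hs ht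
  rw [Real.norm_eq_abs] at this
  refine this.trans (le_of_eq ?_); ring

/-- The decay 7 of the differences of `u` drops to 6 since `v` is a space derivative; the constant p
cancels. -/
lemma Flow.wc_sub (F : Flow r T p c K u v) (hr : 6 ≤ r) :
    ∃ A, 0 ≤ A ∧ ∀ t ∈ Set.Icc 0 T, ∀ s ∈ Set.Icc 0 T,
      WC 6 (A * |t - s|) (fun x => v t x - v s x) := by
  obtain ⟨A, hA, h⟩ := F.norm_fc_sub_le hr
  refine ⟨A, hA, fun t ht s hs => ?_⟩
  have ht' := (F.wcv t ht).mono (t := 6) (by omega) le_rfl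
  have hs' := (F.wcv s hs).mono (t := 6) (by omega) le_rfl
  refine ⟨(ht'.sub (by omega) hs').sum, fun m => ?_⟩
  rw [ht'.fc_sub hs' (by omega) (by omega), F.fcv t ht, F.fcv s hs, add_sub_add_left_eq_sub, ← mul_sub,
    norm_mul, norm_mul, Complex.norm_I, one_mul, Complex.norm_intCast]
  exact (mul_le_mul_of_nonneg_left (h t ht s hs m) (abs_nonneg _)).trans
    (mul_abs_div_le (s := 6) (by positivity) m)

lemma Flow.wc_sq_sub (F : Flow r T p c K u v) (hr : 6 ≤ r) :
    ∃ A, 0 ≤ A ∧ ∀ t ∈ Set.Icc 0 T, ∀ s ∈ Set.Icc 0 T,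
      WC 6 (A * |t - s|) (fun x => v t x ^ 2 - v s x ^ 2) := by
  obtain ⟨A, hA, h⟩ := F.wc_sub hr
  have hK : 0 ≤ K := by linarith [F.one_le]
  have hW := one_le_wsum
  refine ⟨2 ^ (6 + 1) * wsum * (K + K) * A, by positivity, fun t ht s hs => ?_⟩
  have ht' := (F.wcv t ht).mono (t := 6) (by omega) le_rfl
  have hs' := (F.wcv s hs).mono (t := 6) (by omega) le_rfl
  have := (ht'.add (by omega) hs').mul (by omega) (h t ht s hs)
  convert this using 1
  · ring
  · funext x; ring

lemma Flow.wc_cubic_sub (F : Flow r T p c K u v) (hr : 6 ≤ r) :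
    ∃ A, 0 ≤ A ∧ ∀ t ∈ Set.Icc 0 T, ∀ s ∈ Set.Icc 0 T,
      WC 6 (A * |t - s|) (fun x => cubic c v t x - cubic c v s x) := by
  obtain ⟨A, hA, h⟩ := F.wc_sub hr
  have hK : 0 ≤ K := by linarith [F.one_le]
  have hW := one_le_wsum
  set M : ℝ := 2 ^ (6 + 1) * wsum with hM
  refine ⟨‖(c / 2 : ℂ)‖ * (M * (M * K * K + M * K * K + M * K * K) * A), by positivity,
    fun t ht s hs => ?_⟩
  have ht' := (F.wcv t ht).mono (t := 6) (by omega) le_rfl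
  have hs' := (F.wcv s hs).mono (t := 6) (by omega) le_rfl
  have := ((((ht'.mul (by omega) ht').add (by omega) (ht'.mul (by omega) hs')).add (by omega)
    (hs'.mul (by omega) hs')).mul (by omega) (h t ht s hs)).const_mul (by omega) (c / 2 : ℂ)
  convert this using 1
  · ring
  · funext x; simp only [cubic]; ring

lemma Flow.norm_rate_sub_le (F : Flow r T p c K u v) (hr : 6 ≤ r) :
    ∃ A, 0 ≤ A ∧ ∀ t ∈ Set.Icc 0 T, ∀ s ∈ Set.Icc 0 T, ∀ m,
      ‖rate c u v t m - rate c u v s m‖ ≤ A / wt m ^ 4 * |t - s| := by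
  obtain ⟨A, hA, h⟩ := F.norm_fc_sub_le hr
  obtain ⟨B, hB, h'⟩ := F.wc_cubic_sub hr
  obtain ⟨D, hD⟩ := F.wc_cubic
  refine ⟨|c| * A + B, by positivity, fun t ht s hs m => ?_⟩
  have hw := wt_pos m
  have e : rate c u v t m - rate c u v s m = -(Complex.I * (c * m ^ 3 : ℝ)) * (fc (u t) m - fc (u s) m) +
      fc (fun x => cubic c v t x - cubic c v s x) m := by
    rw [(hD t ht).fc_sub (hD s hs) (by omega) (by omega), rate, rate]; ring
  rw [e]
  refine (norm_add_le _ _).trans ?_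
  rw [norm_mul, norm_neg, norm_symbol, add_div, add_mul]
  refine add_le_add ?_ ?_
  · calc |c| * |(m : ℝ)| ^ 3 * ‖fc (u t) m - fc (u s) m‖
        ≤ |c| * |(m : ℝ)| ^ 3 * (A * |t - s| / wt m ^ (4 + 3)) := by
          gcongr; exact h t ht s hs m
      _ = |c| * (|(m : ℝ)| ^ 3 * (A * |t - s| / wt m ^ (4 + 3))) := by ring
      _ ≤ |c| * (A * |t - s| / wt m ^ 4) := by
          have := mul_abs_cube_div_le (s := 4) (A := A * |t - s|) (by positivity) m
          gcongr
      _ = _ := by ring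
  · refine (((h' t ht s hs).mono (t := 4) (by omega) le_rfl).decay m).trans (le_of_eq ?_)
    ring

lemma Flow.norm_fc_second_diff_le (F : Flow r T p c K u v) (hr : 6 ≤ r) :
    ∃ A, 0 ≤ A ∧ ∀ t δ, 0 ≤ δ → 0 ≤ t - δ → t + δ ≤ T → ∀ m,
      ‖fc (u (t + δ)) m + fc (u (t - δ)) m - 2 * fc (u t) m‖ ≤ A * δ ^ 2 / wt m ^ 4 := by
  obtain ⟨A, hA, h⟩ := F.norm_rate_sub_le hr
  refine ⟨2 * A, by positivity, fun t δ hδ h0 h1 m => ?_⟩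
  have hw := wt_pos m
  have := norm_symm_second_diff_le (A := A / wt m ^ 4) (fun t ht => F.deriv t ht m) (by positivity)
    (fun a ha b hb => h a ha b hb m) hδ h0 h1
  refine this.trans (le_of_eq ?_); ring

lemma Flow.wc_second_diff (F : Flow r T p c K u v) (hr : 6 ≤ r) :
    ∃ A, 0 ≤ A ∧ ∀ t δ, 0 ≤ δ → 0 ≤ t - δ → t + δ ≤ T →
      WC 3 (A * δ ^ 2) (fun x => v (t + δ) x + v (t - δ) x - 2 * v t x) := by
  obtain ⟨A, hA, h⟩ := F.norm_fc_second_diff_le hr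
  refine ⟨A, hA, fun t δ hδ h0 h1 => ?_⟩
  have htp : t + δ ∈ Set.Icc 0 T := ⟨by linarith, h1⟩
  have htm : t - δ ∈ Set.Icc 0 T := ⟨h0, by linarith⟩
  have ht : t ∈ Set.Icc 0 T := ⟨by linarith, by linarith⟩
  have w1 := (F.wcv _ htp).mono (t := 3) (by omega) le_rfl
  have w2 := (F.wcv _ htm).mono (t := 3) (by omega) le_rfl
  have w3 := (F.wcv _ ht).mono (t := 3) (by omega) le_rfl
  refine ⟨((w1.add (by omega) w2).sub (by omega) (w3.const_mul (by omega) 2)).sum, fun m => ?_⟩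
  rw [(w1.add (by omega) w2).fc_sub (w3.const_mul (by omega) 2) (by omega) (by omega),
    w1.fc_add w2 (by omega) (by omega), w3.fc_const_mul (by omega), F.fcv _ htp, F.fcv _ htm, F.fcv _ ht]
  have e : ∀ d a b e : ℂ, d + Complex.I * m * a + (d + Complex.I * m * b) -
      2 * (d + Complex.I * m * e) = Complex.I * m * (a + b - 2 * e) := fun _ _ _ _ => by ring
  rw [e, norm_mul, norm_mul, Complex.norm_I, one_mul, Complex.norm_intCast]
  exact (mul_le_mul_of_nonneg_left (h t δ hδ h0 h1 m) (abs_nonneg _)).trans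
    (mul_abs_div_le (s := 3) (by positivity) m)

/-- With d± = v(t±δ) - v, the second difference of v³ equals 3v² times that of v, plus (2v +
v(t+δ))d₊² + (2v + v(t-δ))d₋². The first differences are O(δ), so each term is O(δ²). -/
lemma Flow.wc_cubic_second_diff (F : Flow r T p c K u v) (hr : 6 ≤ r) :
    ∃ A, 0 ≤ A ∧ ∀ t δ, 0 ≤ δ → 0 ≤ t - δ → t + δ ≤ T →
      WC 3 (A * δ ^ 2) (fun x => cubic c v (t + δ) x + cubic c v (t - δ) x - 2 * cubic c v t x) := by
  obtain ⟨A, hA, h⟩ := F.wc_second_diff hr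
  obtain ⟨B, hB, h'⟩ := F.wc_sub hr
  have hK : 0 ≤ K := by linarith [F.one_le]
  have hW := one_le_wsum
  set M : ℝ := 2 ^ (3 + 1) * wsum with hM
  refine ⟨‖(c / 2 : ℂ)‖ * (M * (M * (‖(3 : ℂ)‖ * K) * K) * A +
    (M * (‖(2 : ℂ)‖ * K + K) * (M * B * B) + M * (‖(2 : ℂ)‖ * K + K) * (M * B * B))), by positivity,
    fun t δ hδ h0 h1 => ?_⟩
  have htp : t + δ ∈ Set.Icc 0 T := ⟨by linarith, h1⟩
  have htm : t - δ ∈ Set.Icc 0 T := ⟨h0, by linarith⟩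
  have ht : t ∈ Set.Icc 0 T := ⟨by linarith, by linarith⟩
  have h2 : 2 ≤ 3 := by omega
  have w1 := (F.wcv _ htp).mono (t := 3) (by omega) le_rfl
  have w2 := (F.wcv _ htm).mono (t := 3) (by omega) le_rfl
  have w3 := (F.wcv _ ht).mono (t := 3) (by omega) le_rfl
  have d1 := (h' _ htp _ ht).mono (t := 3) (by omega) le_rfl
  have d2 := (h' _ htm _ ht).mono (t := 3) (by omega) le_rfl
  rw [add_sub_cancel_left, abs_of_nonneg hδ] at d1
  rw [show t - δ - t = -δ by ring, abs_neg, abs_of_nonneg hδ] at d2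
  have q1 := ((w3.const_mul h2 3).mul h2 w3).mul h2 (h t δ hδ h0 h1)
  have q2 := ((w3.const_mul h2 2).add h2 w1).mul h2 (d1.mul h2 d1)
  have q3 := ((w3.const_mul h2 2).add h2 w2).mul h2 (d2.mul h2 d2)
  have q := (q1.add h2 (q2.add h2 q3)).const_mul h2 (c / 2 : ℂ)
  convert q using 1
  · ring
  · funext x; simp only [cubic]; ring

/-- Last rung of the ladder: decay 4 minus the three powers of the symbol. The remaining factor `1 /
wt m` is square summable, as the weighted norm requires. -/
lemma Flow.norm_rate_second_diff_le (F : Flow r T p c K u v) (hr : 6 ≤ r) :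
    ∃ A, 0 ≤ A ∧ ∀ t δ, 0 ≤ δ → 0 ≤ t - δ → t + δ ≤ T → ∀ m,
      ‖rate c u v (t + δ) m + rate c u v (t - δ) m - 2 * rate c u v t m‖ ≤ A / wt m * δ ^ 2 := by
  obtain ⟨A, hA, h⟩ := F.norm_fc_second_diff_le hr
  obtain ⟨B, hB, h'⟩ := F.wc_cubic_second_diff hr
  obtain ⟨D, hD⟩ := F.wc_cubic
  refine ⟨|c| * A + B, by positivity, fun t δ hδ h0 h1 m => ?_⟩
  have hw := wt_pos m
  have htp : t + δ ∈ Set.Icc 0 T := ⟨by linarith, h1⟩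
  have htm : t - δ ∈ Set.Icc 0 T := ⟨h0, by linarith⟩
  have ht : t ∈ Set.Icc 0 T := ⟨by linarith, by linarith⟩
  have w1 := (hD _ htp).mono (t := 3) (by omega) le_rfl
  have w2 := (hD _ htm).mono (t := 3) (by omega) le_rfl
  have w3 := (hD _ ht).mono (t := 3) (by omega) le_rfl
  have e : rate c u v (t + δ) m + rate c u v (t - δ) m - 2 * rate c u v t m =
      -(Complex.I * (c * m ^ 3 : ℝ)) * (fc (u (t + δ)) m + fc (u (t - δ)) m - 2 * fc (u t) m) +
      fc (fun x => cubic c v (t + δ) x + cubic c v (t - δ) x - 2 * cubic c v t x) m := by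
    rw [(w1.add (by omega) w2).fc_sub (w3.const_mul (by omega) 2) (by omega) (by omega),
      w1.fc_add w2 (by omega) (by omega), w3.fc_const_mul (by omega), rate, rate, rate]
    ring
  rw [e]
  refine (norm_add_le _ _).trans ?_
  rw [norm_mul, norm_neg, norm_symbol, add_div, add_mul]
  refine add_le_add ?_ ?_
  · calc |c| * |(m : ℝ)| ^ 3 * ‖fc (u (t + δ)) m + fc (u (t - δ)) m - 2 * fc (u t) m‖
        ≤ |c| * |(m : ℝ)| ^ 3 * (A * δ ^ 2 / wt m ^ (1 + 3)) := by
          gcongr; exact h t δ hδ h0 h1 m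
      _ = |c| * (|(m : ℝ)| ^ 3 * (A * δ ^ 2 / wt m ^ (1 + 3))) := by ring
      _ ≤ |c| * (A * δ ^ 2 / wt m ^ 1) := by
          have := mul_abs_cube_div_le (s := 1) (A := A * δ ^ 2) (by positivity) m
          gcongr
      _ = _ := by ring
  · refine ((h' t δ hδ h0 h1).decay m).trans ?_
    refine (div_wt_pow_le (s := 1) (by positivity) (by omega) m).trans (le_of_eq ?_)
    ring

/-- Consistency in time of the two-step scheme. -/
lemma Flow.norm_two_step_le (F : Flow r T p c K u v) (hr : 6 ≤ r) :
    ∃ A, 0 ≤ A ∧ ∀ t δ, 0 ≤ δ → 0 ≤ t - δ → t + δ ≤ T → ∀ m : ℤ,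
      ‖fc (u (t + δ)) m - fc (u (t - δ)) m +
        Complex.I * (δ * (c * m ^ 3) : ℝ) * (fc (u (t + δ)) m + fc (u (t - δ)) m) -
        2 * δ * fc (cubic c v t) m‖ ≤ A * δ ^ 3 / wt m := by
  obtain ⟨A, hA, h⟩ := F.norm_fc_second_diff_le hr
  obtain ⟨B, hB, h'⟩ := F.norm_rate_second_diff_le hr
  refine ⟨|c| * A + B, by positivity, fun t δ hδ h0 h1 m => ?_⟩
  have hw := wt_pos m
  have h2 := norm_centered_diff_le (A := B / wt m) (fun t ht => F.deriv t ht m) (by positivity) hδ h0 h1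
    (fun s hs => h' t s hs.1 (by linarith [hs.2]) (by linarith [hs.2]) m)
  -- Replacing the implicit average by the midpoint value costs δ c m³ times a second difference,
  -- that is δ m³ · δ²/(1+|m|)⁴; the rest is the centred difference error.
  have e : fc (u (t + δ)) m - fc (u (t - δ)) m +
        Complex.I * (δ * (c * m ^ 3) : ℝ) * (fc (u (t + δ)) m + fc (u (t - δ)) m) -
        2 * δ * fc (cubic c v t) m =
      δ * (Complex.I * (c * m ^ 3 : ℝ)) * (fc (u (t + δ)) m + fc (u (t - δ)) m - 2 * fc (u t) m) +
      (fc (u (t + δ)) m - fc (u (t - δ)) m - 2 * δ * rate c u v t m) := by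
    rw [rate]; push_cast; ring
  rw [e]
  refine (norm_add_le _ _).trans ?_
  rw [norm_mul, norm_mul, norm_symbol, Complex.norm_real, Real.norm_of_nonneg hδ, add_mul, add_div]
  refine add_le_add ?_ (h2.trans (le_of_eq (by ring)))
  calc δ * (|c| * |(m : ℝ)| ^ 3) * ‖fc (u (t + δ)) m + fc (u (t - δ)) m - 2 * fc (u t) m‖
      ≤ δ * (|c| * |(m : ℝ)| ^ 3) * (A * δ ^ 2 / wt m ^ (1 + 3)) := by
        gcongr; exact h t δ hδ h0 h1 m
    _ = δ * |c| * (|(m : ℝ)| ^ 3 * (A * δ ^ 2 / wt m ^ (1 + 3))) := by ring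
    _ ≤ δ * |c| * (A * δ ^ 2 / wt m ^ 1) := by
        have := mul_abs_cube_div_le (s := 1) (A := A * δ ^ 2) (by positivity) m
        gcongr
    _ = _ := by ring

lemma Flow.norm_forward_le (F : Flow r T p c K u v) (hr : 6 ≤ r) :
    ∃ A, 0 ≤ A ∧ ∀ δ, 0 ≤ δ → δ ≤ T → ∀ m : ℤ,
      ‖fc (u δ) m - fc (u 0) m - δ * rate c u v 0 m‖ ≤ A * δ ^ 2 / wt m ^ 4 := by
  obtain ⟨A, hA, h⟩ := F.norm_rate_sub_le hr
  refine ⟨A, hA, fun δ hδ h1 m => ?_⟩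
  have hw := wt_pos m
  have := norm_forward_diff_le (A := A / wt m ^ 4) (t := 0) (fun t ht => F.deriv t ht m) (by positivity)
    (fun a ha b hb => h a ha b hb m) hδ le_rfl (by linarith)
  rw [zero_add] at this
  exact this.trans (le_of_eq (by ring))

end TimeRegularity

end
end Airy

/-! ### The energy method for the abstract two-step scheme. -/

namespace Airy
noncomputable section
open scoped RealInnerProductSpace

section Energy
variable {V : Type*} [NormedAddCommGroup V] [InnerProductSpace ℝ V]

/-- The energy of two consecutive error vectors. -/
def energy (δ : ℝ) (S Q : V →ₗ[ℝ] V) (e e' : V) : ℝ :=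
  ‖e'‖ ^ 2 + ‖e‖ ^ 2 - 2 * δ * ⟪S e, e'⟫ + ⟪Q e, e'⟫

/-- Pair the scheme with b + a: skewness of D leaves ‖b‖² - ‖a‖². The skewness of S' turns the large
S terms into a telescoping cross term plus S - S'. For the corrector, ⟪Qe, b - a⟫ is rewritten with
the scheme, and ⟪Qe, -D(b + a)⟫ = ⟪DQe, b + a⟫ combines with the contribution of H. -/
lemma energy_sub_energy {δ : ℝ} {D S S' H M Q Q' : V →ₗ[ℝ] V} {a e b F : V}
    (hD : ∀ x y, ⟪D x, y⟫ = -⟪x, D y⟫) (hS' : ∀ x y, ⟪S' x, y⟫ = -⟪x, S' y⟫)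
    (hQ' : ∀ x y, ⟪Q' x, y⟫ = ⟪x, Q' y⟫)
    (hs : b - a + D (b + a) = (2 * δ) • (S e + H e + M e + F)) :
    energy δ S Q e b - energy δ S' Q' a e =
      2 * δ * ⟪S e - S' e, a⟫ + 2 * δ * ⟪M e + F, b + a⟫ + ⟪(2 * δ) • H e + D (Q e), b + a⟫ +
        2 * δ * ⟪Q e, S e + H e + M e + F⟫ + ⟪Q e - Q' e, a⟫ := by
  have h1 : ⟪b - a + D (b + a), b + a⟫ = ‖b‖ ^ 2 - ‖a‖ ^ 2 := by
    have hz : ⟪D (b + a), b + a⟫ = 0 := by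
      have := hD (b + a) (b + a)
      rw [real_inner_comm] at this
      have h2 := real_inner_comm (D (b + a)) (b + a)
      linarith
    rw [inner_add_left, hz, inner_sub_left, inner_add_right, inner_add_right, real_inner_self_eq_norm_sq,
      real_inner_self_eq_norm_sq, real_inner_comm b a]
    ring
  have h2 : ⟪Q e, b - a + D (b + a)⟫ = ⟪Q e, b⟫ - ⟪Q e, a⟫ - ⟪D (Q e), b + a⟫ := by
    rw [inner_add_right, inner_sub_right, hD]; ring
  rw [hs] at h1 h2
  have h3 : ⟪S' a, e⟫ = -⟪S' e, a⟫ := by rw [hS', real_inner_comm]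
  have h4 : ⟪Q' a, e⟫ = ⟪Q' e, a⟫ := by rw [hQ', real_inner_comm]
  simp only [energy, h3, h4]
  simp only [inner_add_left, inner_sub_left, inner_add_right, real_inner_smul_left,
    real_inner_smul_right] at h1 h2 ⊢
  linarith

lemma abs_inner_le_of_norm_le {x y : V} {A B : ℝ} (hx : ‖x‖ ≤ A) (hy : ‖y‖ ≤ B) : |⟪x, y⟫| ≤ A * B :=
  (abs_real_inner_le_norm x y).trans
    (mul_le_mul hx hy (norm_nonneg _) ((norm_nonneg _).trans hx))

/-- The smallness conditions make each of the two cross terms at most ‖e‖‖e'‖/2, so together at most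
half the sum of squares. -/
lemma energy_bounds {δ s q : ℝ} {S Q : V →ₗ[ℝ] V} {e e' : V} (hδ : 0 ≤ δ)
    (hS : ‖S e‖ ≤ s * ‖e‖) (hQ : ‖Q e‖ ≤ q * ‖e‖) (hs : δ * s ≤ 1 / 4) (hq : q ≤ 1 / 2) :
    (‖e‖ ^ 2 + ‖e'‖ ^ 2) / 2 ≤ energy δ S Q e e' ∧
      energy δ S Q e e' ≤ 3 * (‖e‖ ^ 2 + ‖e'‖ ^ 2) / 2 := by
  have h1 := abs_le.1 (abs_inner_le_of_norm_le hS (le_refl ‖e'‖))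
  have h2 := abs_le.1 (abs_inner_le_of_norm_le hQ (le_refl ‖e'‖))
  have hp : 0 ≤ ‖e‖ * ‖e'‖ := by positivity
  have h3 : δ * (s * ‖e‖ * ‖e'‖) ≤ 1 / 4 * (‖e‖ * ‖e'‖) := by
    calc _ = δ * s * (‖e‖ * ‖e'‖) := by ring
      _ ≤ _ := by gcongr
  have h4 : q * ‖e‖ * ‖e'‖ ≤ 1 / 2 * (‖e‖ * ‖e'‖) := by
    calc _ = q * (‖e‖ * ‖e'‖) := by ring
      _ ≤ _ := by gcongr
  have h5 := two_mul_le_add_sq ‖e‖ ‖e'‖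
  have h6 := mul_le_mul_of_nonneg_left h1.1 hδ
  have h7 := mul_le_mul_of_nonneg_left h1.2 hδ
  unfold energy
  constructor <;> linarith [h2.1, h2.2]

/-- With x, y, z the norms of e, b, a, the summands on the left bound, in order, the five terms of
`energy_sub_energy` divided by δ. -/
lemma energy_step_quadratic_le {k : ℝ} (x y z σ : ℝ) (hk : 1 ≤ k) :
    k * x * z * 2 + 2 * ((k * x + (k * x + σ)) * (y + z)) + k * x * (y + z) +
      2 * (k * x ^ 2 + (1 / 2) * x * (k * x + σ)) + k * x * z ≤
      20 * (k * (y ^ 2 + 2 * x ^ 2 + z ^ 2)) + 20 * σ ^ 2 := by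
  have k0 : 0 ≤ k := by linarith
  have k1 : 0 ≤ k - 1 := by linarith
  have a1 : 0 ≤ k * (x - z) ^ 2 := by positivity
  have a2 : 0 ≤ k * (x - y) ^ 2 := by positivity
  have b1 := mul_nonneg k1 (sq_nonneg x)
  have b2 := mul_nonneg k1 (sq_nonneg y)
  have b3 := mul_nonneg k1 (sq_nonneg z)
  have c1 := two_mul_le_add_sq σ y
  have c2 := two_mul_le_add_sq σ z
  have c3 := two_mul_le_add_sq x σ
  have d1 : 0 ≤ k * x ^ 2 := by positivity
  have d2 : 0 ≤ k * y ^ 2 := by positivity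
  have d3 : 0 ≤ k * z ^ 2 := by positivity
  have e1 := sq_nonneg σ
  have e2 := sq_nonneg y
  linarith

/-- With w = 40kδ ≤ 1/2 one has (1 + w)/(1 - w) ≤ 1 + 4w and 1/(1 - w) ≤ 2. -/
lemma energy_step_gronwall {k δ σ E E' : ℝ} (hk : 1 ≤ k) (hδ : 0 ≤ δ) (hδk : 40 * k * δ ≤ 1 / 2)
    (hE' : 0 ≤ E') (h : E - E' ≤ 40 * k * δ * (E + E') + 20 * δ * σ ^ 2) :
    E ≤ (1 + 160 * k * δ) * E' + 40 * δ * σ ^ 2 := by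
  obtain ⟨w, hw⟩ : ∃ w, w = 40 * k * δ := ⟨_, rfl⟩
  have hw0 : 0 ≤ w := by rw [hw]; positivity
  rw [show (1 + 160 * k * δ) = 1 + 4 * w by rw [hw]; ring]
  rw [← hw] at h hδk
  have hE : E * (1 - w) ≤ (1 + w) * E' + 20 * δ * σ ^ 2 := by linarith
  have hpos : 0 < 1 - w := by linarith
  refine le_of_mul_le_mul_right (hE.trans ?_) hpos
  have i0 : 1 + w ≤ (1 + 4 * w) * (1 - w) := by nlinarith
  have i1 : (1 + w) * E' ≤ (1 + 4 * w) * (1 - w) * E' := by gcongr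
  have i3 : 0 ≤ δ * σ ^ 2 := by positivity
  have i4 : 0 ≤ δ * σ ^ 2 * (1 - 2 * w) := mul_nonneg i3 (by linarith)
  linarith

lemma energy_step {δ k s q b₀ σ : ℝ} {D S S' H M Q Q' : V →ₗ[ℝ] V} {a e b F : V}
    (hD : ∀ x y, ⟪D x, y⟫ = -⟪x, D y⟫) (hS' : ∀ x y, ⟪S' x, y⟫ = -⟪x, S' y⟫)
    (hQ' : ∀ x y, ⟪Q' x, y⟫ = ⟪x, Q' y⟫)
    (hscheme : b - a + D (b + a) = (2 * δ) • (S e + H e + M e + F))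
    (hδ : 0 ≤ δ) (hk : 1 ≤ k) (hδk : 40 * k * δ ≤ 1 / 2) (hs : δ * s ≤ 1 / 4)
    (hq : q ≤ 1 / 2) (hqb : q * b₀ ≤ k)
    (hSe : ‖S e‖ ≤ s * ‖e‖) (hQe : ‖Q e‖ ≤ q * ‖e‖) (hSa : ‖S' a‖ ≤ s * ‖a‖) (hQa : ‖Q' a‖ ≤ q * ‖a‖)
    (hB : ‖S e + H e + M e‖ ≤ b₀ * ‖e‖) (hM : ‖M e‖ ≤ k * ‖e‖)
    (hSS : ‖S e - S' e‖ ≤ k * ‖e‖) (hQQ : ‖Q e - Q' e‖ ≤ δ * k * ‖e‖)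
    (hHQ : ‖(2 * δ) • H e + D (Q e)‖ ≤ δ * k * ‖e‖) (hF : ‖F‖ ≤ k * ‖e‖ + σ) :
    energy δ S Q e b ≤ (1 + 160 * k * δ) * energy δ S' Q' a e + 40 * δ * σ ^ 2 := by
  have hid := energy_sub_energy (Q := Q) hD hS' hQ' hscheme
  have hba : ‖b + a‖ ≤ ‖b‖ + ‖a‖ := norm_add_le _ _
  have t1 := (abs_le.1 (abs_inner_le_of_norm_le hSS (le_refl ‖a‖))).2
  have t2 := (abs_le.1 (abs_inner_le_of_norm_le ((norm_add_le (M e) F).trans (add_le_add hM hF)) hba)).2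
  have t3 := (abs_le.1 (abs_inner_le_of_norm_le hHQ hba)).2
  have t4 := (abs_le.1 (abs_inner_le_of_norm_le hQe
    ((norm_add_le (S e + H e + M e) F).trans (add_le_add hB hF)))).2
  have t5 := (abs_le.1 (abs_inner_le_of_norm_le hQQ (le_refl ‖a‖))).2
  obtain ⟨l1, -⟩ := energy_bounds (e' := b) hδ hSe hQe hs hq
  obtain ⟨l2, -⟩ := energy_bounds (e' := e) hδ hSa hQa hs hq
  set x := ‖e‖
  set y := ‖b‖
  set z := ‖a‖
  have hx : 0 ≤ x := norm_nonneg _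
  have hy : 0 ≤ y := norm_nonneg _
  have hz : 0 ≤ z := norm_nonneg _
  have hσ : 0 ≤ k * x + σ := (norm_nonneg _).trans hF
  set E := energy δ S Q e b
  set E' := energy δ S' Q' a e
  -- Here S + H + M is paired with Qe. Its norm b₀ grows like N, but q is of order N^{-2}; only q b₀
  -- ≤ k is needed.
  have t4' : q * x * (b₀ * x + (k * x + σ)) ≤ k * x ^ 2 + (1 / 2) * x * (k * x + σ) := by
    have h1 : q * b₀ * x ^ 2 ≤ k * x ^ 2 := by gcongr
    have h2 : q * (x * (k * x + σ)) ≤ 1 / 2 * (x * (k * x + σ)) := by gcongr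
    linarith
  have hX := energy_step_quadratic_le x y z σ hk
  have hmain : E - E' ≤ δ * (20 * (k * (y ^ 2 + 2 * x ^ 2 + z ^ 2)) + 20 * σ ^ 2) := by
    refine le_trans ?_ (mul_le_mul_of_nonneg_left hX hδ)
    have t1' := mul_le_mul_of_nonneg_left t1 hδ
    have t2' := mul_le_mul_of_nonneg_left t2 hδ
    have t4'' := mul_le_mul_of_nonneg_left (t4.trans t4') hδ
    rw [hid]
    linarith
  have hE' : 0 ≤ E' := le_trans (by positivity) l2
  have hkδ : 0 ≤ k * δ := by positivity
  have h5 : E - E' ≤ 40 * k * δ * (E + E') + 20 * δ * σ ^ 2 := by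
    have h6 : k * δ * (y ^ 2 + 2 * x ^ 2 + z ^ 2) ≤ k * δ * (2 * (E + E')) := by
      gcongr; linarith
    linarith
  exact energy_step_gronwall hk hδ hδk hE' h5

/-- The amplification constant of the two-step scheme. -/
def ampl (k T : ℝ) : ℝ := Real.sqrt (2 * (Real.exp (160 * k * T) * (3 + 40 * T)))

/-- Nonlinear stability of the two-step scheme: the perturbations `F` need to be controlled only
as long as the errors are at most `ρ`. -/
lemma two_step_stability {n : ℕ} {δ k s q b₀ σ ρ T : ℝ} {D : V →ₗ[ℝ] V} {S H M Q : ℕ → V →ₗ[ℝ] V}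
    {e F : ℕ → V} (hD : ∀ x y, ⟪D x, y⟫ = -⟪x, D y⟫) (hS : ∀ j ≤ n, ∀ x y, ⟪S j x, y⟫ = -⟪x, S j y⟫)
    (hQ : ∀ j ≤ n, ∀ x y, ⟪Q j x, y⟫ = ⟪x, Q j y⟫)
    (hscheme : ∀ j, j + 2 ≤ n → e (j + 2) - e j + D (e (j + 2) + e j) =
      (2 * δ) • (S (j + 1) (e (j + 1)) + H (j + 1) (e (j + 1)) + M (j + 1) (e (j + 1)) + F (j + 1)))
    (hδ : 0 ≤ δ) (hk : 1 ≤ k) (hδk : 40 * k * δ ≤ 1 / 2) (hs : δ * s ≤ 1 / 4)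
    (hq : q ≤ 1 / 2) (hqb : q * b₀ ≤ k)
    (hSe : ∀ j ≤ n, ∀ x, ‖S j x‖ ≤ s * ‖x‖) (hQe : ∀ j ≤ n, ∀ x, ‖Q j x‖ ≤ q * ‖x‖)
    (hB : ∀ j ≤ n, ∀ x, ‖S j x + H j x + M j x‖ ≤ b₀ * ‖x‖) (hM : ∀ j ≤ n, ∀ x, ‖M j x‖ ≤ k * ‖x‖)
    (hSS : ∀ j, j + 1 ≤ n → ∀ x, ‖S (j + 1) x - S j x‖ ≤ k * ‖x‖)
    (hQQ : ∀ j, j + 1 ≤ n → ∀ x, ‖Q (j + 1) x - Q j x‖ ≤ δ * k * ‖x‖)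
    (hHQ : ∀ j ≤ n, ∀ x, ‖(2 * δ) • H j x + D (Q j x)‖ ≤ δ * k * ‖x‖)
    (hF : ∀ j, j + 2 ≤ n → ‖e (j + 1)‖ ≤ ρ → ‖F (j + 1)‖ ≤ k * ‖e (j + 1)‖ + σ)
    (hσ : 0 ≤ σ) (hT : n * δ ≤ T) (hρ : ampl k T * σ ≤ ρ) (h0 : ‖e 0‖ ≤ σ) (h1 : ‖e 1‖ ≤ σ) :
    ∀ j, j + 1 ≤ n → ‖e j‖ ≤ ampl k T * σ ∧ ‖e (j + 1)‖ ≤ ampl k T * σ := by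
  have hT0 : 0 ≤ T := le_trans (by positivity) hT
  -- In `ampl` the factor 2 comes from the lower energy bound, 3 from the upper bound at the start,
  -- and 40T from the accumulated forcing.
  have hbound : ∀ j, j + 1 ≤ n → energy δ (S j) (Q j) (e j) (e (j + 1)) ≤
      (1 + 160 * k * δ) ^ j * (3 * σ ^ 2 + 40 * δ * σ ^ 2 * j) →
      ‖e j‖ ≤ ampl k T * σ ∧ ‖e (j + 1)‖ ≤ ampl k T * σ := by
    intro j hj hE
    have hl := (energy_bounds (e := e j) (e' := e (j + 1)) hδ (hSe j (by omega) _) (hQe j (by omega) _)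
      hs hq).1
    have hjT : j * δ ≤ T := by
      refine le_trans ?_ hT
      have : (j : ℝ) ≤ n := by exact_mod_cast (by omega : j ≤ n)
      gcongr
    have hpow : (1 + 160 * k * δ) ^ j ≤ Real.exp (160 * k * T) := by
      calc (1 + 160 * k * δ) ^ j ≤ Real.exp (160 * k * δ) ^ j := by
            gcongr
            linarith [Real.add_one_le_exp (160 * k * δ)]
        _ = Real.exp (160 * k * (j * δ)) := by rw [← Real.exp_nat_mul]; congr 1; ring
        _ ≤ _ := by gcongr
    have hE2 : energy δ (S j) (Q j) (e j) (e (j + 1)) ≤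
        Real.exp (160 * k * T) * (3 + 40 * T) * σ ^ 2 := by
      refine hE.trans ?_
      calc _ = (1 + 160 * k * δ) ^ j * (3 + 40 * (j * δ)) * σ ^ 2 := by ring
        _ ≤ _ := by gcongr
    have hsq : ∀ x : ℝ, x ^ 2 ≤ 2 * (Real.exp (160 * k * T) * (3 + 40 * T)) * σ ^ 2 →
        x ≤ ampl k T * σ := by
      intro x hx
      refine le_of_abs_le (abs_le_of_sq_le_sq ?_ (by unfold ampl; positivity))
      rw [mul_pow, ampl, Real.sq_sqrt (by positivity)]
      exact hx
    constructor
    · apply hsq; nlinarith [sq_nonneg ‖e (j + 1)‖]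
    · apply hsq; nlinarith [sq_nonneg ‖e j‖]
  have hind : ∀ j, j + 1 ≤ n → energy δ (S j) (Q j) (e j) (e (j + 1)) ≤
      (1 + 160 * k * δ) ^ j * (3 * σ ^ 2 + 40 * δ * σ ^ 2 * j) := by
    intro j
    induction j with
    | zero =>
      intro hj
      have hu := (energy_bounds (e := e 0) (e' := e 1) hδ (hSe 0 (by omega) _) (hQe 0 (by omega) _) hs hq).2
      have g0 : ‖e 0‖ ^ 2 ≤ σ ^ 2 := by gcongr
      have g1 : ‖e 1‖ ^ 2 ≤ σ ^ 2 := by gcongr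
      simp only [zero_add, pow_zero, one_mul, Nat.cast_zero, mul_zero, add_zero]
      linarith
    | succ j ih =>
      intro hj
      have hprev := ih (by omega)
      -- The bootstrap: the bound already proved up to index j + 1 is at most ρ, which licenses the
      -- estimate of `F` in the next step.
      have hsmall := (hbound j (by omega) hprev).2.trans hρ
      have hstep := energy_step hD (hS j (by omega)) (hQ j (by omega)) (hscheme j (by omega)) hδ hk hδk hs
        hq hqb (hSe (j + 1) (by omega) _) (hQe (j + 1) (by omega) _) (hSe j (by omega) _)
        (hQe j (by omega) _) (hB (j + 1) (by omega) _) (hM (j + 1) (by omega) _) (hSS j (by omega) _)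
        (hQQ j (by omega) _) (hHQ (j + 1) (by omega) _) (hF j (by omega) hsmall)
      refine hstep.trans ?_
      have ha : 1 ≤ 1 + 160 * k * δ := by
        have : 0 ≤ 160 * k * δ := by positivity
        linarith
      have hb : 1 ≤ (1 + 160 * k * δ) ^ (j + 1) := one_le_pow₀ ha
      have hc : 0 ≤ 40 * δ * σ ^ 2 := by positivity
      have hd := mul_le_mul_of_nonneg_right hb hc
      have he := mul_le_mul_of_nonneg_left hprev (by linarith : (0 : ℝ) ≤ 1 + 160 * k * δ)
      have hp : (1 + 160 * k * δ) ^ (j + 1) = (1 + 160 * k * δ) ^ j * (1 + 160 * k * δ) := pow_succ _ _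
      push_cast
      rw [hp] at hd ⊢
      linarith
  exact fun j hj => hbound j hj (hind j hj)

end Energy

end
end Airy

/-! ### Operators on Fourier vectors and the splitting of the linearised term. -/

namespace Airy
noncomputable section
open scoped RealInnerProductSpace ComplexConjugate

section Kernels
variable {N : ℕ}

/-- Vectors of discrete Fourier coefficients. -/
abbrev Vec (N : ℕ) := EuclideanSpace ℂ (idx N)

/-- The vector of the values of `g` at the wave numbers. -/
def vec (N : ℕ) (g : ℤ → ℂ) : Vec N := WithLp.toLp 2 fun m => g m

@[simp] lemma vec_apply (g : ℤ → ℂ) (m : idx N) : vec N g m = g m := rfl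

lemma norm_vec_sq (g : ℤ → ℂ) : ‖vec N g‖ ^ 2 = ∑ m ∈ idx N, ‖g m‖ ^ 2 := by
  rw [EuclideanSpace.norm_sq_eq]
  exact Finset.sum_coe_sort (idx N) fun m => ‖g m‖ ^ 2

/-- The operator with kernel `κ`. -/
def kop (N : ℕ) (κ : ℤ → ℤ → ℂ) : Vec N →ₗ[ℝ] Vec N where
  toFun x := WithLp.toLp 2 fun m => ∑ n : idx N, κ m n * x n
  map_add' x y := by ext m; simp [mul_add, Finset.sum_add_distrib]
  map_smul' a x := by
    ext m
    simp only [PiLp.smul_apply, RingHom.id_apply, Finset.smul_sum, Complex.real_smul]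
    exact Finset.sum_congr rfl fun n _ => by ring

lemma kop_apply (κ : ℤ → ℤ → ℂ) (x : Vec N) (m : idx N) : kop N κ x m = ∑ n : idx N, κ m n * x n := rfl

lemma inner_eq_re (x y : Vec N) : ⟪x, y⟫ = (∑ m, conj (x m) * y m).re := by
  rw [PiLp.inner_apply, Complex.re_sum]
  refine Finset.sum_congr rfl fun m _ => ?_
  rw [Complex.inner, mul_comm]

lemma inner_kop {κ : ℤ → ℤ → ℂ} {ε : ℝ} (h : ∀ m n, conj (κ m n) = ε * κ n m) (x y : Vec N) :
    ⟪kop N κ x, y⟫ = ε * ⟪x, kop N κ y⟫ := by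
  rw [inner_eq_re, inner_eq_re, ← Complex.re_ofReal_mul]
  congr 1
  simp only [kop_apply, map_sum, map_mul, Finset.sum_mul, Finset.mul_sum]
  rw [Finset.sum_comm]
  refine Finset.sum_congr rfl fun n _ => Finset.sum_congr rfl fun m _ => ?_
  rw [h m n]; ring

/-- Schur's test: Cauchy–Schwarz with the weights ‖κ m n‖, using row sums first and column sums
afterwards. -/
lemma norm_kop_le {κ : ℤ → ℤ → ℂ} {A : ℝ} (hA : 0 ≤ A) (hr : ∀ m ∈ idx N, ∑ n ∈ idx N, ‖κ m n‖ ≤ A)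
    (hc : ∀ n ∈ idx N, ∑ m ∈ idx N, ‖κ m n‖ ≤ A) (x : Vec N) : ‖kop N κ x‖ ≤ A * ‖x‖ := by
  refine le_of_abs_le (abs_le_of_sq_le_sq ?_ (by positivity))
  rw [mul_pow, EuclideanSpace.norm_sq_eq, EuclideanSpace.norm_sq_eq]
  have h1 : ∀ m : idx N, ‖kop N κ x m‖ ^ 2 ≤ A * ∑ n : idx N, ‖κ m n‖ * ‖x n‖ ^ 2 := by
    intro m
    rw [kop_apply]
    have h2 := Finset.sum_sq_le_sum_mul_sum_of_sq_le_mul (Finset.univ : Finset (idx N))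
      (r := fun n => ‖κ m n‖ * ‖x n‖) (f := fun n => ‖κ m n‖) (g := fun n => ‖κ m n‖ * ‖x n‖ ^ 2)
      (fun _ _ => norm_nonneg _) (fun _ _ => by positivity) (fun _ _ => le_of_eq (by ring))
    have h3 : ‖∑ n : idx N, κ m n * x n‖ ≤ ∑ n : idx N, ‖κ m n‖ * ‖x n‖ := by
      refine (norm_sum_le _ _).trans (le_of_eq ?_)
      exact Finset.sum_congr rfl fun _ _ => norm_mul _ _
    have h4 : ∑ n : idx N, ‖κ m n‖ ≤ A := by
      rw [Finset.sum_coe_sort (idx N) (fun n => ‖κ m n‖)]; exact hr m m.2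
    calc _ ≤ (∑ n : idx N, ‖κ m n‖ * ‖x n‖) ^ 2 := by gcongr
      _ ≤ _ := h2
      _ ≤ _ := by gcongr
  refine (Finset.sum_le_sum fun m _ => h1 m).trans ?_
  rw [← Finset.mul_sum, Finset.sum_comm, sq, mul_assoc]
  gcongr
  rw [Finset.mul_sum]
  refine Finset.sum_le_sum fun n _ => ?_
  rw [← Finset.sum_mul]
  gcongr
  rw [Finset.sum_coe_sort (idx N) (fun m => ‖κ m n‖)]; exact hc n n.2

lemma abs_sub_le_of_mem_idx {m n : ℤ} (hm : m ∈ idx N) (hn : n ∈ idx N) :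
    |((m - n : ℤ) : ℝ)| ≤ N := by
  have h1 := abs_le_of_mem_idx hm
  have h2 := abs_le_of_mem_idx hn
  have := abs_sub (m : ℝ) n
  push_cast; linarith

lemma cdist_comm (m n : ℤ) : cdist N (m - n) = cdist N (n - m) := by
  unfold cdist
  rw [show ((m - n : ℤ) : ℝ) = -((n - m : ℤ) : ℝ) by push_cast; ring, abs_neg]

lemma norm_kop_le_of_decay {κ : ℤ → ℤ → ℂ} {A : ℝ} (hA : 0 ≤ A)
    (h : ∀ m ∈ idx N, ∀ n ∈ idx N, ‖κ m n‖ ≤ A / (1 + cdist N (m - n)) ^ 2) (x : Vec N) :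
    ‖kop N κ x‖ ≤ 3 * wsum * A * ‖x‖ := by
  have hW := one_le_wsum
  have hsum : ∀ m ∈ idx N, ∑ n ∈ idx N, A / (1 + cdist N (m - n)) ^ 2 ≤ 3 * wsum * A := by
    intro m hm
    have := sum_inv_cdist_sq_le (N := N) (idx N) m fun n hn => abs_sub_le_of_mem_idx hm hn
    calc _ = A * ∑ n ∈ idx N, 1 / (1 + cdist N (m - n)) ^ 2 := by
          rw [Finset.mul_sum]; exact Finset.sum_congr rfl fun _ _ => by ring
      _ ≤ A * (3 * wsum) := by gcongr
      _ = _ := by ring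
  refine norm_kop_le (by positivity) (fun m hm => ?_) (fun n hn => ?_) x
  · exact (Finset.sum_le_sum fun n hn => h m hm n hn).trans (hsum m hm)
  · refine (Finset.sum_le_sum fun m hm => (h m hm n hn).trans (le_of_eq ?_)).trans (hsum n hn)
    rw [cdist_comm]

/-- The diagonal operator with purely imaginary entries `iγ_m`. -/
def diag (N : ℕ) (γ : ℤ → ℝ) : Vec N →ₗ[ℝ] Vec N where
  toFun x := WithLp.toLp 2 fun m => Complex.I * γ m * x m
  map_add' x y := by ext m; simp [mul_add]
  map_smul' a x := by
    ext m
    simp only [PiLp.smul_apply, RingHom.id_apply, Complex.real_smul]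
    ring

lemma diag_apply (γ : ℤ → ℝ) (x : Vec N) (m : idx N) : diag N γ x m = Complex.I * γ m * x m := rfl

lemma inner_diag (γ : ℤ → ℝ) (x y : Vec N) : ⟪diag N γ x, y⟫ = -⟪x, diag N γ y⟫ := by
  rw [inner_eq_re, inner_eq_re, ← Complex.neg_re, ← Finset.sum_neg_distrib]
  congr 1
  refine Finset.sum_congr rfl fun m _ => ?_
  simp only [diag_apply, map_mul, Complex.conj_I, Complex.conj_ofReal]; ring

/-- The skew part of the multiplication operator composed with the spectral derivative. -/
def kerS (α : ℤ → ℂ) (m n : ℤ) : ℂ := α (m - n) * (Complex.I * ((m + n) / 2))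

/-- The hermitian part, restricted to the pairs of wave numbers that interact through aliasing. -/
def kerH (N : ℕ) (α : ℤ → ℂ) (m n : ℤ) : ℂ :=
  if (N : ℤ) < 2 * |m - n| then α (m - n) * (Complex.I * ((n - m) / 2)) else 0

/-- The corrector that compensates `kerH` through the dispersion. -/
def kerQ (N : ℕ) (c : ℝ) (α : ℤ → ℂ) (m n : ℤ) : ℂ :=
  if (N : ℤ) < 2 * |m - n| then α (m - n) * ((2 / c / (m ^ 2 + m * n + n ^ 2) : ℝ) : ℂ) else 0

/-- The multiplication operator composed with the spectral derivative, conjugated by the weight `w`. -/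
def kerB (w : ℤ → ℝ) (α : ℤ → ℂ) (m n : ℤ) : ℂ := (w m / w n : ℝ) * α (m - n) * (Complex.I * n)

/-- The remaining bounded part. -/
def kerM (N : ℕ) (w : ℤ → ℝ) (α : ℤ → ℂ) (m n : ℤ) : ℂ :=
  kerB w α m n - kerS α m n - kerH N α m n

lemma kerS_skew {α : ℤ → ℂ} (hα : ∀ l, conj (α l) = α (-l)) (m n : ℤ) :
    conj (kerS α m n) = ((-1 : ℝ) : ℂ) * kerS α n m := by
  simp only [kerS, map_mul, hα, neg_sub, Complex.conj_I, map_div₀, map_add, Complex.conj_ofNat]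
  rw [Complex.conj_eq_iff_im.2 (by simp : ((m : ℂ)).im = 0), Complex.conj_eq_iff_im.2 (by simp : ((n : ℂ)).im = 0)]
  push_cast; ring

lemma kerQ_symm {c : ℝ} {α : ℤ → ℂ} (hα : ∀ l, conj (α l) = α (-l)) (m n : ℤ) :
    conj (kerQ N c α m n) = ((1 : ℝ) : ℂ) * kerQ N c α n m := by
  simp only [kerQ, abs_sub_comm n m]
  split_ifs
  · simp only [map_mul, hα, neg_sub, Complex.conj_ofReal, Complex.ofReal_one, one_mul]
    congr 3; ring
  · simp

section Bounds
variable {α : ℤ → ℂ} {A : ℝ} {m n : ℤ}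

/-- Decay of the coefficients of a multiplication operator on the grid. -/
def GridDecay (N : ℕ) (A : ℝ) (α : ℤ → ℂ) : Prop :=
  ∀ l : ℤ, |(l : ℝ)| ≤ N → ‖α l‖ ≤ A / (1 + cdist N l) ^ 4

lemma GridDecay.nonneg (h : GridDecay N A α) : 0 ≤ A := by
  have := (norm_nonneg _).trans (h 0 (by simp))
  simpa [cdist] using this

lemma GridDecay.le (h : GridDecay N A α) (hm : m ∈ idx N) (hn : n ∈ idx N) :
    ‖α (m - n)‖ * (1 + cdist N (m - n)) ≤ A / (1 + cdist N (m - n)) ^ 2 := by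
  have hl := abs_sub_le_of_mem_idx hm hn
  have hd := cdist_nonneg hl
  have hA := h.nonneg
  calc _ ≤ A / (1 + cdist N (m - n)) ^ 4 * (1 + cdist N (m - n)) := by gcongr; exact h _ hl
    _ = A / (1 + cdist N (m - n)) ^ 3 := by field_simp
    _ ≤ _ := by gcongr <;> linarith

lemma norm_le_of_gridDecay (h : GridDecay N A α) (hm : m ∈ idx N) (hn : n ∈ idx N) {X : ℂ} {B : ℝ}
    (hB : 0 ≤ B) (hX : ‖X‖ ≤ B * (1 + cdist N (m - n))) :
    ‖α (m - n) * X‖ ≤ B * A / (1 + cdist N (m - n)) ^ 2 := by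
  rw [norm_mul]
  calc _ ≤ ‖α (m - n)‖ * (B * (1 + cdist N (m - n))) := by gcongr
    _ = B * (‖α (m - n)‖ * (1 + cdist N (m - n))) := by ring
    _ ≤ B * (A / (1 + cdist N (m - n)) ^ 2) := by gcongr; exact h.le hm hn
    _ = _ := by ring

lemma abs_lt_of_wrapped (h : (N : ℤ) < 2 * |m - n|) : (N : ℝ) < 2 * |(m : ℝ) - n| := by
  exact_mod_cast h

/-- Both indices are at most N/2 in modulus, so a distance above N/2 forces opposite signs. Then |m
- n| = |m| + |n|, and |m + n| = ||m| - |n|| is at most N - |m| - |n|. -/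
lemma wrapped_sign (hm : m ∈ idx N) (hn : n ∈ idx N) (h : (N : ℤ) < 2 * |m - n|) :
    |(m : ℝ) + n| ≤ cdist N (m - n) ∧ (m : ℝ) * n ≤ 0 := by
  have h1 := abs_le.1 (abs_le_of_mem_idx hm)
  have h2 := abs_le.1 (abs_le_of_mem_idx hn)
  have h3 := abs_lt_of_wrapped h
  unfold cdist
  push_cast
  rw [le_min_iff, and_assoc]
  rcases abs_cases ((m : ℝ) - n) with ⟨ha, hb⟩ | ⟨ha, hb⟩
  · rw [ha] at h3 ⊢
    have hm0 : 0 ≤ (m : ℝ) := by linarith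
    have hn0 : (n : ℝ) ≤ 0 := by linarith
    refine ⟨abs_le.2 ⟨by linarith, by linarith⟩, abs_le.2 ⟨by linarith, by linarith⟩,
      mul_nonpos_of_nonneg_of_nonpos hm0 hn0⟩
  · rw [ha] at h3 ⊢
    have hm0 : (m : ℝ) ≤ 0 := by linarith
    have hn0 : 0 ≤ (n : ℝ) := by linarith
    refine ⟨abs_le.2 ⟨by linarith, by linarith⟩, abs_le.2 ⟨by linarith, by linarith⟩,
      mul_nonpos_of_nonpos_of_nonneg hm0 hn0⟩

lemma cdist_of_not_wrapped (h : ¬ (N : ℤ) < 2 * |m - n|) : cdist N (m - n) = |(m : ℝ) - n| := by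
  have h1 : 2 * |(m : ℝ) - n| ≤ N := by
    have := not_lt.1 h
    exact_mod_cast this
  unfold cdist
  push_cast
  rw [min_eq_left]; linarith

/-- The error weight depends on |m| only, so it varies slowly even across an aliased pair m ≈ -n. -/
lemma abs_abs_sub_abs_le_cdist (hm : m ∈ idx N) (hn : n ∈ idx N) :
    |(|(m : ℝ)| - |(n : ℝ)|)| ≤ cdist N (m - n) := by
  by_cases h : (N : ℤ) < 2 * |m - n|
  · have := (wrapped_sign hm hn h).1
    have h2 := abs_abs_sub_abs_le (m : ℝ) (-n)
    rw [abs_neg, sub_neg_eq_add] at h2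
    exact h2.trans this
  · rw [cdist_of_not_wrapped h]
    exact abs_abs_sub_abs_le _ _

lemma norm_kerS_le (h : GridDecay N A α) (hm : m ∈ idx N) (hn : n ∈ idx N) :
    ‖kerS α m n‖ ≤ N * A / (1 + cdist N (m - n)) ^ 2 := by
  have h1 := abs_le_of_mem_idx hm
  have h2 := abs_le_of_mem_idx hn
  have hd := cdist_nonneg (abs_sub_le_of_mem_idx hm hn)
  have hN : (0 : ℝ) ≤ N := Nat.cast_nonneg N
  refine norm_le_of_gridDecay h hm hn hN ?_
  rw [norm_mul, Complex.norm_I, one_mul, show (((m : ℂ) + n) / 2) = (((m + n) / 2 : ℝ) : ℂ) by push_cast; ring,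
    Complex.norm_real, Real.norm_eq_abs, abs_div, abs_two]
  have := abs_add_le (m : ℝ) n
  nlinarith

lemma norm_kerH_le (h : GridDecay N A α) (hm : m ∈ idx N) (hn : n ∈ idx N) :
    ‖kerH N α m n‖ ≤ N * A / (1 + cdist N (m - n)) ^ 2 := by
  have hd := cdist_nonneg (abs_sub_le_of_mem_idx hm hn)
  have hN : (0 : ℝ) ≤ N := Nat.cast_nonneg N
  have hA := h.nonneg
  unfold kerH
  split_ifs
  · refine norm_le_of_gridDecay h hm hn hN ?_
    rw [norm_mul, Complex.norm_I, one_mul,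
      show (((n : ℂ) - m) / 2) = ((((n - m : ℤ) : ℝ) / 2 : ℝ) : ℂ) by push_cast; ring,
      Complex.norm_real, Real.norm_eq_abs, abs_div, abs_two]
    have := abs_sub_le_of_mem_idx hn hm
    nlinarith
  · rw [norm_zero]; positivity

/-- Use m² + mn + n² = (3(m + n)² + (m - n)²)/4. This is the nonresonance bound: m³ - n³ is m - n
times this quantity. -/
lemma quad_ge_of_wrapped (h : (N : ℤ) < 2 * |m - n|) :
    (N : ℝ) ^ 2 / 16 ≤ (m : ℝ) ^ 2 + m * n + n ^ 2 := by
  have h3 := abs_lt_of_wrapped h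
  have hN : (0 : ℝ) ≤ N := Nat.cast_nonneg N
  have h4 : (N : ℝ) ^ 2 ≤ (2 * |(m : ℝ) - n|) ^ 2 := by gcongr
  rw [mul_pow, sq_abs] at h4
  nlinarith [sq_nonneg ((m : ℝ) + n)]

lemma norm_kerQ_le {c : ℝ} (hc : 0 < c) (hN : 0 < N) (h : GridDecay N A α) (hm : m ∈ idx N)
    (hn : n ∈ idx N) : ‖kerQ N c α m n‖ ≤ 32 / (c * N ^ 2) * A / (1 + cdist N (m - n)) ^ 2 := by
  have hd := cdist_nonneg (abs_sub_le_of_mem_idx hm hn)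
  have hN' : (0 : ℝ) < N := by exact_mod_cast hN
  have hA := h.nonneg
  unfold kerQ
  split_ifs with hw
  · refine norm_le_of_gridDecay h hm hn (by positivity) ?_
    have hq := quad_ge_of_wrapped hw
    have hq0 : 0 < (N : ℝ) ^ 2 / 16 := by positivity
    rw [Complex.norm_real, Real.norm_of_nonneg (div_nonneg (by positivity) (by linarith))]
    calc 2 / c / ((m : ℝ) ^ 2 + m * n + n ^ 2) ≤ 2 / c / ((N : ℝ) ^ 2 / 16) := by gcongr
      _ = 32 / (c * N ^ 2) * 1 := by field_simp; norm_num
      _ ≤ _ := by gcongr; linarith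
  · rw [norm_zero]; positivity

/-- The cancellation behind the corrector: (n - m) + 2m³/(m² + mn + n²) = (m + n)(m² - mn + n²)/(m²
+ mn + n²). On wrapped pairs |m + n| is at most the cyclic distance, which the decay of α absorbs,
so the factor N is gone. -/
lemma norm_kerHQ_le {c δ : ℝ} (hc : 0 < c) (hδ : 0 ≤ δ) (hN : 0 < N) (h : GridDecay N A α)
    (hm : m ∈ idx N) (hn : n ∈ idx N) :
    ‖(2 * δ : ℝ) * kerH N α m n + Complex.I * ((δ * (c * m ^ 3) : ℝ) : ℂ) * kerQ N c α m n‖ ≤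
      12 * δ * A / (1 + cdist N (m - n)) ^ 2 := by
  have hd := cdist_nonneg (abs_sub_le_of_mem_idx hm hn)
  have hN' : (0 : ℝ) < N := by exact_mod_cast hN
  have hA := h.nonneg
  unfold kerH kerQ
  split_ifs with hw
  · have hq := quad_ge_of_wrapped hw
    have hq0 : 0 < (N : ℝ) ^ 2 / 16 := by positivity
    have hq1 : 0 < (m : ℝ) ^ 2 + m * n + n ^ 2 := by linarith
    obtain ⟨hs, hneg⟩ := wrapped_sign hm hn hw
    have hX : (2 * δ : ℝ) * (α (m - n) * (Complex.I * (((n : ℂ) - m) / 2))) +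
        Complex.I * ((δ * (c * m ^ 3) : ℝ) : ℂ) * (α (m - n) *
          ((2 / c / ((m : ℝ) ^ 2 + m * n + n ^ 2) : ℝ) : ℂ)) =
        α (m - n) * (Complex.I * ((δ * ((m + n) * (m ^ 2 - m * n + n ^ 2) /
          ((m : ℝ) ^ 2 + m * n + n ^ 2)) : ℝ) : ℂ)) := by
      have hr : δ * (((m : ℝ) + n) * (m ^ 2 - m * n + n ^ 2) / ((m : ℝ) ^ 2 + m * n + n ^ 2)) =
          δ * ((n : ℝ) - m) + δ * (c * m ^ 3) * (2 / c / ((m : ℝ) ^ 2 + m * n + n ^ 2)) := by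
        obtain ⟨y, hy⟩ : ∃ y, y = (m : ℝ) ^ 2 + m * n + n ^ 2 := ⟨_, rfl⟩
        rw [← hy] at hq1 ⊢
        field_simp
        rw [hy]; ring
      rw [hr]; push_cast; ring
    rw [hX]
    refine norm_le_of_gridDecay h hm hn (by positivity) ?_
    rw [norm_mul, Complex.norm_I, one_mul, Complex.norm_real, Real.norm_eq_abs, abs_mul,
      abs_of_nonneg hδ, abs_div, abs_mul, abs_of_pos hq1]
    have h1 := abs_le.1 (abs_le_of_mem_idx hm)
    have h2 := abs_le.1 (abs_le_of_mem_idx hn)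
    have hp : 0 ≤ (m : ℝ) ^ 2 - m * n + n ^ 2 := by nlinarith [sq_nonneg (m : ℝ), sq_nonneg (n : ℝ)]
    -- The left side is at most 3N²/4 since |m|, |n| ≤ N/2, and m² + mn + n² ≥ N²/16.
    have hp2 : (m : ℝ) ^ 2 - m * n + n ^ 2 ≤ 12 * ((m : ℝ) ^ 2 + m * n + n ^ 2) := by
      have e1 : (m : ℝ) ^ 2 ≤ (N / 2 : ℝ) ^ 2 := sq_le_sq' (by linarith) h1.2
      have e2 : (n : ℝ) ^ 2 ≤ (N / 2 : ℝ) ^ 2 := sq_le_sq' (by linarith) h2.2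
      nlinarith [sq_nonneg ((m : ℝ) + n)]
    rw [abs_of_nonneg hp, mul_div_assoc]
    have hp3 : ((m : ℝ) ^ 2 - m * n + n ^ 2) / ((m : ℝ) ^ 2 + m * n + n ^ 2) ≤ 12 := by
      rw [div_le_iff₀ hq1]; exact hp2
    calc _ ≤ δ * (cdist N (m - n) * 12) := by gcongr
      _ = 12 * δ * cdist N (m - n) := by ring
      _ ≤ _ := by gcongr; linarith
  · simp only [mul_zero, add_zero, norm_zero]; positivity

/-- On wrapped pairs S and H together remove everything but the weight commutator (w m/w n - 1)n. On
the others (n - m)/2 also remains. Both are bounded by the cyclic distance. -/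
lemma norm_kerM_le {w : ℤ → ℝ} (hw0 : ∀ m, 0 < w m)
    (hw : ∀ m n : ℤ, |w m - w n| * |(n : ℝ)| ≤ |(|(m : ℝ)| - |(n : ℝ)|)| * w n)
    (h : GridDecay N A α) (hm : m ∈ idx N) (hn : n ∈ idx N) :
    ‖kerM N w α m n‖ ≤ 2 * A / (1 + cdist N (m - n)) ^ 2 := by
  have hd := cdist_nonneg (abs_sub_le_of_mem_idx hm hn)
  have hwn := hw0 n
  have hwt : |(w m / w n - 1) * n| ≤ cdist N (m - n) := by
    rw [div_sub_one hwn.ne', div_mul_eq_mul_div, abs_div, abs_mul, abs_of_pos hwn, div_le_iff₀ hwn]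
    refine (hw m n).trans ?_
    gcongr
    exact abs_abs_sub_abs_le_cdist hm hn
  have hwC : (w n : ℂ) ≠ 0 := by exact_mod_cast hwn.ne'
  by_cases hwr : (N : ℤ) < 2 * |m - n|
  · have e : kerM N w α m n = α (m - n) * (Complex.I * (((w m / w n - 1) * n : ℝ) : ℂ)) := by
      rw [kerM, kerB, kerS, kerH, if_pos hwr]; push_cast; ring
    rw [e]
    refine norm_le_of_gridDecay h hm hn (by norm_num) ?_
    rw [norm_mul, Complex.norm_I, one_mul, Complex.norm_real, Real.norm_eq_abs]
    linarith
  · have e : kerM N w α m n =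
        α (m - n) * (Complex.I * (((w m / w n - 1) * n + (n - m) / 2 : ℝ) : ℂ)) := by
      rw [kerM, kerB, kerS, kerH, if_neg hwr]; push_cast; ring
    rw [e]
    refine norm_le_of_gridDecay h hm hn (by norm_num) ?_
    rw [norm_mul, Complex.norm_I, one_mul, Complex.norm_real, Real.norm_eq_abs]
    have h1 := abs_add_le ((w m / w n - 1) * n : ℝ) ((n - m) / 2)
    have h2 : |((n : ℝ) - m) / 2| = cdist N (m - n) / 2 := by
      rw [abs_div, abs_two, cdist_of_not_wrapped hwr, abs_sub_comm]
    linarith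

end Bounds

end Kernels

end
end Airy

/-! ### The weighted error norm and the nonlinear remainder. -/

namespace Airy
noncomputable section

section Residual
variable {N : ℕ}

/-- The weight of the error norm. -/
def wgt (N : ℕ) (m : ℤ) : ℝ := 1 + |(m : ℝ)| / Real.sqrt N

lemma one_le_wgt (m : ℤ) : 1 ≤ wgt N m := by
  have : 0 ≤ |(m : ℝ)| / Real.sqrt N := by positivity
  unfold wgt; linarith

lemma wgt_pos (m : ℤ) : 0 < wgt N m := by linarith [one_le_wgt (N := N) m]

/-- The weight is affine in |m| with slope 1/√N, and |n|/√N ≤ `wgt N n`. This makes the commutator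
of the weight with the derivative bounded uniformly in N. -/
lemma wgt_lipschitz (m n : ℤ) :
    |wgt N m - wgt N n| * |(n : ℝ)| ≤ |(|(m : ℝ)| - |(n : ℝ)|)| * wgt N n := by
  have e : wgt N m - wgt N n = (|(m : ℝ)| - |(n : ℝ)|) / Real.sqrt N := by unfold wgt; ring
  rw [e, abs_div, abs_of_nonneg (Real.sqrt_nonneg _), div_mul_eq_mul_div, mul_div_assoc]
  gcongr
  unfold wgt; linarith

lemma abs_le_sqrt_mul_wgt (hN : 0 < N) (m : ℤ) : |(m : ℝ)| ≤ Real.sqrt N * wgt N m := by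
  have hs : 0 < Real.sqrt N := Real.sqrt_pos.2 (by exact_mod_cast hN)
  have : Real.sqrt N * wgt N m = Real.sqrt N + |(m : ℝ)| := by unfold wgt; field_simp
  linarith

lemma wgt_le (hN : 0 < N) {m : ℤ} (hm : m ∈ idx N) : wgt N m ^ 2 ≤ 4 * (N : ℝ) := by
  have hN' : (1 : ℝ) ≤ N := by exact_mod_cast hN
  have hs : 1 ≤ Real.sqrt N := Real.one_le_sqrt.2 hN'
  have hss : Real.sqrt N * Real.sqrt N = N := Real.mul_self_sqrt (by linarith)
  have h1 : wgt N m ≤ 2 * Real.sqrt N := by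
    have h2 := abs_le_of_mem_idx hm
    have : |(m : ℝ)| / Real.sqrt N ≤ Real.sqrt N := by
      rw [div_le_iff₀ (by linarith), hss]; linarith
    unfold wgt; linarith
  have h0 := (wgt_pos (N := N) m).le
  calc wgt N m ^ 2 ≤ (2 * Real.sqrt N) ^ 2 := by gcongr
    _ = 4 * (N : ℝ) := by rw [mul_pow, sq (Real.sqrt N), hss]; ring

/-- The weighted vector of coefficients. -/
def wvec (N : ℕ) (f : ℤ → ℂ) : Vec N := vec N fun m => (wgt N m : ℂ) * f m

lemma norm_wvec_sq (f : ℤ → ℂ) : ‖wvec N f‖ ^ 2 = ∑ m ∈ idx N, wgt N m ^ 2 * ‖f m‖ ^ 2 := by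
  rw [wvec, norm_vec_sq]
  refine Finset.sum_congr rfl fun m _ => ?_
  rw [norm_mul, Complex.norm_real, Real.norm_of_nonneg (wgt_pos m).le, mul_pow]

lemma wvec_add (f g : ℤ → ℂ) : wvec N (fun m => f m + g m) = wvec N f + wvec N g := by
  ext m; simp [wvec, mul_add]

lemma wvec_congr {f g : ℤ → ℂ} (h : ∀ m ∈ idx N, f m = g m) : wvec N f = wvec N g := by
  ext m; simp [wvec, h m m.2]

lemma norm_wvec_mono {f g : ℤ → ℂ} (h : ∀ m ∈ idx N, ‖f m‖ ≤ ‖g m‖) : ‖wvec N f‖ ≤ ‖wvec N g‖ := by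
  refine le_of_abs_le (abs_le_of_sq_le_sq ?_ (norm_nonneg _))
  rw [norm_wvec_sq, norm_wvec_sq]
  refine Finset.sum_le_sum fun m hm => ?_
  gcongr
  exact h m hm

lemma sum_norm_sq_le_norm_wvec_sq (f : ℤ → ℂ) : ∑ m ∈ idx N, ‖f m‖ ^ 2 ≤ ‖wvec N f‖ ^ 2 := by
  rw [norm_wvec_sq]
  refine Finset.sum_le_sum fun m _ => ?_
  have := one_le_wgt (N := N) m
  have h2 : 1 ≤ wgt N m ^ 2 := one_le_pow₀ this
  nlinarith [sq_nonneg ‖f m‖]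

/-- The loss `4 * N` from the squared weight is exactly compensated by the factor N in Parseval. -/
lemma norm_wvec_dft_sq_le (hN : 0 < N) (he : Even N) (g : ℤ → ℂ) :
    ‖wvec N (dft N g)‖ ^ 2 ≤ 4 * ∑ k ∈ idx N, ‖g k‖ ^ 2 := by
  rw [norm_wvec_sq, sum_norm_sq_eq hN he, ← mul_assoc, Finset.mul_sum]
  refine Finset.sum_le_sum fun m hm => ?_
  gcongr
  exact wgt_le hN hm

lemma norm_wvec_le_of_const (hN : 0 < N) (he : Even N) {f : ℤ → ℂ} {B : ℝ} (hB : 0 ≤ B)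
    (h : ∀ m ∈ idx N, ‖f m‖ ≤ B) : ‖wvec N f‖ ≤ 2 * N * B := by
  refine le_of_abs_le (abs_le_of_sq_le_sq ?_ (by positivity))
  rw [norm_wvec_sq]
  calc _ ≤ ∑ m ∈ idx N, 4 * N * B ^ 2 := by
        refine Finset.sum_le_sum fun m hm => ?_
        gcongr
        · exact wgt_le hN hm
        · exact h m hm
    _ = (2 * N * B) ^ 2 := by rw [Finset.sum_const, card_idx he, nsmul_eq_mul]; ring

/-- Since (wgt/wt)² ≤ 2/wt² + 2/N, the sum over N indices stays bounded. The slope 1/√N is thus the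
largest order for which a defect decaying like 1/(1+|m|) suffers no loss in N. -/
lemma norm_wvec_le_of_inv_wt (hN : 0 < N) (he : Even N) {f : ℤ → ℂ} {B : ℝ} (hB : 0 ≤ B)
    (h : ∀ m ∈ idx N, ‖f m‖ ≤ B / wt m) : ‖wvec N f‖ ≤ 2 * wsum * B := by
  have hW := one_le_wsum
  have hN' : (0 : ℝ) < N := by exact_mod_cast hN
  have hs : 0 < Real.sqrt N := Real.sqrt_pos.2 hN'
  refine le_of_abs_le (abs_le_of_sq_le_sq ?_ (by positivity))
  rw [norm_wvec_sq]
  calc _ ≤ ∑ m ∈ idx N, B ^ 2 * (2 * (1 / wt m ^ 2) + 2 / N) := by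
        refine Finset.sum_le_sum fun m hm => ?_
        have hw := wt_pos m
        have h1 : wgt N m / wt m ≤ 1 / wt m + 1 / Real.sqrt N := by
          rw [div_add_div _ _ hw.ne' hs.ne', div_le_div_iff₀ hw (by positivity)]
          have h2 : wgt N m * Real.sqrt N = Real.sqrt N + |(m : ℝ)| := by unfold wgt; field_simp
          have h3 := abs_le_wt m
          calc _ = (wgt N m * Real.sqrt N) * (wt m * 1) := by ring
            _ = (Real.sqrt N + |(m : ℝ)|) * (wt m * 1) := by rw [h2]
            _ ≤ (Real.sqrt N + wt m) * (wt m * 1) := by gcongr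
            _ = _ := by ring
        have h0 : 0 ≤ wgt N m / wt m := div_nonneg (wgt_pos m).le hw.le
        have h4 : (wgt N m / wt m) ^ 2 ≤ 2 * (1 / wt m ^ 2) + 2 / N := by
          calc _ ≤ (1 / wt m + 1 / Real.sqrt N) ^ 2 := by gcongr
            _ ≤ 2 * (1 / wt m) ^ 2 + 2 * (1 / Real.sqrt N) ^ 2 := by
              nlinarith [sq_nonneg (1 / wt m - 1 / Real.sqrt N)]
            _ = _ := by rw [div_pow, div_pow, Real.sq_sqrt hN'.le]; ring
        calc wgt N m ^ 2 * ‖f m‖ ^ 2 ≤ wgt N m ^ 2 * (B / wt m) ^ 2 := by gcongr; exact h m hm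
          _ = B ^ 2 * (wgt N m / wt m) ^ 2 := by field_simp
          _ ≤ _ := by gcongr
    _ = B ^ 2 * (2 * ∑ m ∈ idx N, 1 / wt m ^ 2 + 2) := by
        rw [← Finset.mul_sum, Finset.sum_add_distrib, ← Finset.mul_sum, Finset.sum_const, card_idx he,
          nsmul_eq_mul]
        congr 2; field_simp
    _ ≤ B ^ 2 * (2 * wsum + 2) := by gcongr; exact sum_inv_wt_sq_le _
    _ ≤ (2 * wsum * B) ^ 2 := by
        have : 2 * wsum + 2 ≤ 4 * wsum ^ 2 := by nlinarith
        calc _ ≤ B ^ 2 * (4 * wsum ^ 2) := by gcongr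
          _ = _ := by ring

lemma dft_mul_idft (f d : ℤ → ℂ) (m : ℤ) :
    dft N (fun k => f k * idft N d k) m = ∑ n ∈ idx N, dft N f (m - n) * d n := by
  simp only [dft_eq, idft_eq, Finset.mul_sum, Finset.sum_mul]
  rw [Finset.sum_comm]
  refine Finset.sum_congr rfl fun n _ => Finset.sum_congr rfl fun k _ => ?_
  rw [show -(m - n) = n + -m by ring, ex_add]; ring

lemma sum_norm_mul_sq_le (hN : 0 < N) (E : ℤ → ℂ) :
    ∑ m ∈ idx N, ‖Complex.I * m * E m‖ ^ 2 ≤ N * ‖wvec N E‖ ^ 2 := by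
  rw [norm_wvec_sq, Finset.mul_sum]
  refine Finset.sum_le_sum fun m _ => ?_
  have h := abs_le_sqrt_mul_wgt hN m
  rw [norm_mul, norm_mul, Complex.norm_I, one_mul, Complex.norm_intCast, mul_pow]
  calc |(m : ℝ)| ^ 2 * ‖E m‖ ^ 2 ≤ (Real.sqrt N * wgt N m) ^ 2 * ‖E m‖ ^ 2 := by gcongr
    _ = _ := by rw [mul_pow, Real.sq_sqrt (Nat.cast_nonneg N)]; ring

/-- The grid derivative of the function with discrete Fourier coefficients `E`. -/
def gridDeriv (N : ℕ) (E : ℤ → ℂ) : ℤ → ℂ := idft N fun m => Complex.I * m * E m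

lemma sum_norm_gridDeriv_sq_le (hN : 0 < N) (he : Even N) (E : ℤ → ℂ) :
    ∑ k ∈ idx N, ‖gridDeriv N E k‖ ^ 2 ≤ (N * ‖wvec N E‖) ^ 2 := by
  rw [gridDeriv, sum_norm_idft_sq hN he]
  calc _ ≤ (N : ℝ) * (N * ‖wvec N E‖ ^ 2) := by gcongr; exact sum_norm_mul_sq_le hN E
    _ = _ := by ring

/-- One √N comes from |m| ≤ √N `wgt N m`, the other from Cauchy–Schwarz over the N wave numbers. -/
lemma norm_gridDeriv_le (hN : 0 < N) (he : Even N) (E : ℤ → ℂ) (k : ℤ) :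
    ‖gridDeriv N E k‖ ≤ N * ‖wvec N E‖ := by
  refine le_of_abs_le (abs_le_of_sq_le_sq ?_ (by positivity))
  have h1 : ‖gridDeriv N E k‖ ≤ ∑ m ∈ idx N, ‖Complex.I * m * E m‖ := by
    rw [gridDeriv, idft_eq]
    refine (norm_sum_le _ _).trans (le_of_eq ?_)
    exact Finset.sum_congr rfl fun m _ => by rw [norm_mul, norm_ex, mul_one]
  have h2 := sq_sum_le_card_mul_sum_sq (s := idx N) (f := fun m => ‖Complex.I * m * E m‖)
  rw [card_idx he] at h2
  calc _ ≤ (∑ m ∈ idx N, ‖Complex.I * m * E m‖) ^ 2 := by gcongr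
    _ ≤ _ := h2
    _ ≤ (N : ℝ) * (N * ‖wvec N E‖ ^ 2) := by gcongr; exact sum_norm_mul_sq_le hN E
    _ = _ := by ring

variable {r : ℕ} {T p c K : ℝ} {u v : ℝ → ℝ → ℂ}

lemma WC.norm_partial_sum_sub_le {s : ℕ} {f : ℝ → ℂ} (hf : WC (s + 2) K f) (hN : 0 < N) (x : ℝ) :
    ‖∑ m ∈ idx N, fc f m * ex m x - f x‖ ≤ K * 2 ^ s * wsum / N ^ s := by
  have hN' : (0 : ℝ) < N := by exact_mod_cast hN
  have hK := hf.nonneg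
  have h1 : HasSum (fun m => if m ∈ idx N then fc f m * ex m x else 0)
      (∑ m ∈ idx N, fc f m * ex m x) := by
    rw [Finset.sum_congr rfl (g := fun m => if m ∈ idx N then fc f m * ex m x else 0)
      (fun m hm => by rw [if_pos hm])]
    exact hasSum_sum_of_ne_finset_zero (fun m hm => by simp [hm])
  have h2 := h1.sub (hf.sum x)
  have hb : ∀ m, ‖(if m ∈ idx N then fc f m * ex m x else 0) - fc f m * ex m x‖ ≤
      K * 2 ^ s / N ^ s * (1 / wt m ^ 2) := by
    intro m
    have hw := wt_pos m
    split_ifs with hm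
    · rw [sub_self, norm_zero]; positivity
    · rw [zero_sub, norm_neg, norm_mul, norm_ex, mul_one]
      refine (hf.decay m).trans ?_
      have hl : (N : ℝ) / 2 ≤ wt m := by
        have : (N : ℤ) ≤ 2 * |m| + 1 := by
          simp only [idx, Finset.mem_Ioc] at hm
          rcases abs_cases m with ⟨h, _⟩ | ⟨h, _⟩ <;> rw [h] <;> omega
        have h3 : (N : ℝ) ≤ 2 * |(m : ℝ)| + 1 := by exact_mod_cast this
        unfold wt; linarith
      calc K / wt m ^ (s + 2) = K / (wt m ^ s * wt m ^ 2) := by rw [pow_add]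
        _ ≤ K / ((N / 2) ^ s * wt m ^ 2) := by gcongr
        _ = _ := by rw [div_pow]; field_simp
  have hsum := summable_inv_wt_sq.mul_left (K * 2 ^ s / N ^ s)
  have hn := Summable.of_nonneg_of_le (fun _ => norm_nonneg _) hb hsum
  rw [← h2.tsum_eq]
  refine (norm_tsum_le_tsum_norm hn).trans ((hn.tsum_le_tsum hb hsum).trans ?_)
  rw [tsum_mul_left, ← wsum]
  apply le_of_eq; ring

/-- The coefficient of the linearised equation. -/
def lincoef (c : ℝ) (v : ℝ → ℝ → ℂ) (t x : ℝ) : ℂ := (3 * c / 2 : ℂ) * v t x ^ 2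

/-- Its discrete Fourier coefficients. -/
def gridCoef (N : ℕ) (c : ℝ) (v : ℝ → ℝ → ℂ) (t : ℝ) : ℤ → ℂ :=
  dft N fun k => lincoef c v t (node N k)

/-- Here `v` is the exact derivative, `η` its Fourier truncation error and `s` the derivative of the
numerical error. Without the part linear in `s`, each term contains η or the square of η + s; one
factor of s² is replaced by its bound `R`. -/
lemma norm_cubic_remainder_le {c Kv Kη η₀ R : ℝ} {v η s : ℂ} (hv : ‖v‖ ≤ Kv)
    (hη : ‖η‖ ≤ η₀) (hη' : η₀ ≤ Kη) (hR : R ≤ 1) (hs : ‖s‖ ≤ R) :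
    ‖(c / 2 : ℂ) * (v + (η + s)) ^ 3 - (c / 2 : ℂ) * v ^ 3 - (3 * c / 2 : ℂ) * v ^ 2 * s‖ ≤
      |c| * (2 * Kv ^ 2 + (2 * Kv + Kη + 1) * (2 * Kη + 2)) * (η₀ + R * ‖s‖) := by
  have hη0 : 0 ≤ η₀ := (norm_nonneg _).trans hη
  have hKv : 0 ≤ Kv := (norm_nonneg _).trans hv
  have hR0 : 0 ≤ R := (norm_nonneg _).trans hs
  have hKη : 0 ≤ Kη := hη0.trans hη'
  set b := η + s with hb
  have e : (c / 2 : ℂ) * (v + b) ^ 3 - (c / 2 : ℂ) * v ^ 3 - (3 * c / 2 : ℂ) * v ^ 2 * s =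
      (c : ℂ) * (3 / 2 * v ^ 2 * η + (3 / 2 * v + 1 / 2 * b) * b ^ 2) := by
    rw [hb]; ring
  have hb1 : ‖b‖ ≤ Kη + 1 := (norm_add_le η s).trans (by linarith)
  have hb2 : ‖b‖ ^ 2 ≤ (2 * Kη + 2) * (η₀ + R * ‖s‖) := by
    have h1 : ‖b‖ ≤ η₀ + ‖s‖ := (norm_add_le η s).trans (by linarith)
    have h2 : ‖b‖ ^ 2 ≤ (η₀ + ‖s‖) ^ 2 := by gcongr
    have h3 : η₀ * η₀ ≤ Kη * η₀ := by gcongr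
    have h4 : ‖s‖ * ‖s‖ ≤ R * ‖s‖ := by gcongr
    have h5 : 0 ≤ Kη * (R * ‖s‖) := by positivity
    nlinarith [sq_nonneg (η₀ - ‖s‖)]
  rw [e, norm_mul, Complex.norm_real, Real.norm_eq_abs]
  refine (mul_le_mul_of_nonneg_left ?_ (abs_nonneg c)).trans (le_of_eq (mul_assoc _ _ _).symm)
  refine (norm_add_le _ _).trans ?_
  have h1 : ‖3 / 2 * v ^ 2 * η‖ ≤ 2 * Kv ^ 2 * (η₀ + R * ‖s‖) := by
    rw [norm_mul, norm_mul, norm_pow]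
    have : ‖(3 / 2 : ℂ)‖ ≤ 2 := by
      rw [norm_div, Complex.norm_ofNat, Complex.norm_ofNat]; norm_num
    have h6 : 0 ≤ R * ‖s‖ := by positivity
    gcongr
    linarith
  have h2 : ‖(3 / 2 * v + 1 / 2 * b) * b ^ 2‖ ≤
      (2 * Kv + Kη + 1) * ((2 * Kη + 2) * (η₀ + R * ‖s‖)) := by
    rw [norm_mul, norm_pow]
    have : ‖3 / 2 * v + 1 / 2 * b‖ ≤ 2 * Kv + Kη + 1 := by
      refine (norm_add_le _ _).trans ?_
      rw [norm_mul, norm_mul, norm_div, norm_div, Complex.norm_ofNat, Complex.norm_ofNat, norm_one]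
      linarith
    gcongr
  calc _ ≤ _ := add_le_add h1 h2
    _ = _ := by ring

/-- The error of the nonlinear term is the linearised term up to a small remainder. -/
lemma Flow.norm_nonlinear_remainder_le (F : Flow r T p c K u v) {L : ℝ}
    (hc : c = (2 * Real.pi / L) ^ 3) :
    ∃ C₁, 0 ≤ C₁ ∧ ∀ N : ℕ, 0 < N → Even N → ∀ t ∈ Set.Icc 0 T, ∀ U : ℤ → ℂ,
      N ^ 2 * ‖wvec N fun m => dft N U m - fc (u t) m‖ ≤ 1 →
      ‖wvec N fun m => dft N (nonlin N L p U) m - fc (cubic c v t) m -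
        ∑ n ∈ idx N, gridCoef N c v t (m - n) * (Complex.I * n * (dft N U n - fc (u t) n))‖ ≤
      C₁ * (‖wvec N fun m => dft N U m - fc (u t) m‖ + 1 / N ^ r) := by
  obtain ⟨B, hB⟩ := F.wc_cubic
  have hW := one_le_wsum
  have hK : 0 ≤ K := by linarith [F.one_le]
  set Kη : ℝ := K * 2 ^ (r + 1) * wsum with hKη
  set Kv : ℝ := K * wsum with hKv
  set C₀ : ℝ := |c| * (2 * Kv ^ 2 + (2 * Kv + Kη + 1) * (2 * Kη + 2)) with hC₀
  have hC0 : 0 ≤ C₀ := by positivity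
  refine ⟨4 * C₀ * (Kη + 1) + 2 * (|B| * 4 ^ (r + 3) * wsum), by positivity,
    fun N hN he t ht U hsmall => ?_⟩
  have hN1 : (1 : ℝ) ≤ N := by exact_mod_cast hN
  have hN' : (0 : ℝ) < N := by linarith
  set E : ℤ → ℂ := fun m => dft N U m - fc (u t) m with hE
  set ε := ‖wvec N E‖ with hε
  have hε0 : 0 ≤ ε := norm_nonneg _
  set g : ℤ → ℂ := fun k => nonlin N L p U k - cubic c v t (node N k) -
    lincoef c v t (node N k) * gridDeriv N E k with hg
  have hs1 : N * ε ≤ 1 := by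
    refine le_trans ?_ hsmall
    gcongr; exact le_self_pow₀ hN1 (by norm_num)
  -- `E` compares discrete coefficients with the exact Fourier coefficients, so the numerical
  -- derivative is the truncated series of `v` plus the grid derivative of the error.
  have hpart : ∀ k, p + specDeriv N U k = ∑ m ∈ idx N, fc (v t) m * ex m (node N k) +
      gridDeriv N E k := by
    intro k
    have h0 : (0 : ℤ) ∈ idx N := by
      obtain ⟨M, hM⟩ := he
      simp only [idx, Finset.mem_Ioc]; omega
    have h1 : ∑ m ∈ idx N, fc (v t) m * ex m (node N k) =
        p + ∑ m ∈ idx N, Complex.I * m * fc (u t) m * ex m (node N k) := by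
      simp_rw [F.fcv t ht, add_mul, Finset.sum_add_distrib]
      congr 1
      simp_rw [ite_mul, zero_mul]
      rw [Finset.sum_ite_eq', if_pos h0, ex_zero, mul_one]
    rw [h1, specDeriv_eq, gridDeriv, idft_eq, add_assoc, ← Finset.sum_add_distrib]
    congr 1
    refine Finset.sum_congr rfl fun m _ => ?_
    simp only [hE]; ring
  have hgk : ∀ k, ‖g k‖ ≤ C₀ * (Kη / N ^ (r + 1) + N * ε * ‖gridDeriv N E k‖) := by
    intro k
    have hη := ((F.wcv t ht).norm_partial_sum_sub_le (s := r + 1) hN (node N k))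
    rw [← hKη] at hη
    set η := ∑ m ∈ idx N, fc (v t) m * ex m (node N k) - v t (node N k) with hηdef
    have hfac : Kη / N ^ (r + 1) ≤ Kη := div_le_self (by positivity) (one_le_pow₀ hN1)
    have h := norm_cubic_remainder_le (c := c) ((F.wcv t ht).norm_le (by omega) (node N k)) hη hfac hs1
      (norm_gridDeriv_le hN he E k)
    refine le_trans (le_of_eq ?_) h
    congr 1
    simp only [hg, nonlin, cubic, lincoef]
    rw [hpart k, hc]
    push_cast
    rw [hηdef]; ring
  have hwg : ‖wvec N (dft N g)‖ ≤ 4 * C₀ * (Kη + 1) * (ε + 1 / N ^ r) := by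
    have h1 : ∑ k ∈ idx N, ‖g k‖ ^ 2 ≤ 2 * C₀ ^ 2 * (N * (Kη / N ^ (r + 1)) ^ 2 + (N ^ 2 * ε * ε) ^ 2) := by
      calc _ ≤ ∑ k ∈ idx N, 2 * C₀ ^ 2 *
            ((Kη / N ^ (r + 1)) ^ 2 + (N * ε) ^ 2 * ‖gridDeriv N E k‖ ^ 2) := by
            refine Finset.sum_le_sum fun k _ => ?_
            calc ‖g k‖ ^ 2 ≤ (C₀ * (Kη / N ^ (r + 1) + N * ε * ‖gridDeriv N E k‖)) ^ 2 := by
                  gcongr; exact hgk k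
              _ = C₀ ^ 2 * (Kη / N ^ (r + 1) + N * ε * ‖gridDeriv N E k‖) ^ 2 := by ring
              _ ≤ C₀ ^ 2 * (2 * ((Kη / N ^ (r + 1)) ^ 2 + (N * ε * ‖gridDeriv N E k‖) ^ 2)) := by
                  gcongr; exact add_sq_le
              _ = _ := by ring
        _ = 2 * C₀ ^ 2 * (N * (Kη / N ^ (r + 1)) ^ 2 +
            (N * ε) ^ 2 * ∑ k ∈ idx N, ‖gridDeriv N E k‖ ^ 2) := by
            rw [← Finset.mul_sum, Finset.sum_add_distrib, ← Finset.mul_sum, Finset.sum_const, card_idx he,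
              nsmul_eq_mul]
        _ ≤ 2 * C₀ ^ 2 * (N * (Kη / N ^ (r + 1)) ^ 2 + (N * ε) ^ 2 * (N * ε) ^ 2) := by
            gcongr
            exact sum_norm_gridDeriv_sq_le hN he E
        _ = _ := by ring
    have h2 : N * (Kη / N ^ (r + 1)) ^ 2 ≤ (Kη * (1 / N ^ r)) ^ 2 := by
      calc N * (Kη / N ^ (r + 1)) ^ 2 = (Kη * (1 / N ^ r)) ^ 2 * (1 / N) := by
            rw [pow_succ (N : ℝ) r]; field_simp
        _ ≤ (Kη * (1 / N ^ r)) ^ 2 * 1 := by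
            gcongr; rw [div_le_one hN']; exact hN1
        _ = _ := mul_one _
    -- The smallness N²ε ≤ 1 enters: one Nε is the sup norm, the other the quadratic mean of the
    -- grid derivative.
    have h3 : (N ^ 2 * ε * ε) ^ 2 ≤ ε ^ 2 := by
      have : N ^ 2 * ε * ε ≤ 1 * ε := by gcongr
      rw [one_mul] at this
      gcongr
    have hP : 0 ≤ 1 / (N : ℝ) ^ r := by positivity
    refine le_of_abs_le (abs_le_of_sq_le_sq ?_ (by positivity))
    calc _ ≤ 4 * ∑ k ∈ idx N, ‖g k‖ ^ 2 := norm_wvec_dft_sq_le hN he g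
      _ ≤ 4 * (2 * C₀ ^ 2 * ((Kη * (1 / N ^ r)) ^ 2 + ε ^ 2)) := by
          refine mul_le_mul_of_nonneg_left (h1.trans ?_) (by norm_num)
          gcongr
      _ ≤ 16 * C₀ ^ 2 * ((Kη + 1) * (ε + 1 / N ^ r)) ^ 2 := by
          have hx : (Kη * (1 / N ^ r)) ^ 2 ≤ ((Kη + 1) * (ε + 1 / N ^ r)) ^ 2 := by
            gcongr <;> linarith
          have hy : ε ^ 2 ≤ ((Kη + 1) * (ε + 1 / N ^ r)) ^ 2 := by
            have : ε ≤ (Kη + 1) * (ε + 1 / N ^ r) := by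
              have hKη0 : 0 ≤ Kη * (ε + 1 / N ^ r) := by positivity
              linarith
            gcongr
          calc _ ≤ 4 * (2 * C₀ ^ 2 * (((Kη + 1) * (ε + 1 / N ^ r)) ^ 2 +
                ((Kη + 1) * (ε + 1 / N ^ r)) ^ 2)) := by gcongr
            _ = _ := by ring
      _ = _ := by ring
  -- Passing from discrete to exact coefficients of the cubic term gives N^{-(r+3)} per mode, and
  -- the weighted norm costs a factor 2N.
  have halias : ‖wvec N fun m => dft N (fun k => cubic c v t (node N k)) m - fc (cubic c v t) m‖ ≤
      2 * (|B| * 4 ^ (r + 3) * wsum) * (ε + 1 / N ^ r) := by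
    have h1 := norm_wvec_le_of_const hN he (B := |B| * 4 ^ (r + 3) * wsum / N ^ (r + 3)) (by positivity)
      (fun m hm => ((hB t ht).mono le_rfl (le_abs_self B)).norm_dft_sub_fc_le (by omega) hN he hm)
    refine h1.trans ?_
    calc 2 * N * (|B| * 4 ^ (r + 3) * wsum / N ^ (r + 3))
        = 2 * (|B| * 4 ^ (r + 3) * wsum) * (1 / N ^ (r + 2)) := by
          rw [show r + 3 = r + 2 + 1 by ring, pow_succ (N : ℝ)]; field_simp
      _ ≤ 2 * (|B| * 4 ^ (r + 3) * wsum) * (ε + 1 / N ^ r) := by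
          gcongr
          have : 1 / (N : ℝ) ^ (r + 2) ≤ 1 / N ^ r := by
            gcongr
            omega
          linarith
  have hsplit : (wvec N fun m => dft N (nonlin N L p U) m - fc (cubic c v t) m -
        ∑ n ∈ idx N, gridCoef N c v t (m - n) * (Complex.I * n * E n)) =
      wvec N (dft N g) +
        wvec N (fun m => dft N (fun k => cubic c v t (node N k)) m - fc (cubic c v t) m) := by
    rw [← wvec_add]
    refine wvec_congr fun m _ => ?_
    have h1 : dft N g m = dft N (nonlin N L p U) m - dft N (fun k => cubic c v t (node N k)) m -
        dft N (fun k => lincoef c v t (node N k) * gridDeriv N E k) m := by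
      rw [← dft_sub, ← dft_sub]
    rw [h1, gridDeriv, dft_mul_idft]
    simp only [gridCoef]; ring
  rw [hsplit]
  refine (norm_add_le _ _).trans ((add_le_add hwg halias).trans (le_of_eq ?_))
  ring

end Residual

end
end Airy

/-! ### The error equation and its perturbation. -/

namespace Airy
noncomputable section
open scoped RealInnerProductSpace ComplexConjugate

section Scheme
variable {N r : ℕ} {T p c K : ℝ} {u v : ℝ → ℝ → ℂ}

lemma kop_sub_apply (κ κ' : ℤ → ℤ → ℂ) (x : Vec N) :
    kop N κ x - kop N κ' x = kop N (fun m n => κ m n - κ' m n) x := by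
  ext m; simp [kop_apply, sub_mul, Finset.sum_sub_distrib]

lemma kop_add_apply (κ κ' : ℤ → ℤ → ℂ) (x : Vec N) :
    kop N κ x + kop N κ' x = kop N (fun m n => κ m n + κ' m n) x := by
  ext m; simp [kop_apply, add_mul, Finset.sum_add_distrib]

lemma kop_split (w : ℤ → ℝ) (α : ℤ → ℂ) (x : Vec N) :
    kop N (kerS α) x + kop N (kerH N α) x + kop N (kerM N w α) x = kop N (kerB w α) x := by
  rw [kop_add_apply, kop_add_apply]
  congr 2
  funext m n; simp only [kerM]; ring

lemma kop_kerB_wvec (α E : ℤ → ℂ) :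
    kop N (kerB (wgt N) α) (wvec N E) =
      wvec N fun m => ∑ n ∈ idx N, α (m - n) * (Complex.I * n * E n) := by
  ext m
  rw [kop_apply, wvec, wvec, vec_apply, Finset.mul_sum, ← Finset.sum_coe_sort (idx N)]
  refine Finset.sum_congr rfl fun n _ => ?_
  have hn : (wgt N n : ℂ) ≠ 0 := by exact_mod_cast (wgt_pos (N := N) n).ne'
  rw [vec_apply, kerB]
  push_cast
  field_simp

lemma kop_diag (γ : ℤ → ℝ) (κ : ℤ → ℤ → ℂ) (a : ℝ) (κ' : ℤ → ℤ → ℂ) (x : Vec N) :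
    a • kop N κ' x + diag N γ (kop N κ x) =
      kop N (fun m n => (a : ℂ) * κ' m n + Complex.I * γ m * κ m n) x := by
  ext m
  simp only [PiLp.add_apply, PiLp.smul_apply, diag_apply, kop_apply, Complex.real_smul, Finset.mul_sum,
    ← Finset.sum_add_distrib]
  exact Finset.sum_congr rfl fun n _ => by ring

lemma conj_gridCoef (F : Flow r T p c K u v) (t : ℝ) (l : ℤ) :
    conj (gridCoef N c v t l) = gridCoef N c v t (-l) := by
  refine dft_conj _ (fun k => ?_) l
  simp [lincoef, F.real, Complex.conj_ofNat]

lemma Flow.gridDecay (F : Flow r T p c K u v) (hr : 6 ≤ r) :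
    ∃ A, 0 ≤ A ∧ ∀ N : ℕ, 0 < N → Even N → ∀ t ∈ Set.Icc 0 T, GridDecay N A (gridCoef N c v t) := by
  have hK : 0 ≤ K := by linarith [F.one_le]
  have hW := one_le_wsum
  refine ⟨4 * wsum * (‖(3 * c / 2 : ℂ)‖ * (2 ^ (6 + 1) * wsum * K * K)), by positivity,
    fun N hN he t ht l hl => ?_⟩
  have h1 := (F.wcv t ht).mono (t := 6) (by omega) le_rfl
  have h2 := (h1.mul (by omega) h1).const_mul (by omega) (3 * c / 2 : ℂ)
  have h3 : WC (4 + 2) (‖(3 * c / 2 : ℂ)‖ * (2 ^ (6 + 1) * wsum * K * K)) (lincoef c v t) := by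
    convert h2 using 1
    funext x; simp only [lincoef]; ring
  exact h3.norm_dft_le hN he hl

lemma Flow.gridDecay_sub (F : Flow r T p c K u v) (hr : 6 ≤ r) :
    ∃ A, 0 ≤ A ∧ ∀ N : ℕ, 0 < N → Even N → ∀ t ∈ Set.Icc 0 T, ∀ s ∈ Set.Icc 0 T,
      GridDecay N (A * |t - s|) (fun l => gridCoef N c v t l - gridCoef N c v s l) := by
  obtain ⟨A, hA, h⟩ := F.wc_sq_sub hr
  have hW := one_le_wsum
  refine ⟨4 * wsum * (‖(3 * c / 2 : ℂ)‖ * A), by positivity, fun N hN he t ht s hs l hl => ?_⟩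
  have h2 := (h t ht s hs).const_mul (by omega) (3 * c / 2 : ℂ)
  have h3 : WC (4 + 2) (‖(3 * c / 2 : ℂ)‖ * (A * |t - s|))
      (fun x => lincoef c v t x - lincoef c v s x) := by
    convert h2 using 1
    funext x; simp only [lincoef]; ring
  have h4 := h3.norm_dft_le hN he hl
  rw [dft_sub] at h4
  refine h4.trans (le_of_eq ?_)
  ring

lemma gam_eq {L : ℝ} (hc : c = (2 * Real.pi / L) ^ 3) (dt : ℝ) (m : ℤ) :
    gam L dt m = dt * (c * m ^ 3) := by
  rw [gam, hc]; ring

/-- Multiplying by 1 + iγ undoes the division hidden in both factors, because ζ² = 1/(1 + iγ). The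
implicit form exhibits the skew operator D acting on the sum of the outer levels. -/
lemma dft_cnadbPer_two_step (hN : 0 < N) (he : Even N) (L dt : ℝ) (u₀ : ℤ → ℂ) (j : ℕ) {m : ℤ}
    (hm : m ∈ idx N) :
    dft N (cnadbPer N L p dt u₀ (j + 2)) m - dft N (cnadbPer N L p dt u₀ j) m +
      Complex.I * gam L dt m *
        (dft N (cnadbPer N L p dt u₀ (j + 2)) m + dft N (cnadbPer N L p dt u₀ j) m) =
      2 * dt * dft N (nonlin N L p (cnadbPer N L p dt u₀ (j + 1))) m := by
  have h : dft N (cnadbPer N L p dt u₀ (j + 2)) m =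
      zeta1 L dt m * dft N (cnadbPer N L p dt u₀ j) m +
        2 * dt * zeta2 L dt m * dft N (nonlin N L p (cnadbPer N L p dt u₀ (j + 1))) m := by
    rw [cnadbPer, dft_idft hN he _ hm]
  have h1 : (1 : ℂ) + Complex.I * gam L dt m ≠ 0 := by
    intro h0
    have := congrArg Complex.re h0
    simp at this
  have h2 : (1 : ℂ) - Complex.I * gam L dt m ≠ 0 := by
    intro h0
    have := congrArg Complex.re h0
    simp at this
  have h3 : (1 : ℂ) + (gam L dt m : ℂ) ^ 2 =
      (1 + Complex.I * gam L dt m) * (1 - Complex.I * gam L dt m) := by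
    linear_combination (gam L dt m : ℂ) ^ 2 * Complex.I_sq
  have h4 : (1 + Complex.I * gam L dt m) * zeta1 L dt m = 1 - Complex.I * gam L dt m := by
    rw [zeta1]; field_simp
  have h5 : (1 + Complex.I * gam L dt m) * zeta2 L dt m = 1 := by
    rw [zeta2, h3]; field_simp
  rw [h]
  linear_combination dft N (cnadbPer N L p dt u₀ j) m * h4 +
    2 * dt * dft N (nonlin N L p (cnadbPer N L p dt u₀ (j + 1))) m * h5

/-- The error of the discrete Fourier coefficients at time `jΔt`. -/
def errCoef (N : ℕ) (L p dt : ℝ) (u : ℝ → ℝ → ℂ) (j : ℕ) (m : ℤ) : ℂ :=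
  dft N (cnadbPer N L p dt (fun l => u 0 (node N l)) j) m - fc (u (j * dt)) m

/-- The perturbation in the error equation. -/
def pert (N : ℕ) (L p c dt : ℝ) (u v : ℝ → ℝ → ℂ) (j : ℕ) (m : ℤ) : ℂ :=
  dft N (nonlin N L p (cnadbPer N L p dt (fun l => u 0 (node N l)) j)) m - fc (cubic c v (j * dt)) m -
    ∑ n ∈ idx N, gridCoef N c v (j * dt) (m - n) * (Complex.I * n * errCoef N L p dt u j n) -
    (fc (u (j * dt + dt)) m - fc (u (j * dt - dt)) m +
        Complex.I * (dt * (c * m ^ 3) : ℝ) * (fc (u (j * dt + dt)) m + fc (u (j * dt - dt)) m) -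
        2 * dt * fc (cubic c v (j * dt)) m) / (2 * dt)

/-- The error equation. -/
lemma error_equation (hN : 0 < N) (he : Even N) {L dt : ℝ} (hc : c = (2 * Real.pi / L) ^ 3)
    (hdt : 0 < dt) (j : ℕ) :
    wvec N (errCoef N L p dt u (j + 2)) - wvec N (errCoef N L p dt u j) +
      diag N (fun m => dt * (c * m ^ 3))
        (wvec N (errCoef N L p dt u (j + 2)) + wvec N (errCoef N L p dt u j)) =
    (2 * dt) • (kop N (kerS (gridCoef N c v ((j + 1 : ℕ) * dt))) (wvec N (errCoef N L p dt u (j + 1))) +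
      kop N (kerH N (gridCoef N c v ((j + 1 : ℕ) * dt))) (wvec N (errCoef N L p dt u (j + 1))) +
      kop N (kerM N (wgt N) (gridCoef N c v ((j + 1 : ℕ) * dt))) (wvec N (errCoef N L p dt u (j + 1))) +
      wvec N (pert N L p c dt u v (j + 1))) := by
  rw [kop_split, kop_kerB_wvec, ← wvec_add]
  ext m
  have hs := dft_cnadbPer_two_step (p := p) hN he L dt (fun l => u 0 (node N l)) j m.2
  rw [gam_eq hc] at hs
  have hdt' : (dt : ℂ) ≠ 0 := by exact_mod_cast hdt.ne'
  have e1 : ((j + 1 : ℕ) : ℝ) * dt + dt = ((j + 2 : ℕ) : ℝ) * dt := by push_cast; ring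
  have e2 : ((j + 1 : ℕ) : ℝ) * dt - dt = (j : ℝ) * dt := by push_cast; ring
  simp only [PiLp.add_apply, PiLp.sub_apply, PiLp.smul_apply, diag_apply, wvec, vec_apply,
    Complex.real_smul, pert, e1, e2]
  generalize (∑ n ∈ idx N, gridCoef N c v ((j + 1 : ℕ) * dt) (m - n) *
    (Complex.I * n * errCoef N L p dt u (j + 1) n)) = X
  simp only [errCoef]
  rw [Complex.ofReal_mul 2 dt, Complex.ofReal_ofNat]
  generalize ((dt * (c * ((m : ℤ) : ℝ) ^ 3) : ℝ) : ℂ) = g at hs ⊢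
  field_simp
  linear_combination (wgt N m : ℂ) * hs

lemma wvec_sub (f g : ℤ → ℂ) : wvec N (fun m => f m - g m) = wvec N f - wvec N g := by
  ext m; simp [wvec, mul_sub]

lemma Flow.norm_pert_le (F : Flow r T p c K u v) (hr : 6 ≤ r) {L : ℝ}
    (hc : c = (2 * Real.pi / L) ^ 3) :
    ∃ C₁, 0 ≤ C₁ ∧ ∀ N : ℕ, 0 < N → Even N → ∀ dt, 0 < dt → ∀ j : ℕ, (j + 2 : ℕ) * dt ≤ T →
      N ^ 2 * ‖wvec N (errCoef N L p dt u (j + 1))‖ ≤ 1 →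
      ‖wvec N (pert N L p c dt u v (j + 1))‖ ≤
        C₁ * ‖wvec N (errCoef N L p dt u (j + 1))‖ + C₁ * (1 / N ^ r + dt ^ 2) := by
  obtain ⟨C₁, hC₁, h⟩ := F.norm_nonlinear_remainder_le hc
  obtain ⟨A, hA, h'⟩ := F.norm_two_step_le hr
  have hW := one_le_wsum
  refine ⟨C₁ + wsum * A, by positivity, fun N hN he dt hdt j hj hsmall => ?_⟩
  have hN' : (0 : ℝ) < N := by exact_mod_cast hN
  push_cast at hj
  have hjd : 0 ≤ (j : ℝ) * dt := by positivity
  have ht : ((j + 1 : ℕ) : ℝ) * dt ∈ Set.Icc 0 T := by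
    push_cast
    constructor <;> nlinarith
  have h1 := h N hN he _ ht _ hsmall
  -- The time defect is A Δt³/(1+|m|); dividing by 2Δt to match the scaling of the error equation
  -- leaves A Δt²/2.
  have h2 := norm_wvec_le_of_inv_wt hN he (B := A * dt ^ 2 / 2) (by positivity)
    (f := fun m => (fc (u ((j + 1 : ℕ) * dt + dt)) m - fc (u ((j + 1 : ℕ) * dt - dt)) m +
        Complex.I * (dt * (c * m ^ 3) : ℝ) *
          (fc (u ((j + 1 : ℕ) * dt + dt)) m + fc (u ((j + 1 : ℕ) * dt - dt)) m) -
        2 * dt * fc (cubic c v ((j + 1 : ℕ) * dt)) m) / (2 * dt)) (fun m _ => by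
      have hw := wt_pos m
      have h3 := h' ((j + 1 : ℕ) * dt) dt hdt.le (by push_cast; nlinarith) (by push_cast; nlinarith) m
      rw [norm_div, norm_mul, Complex.norm_ofNat, Complex.norm_real, Real.norm_of_nonneg hdt.le,
        div_le_iff₀ (by positivity)]
      refine h3.trans (le_of_eq ?_)
      field_simp)
  have e : wvec N (pert N L p c dt u v (j + 1)) = _ := wvec_sub _ _
  rw [e]
  refine (norm_sub_le _ _).trans ((add_le_add h1 h2).trans ?_)
  have hP : 0 ≤ 1 / (N : ℝ) ^ r := by positivity
  have hE : 0 ≤ wsum * A * ‖wvec N (errCoef N L p dt u (j + 1))‖ := by positivity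
  have hE2 : 0 ≤ wsum * A * (1 / (N : ℝ) ^ r) := by positivity
  have hE3 : 0 ≤ C₁ * dt ^ 2 := by positivity
  have e3 : (fun m => dft N (cnadbPer N L p dt (fun l => u 0 (node N l)) (j + 1)) m -
    fc (u ((j + 1 : ℕ) * dt)) m) = errCoef N L p dt u (j + 1) := rfl
  rw [e3]
  nlinarith

lemma Flow.norm_err_zero_le (F : Flow r T p c K u v) (hT : 0 ≤ T) {L dt : ℝ} (hN : 0 < N) (he : Even N)
    {m : ℤ} (hm : m ∈ idx N) :
    ‖errCoef N L p dt u 0 m‖ ≤ K * 4 ^ (r + 4) * wsum / N ^ (r + 4) := by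
  have := (F.wcu 0 ⟨le_rfl, hT⟩).norm_dft_sub_fc_le (by omega) hN he hm
  simpa [errCoef, cnadbPer] using this

/-- The phase γ_m is not small for high frequencies, so Taylor's estimate covers |x| ≤ 1 and the
trivial bound 2 + |x| ≤ 3x² the rest. -/
lemma norm_exp_sub_linear_le (x : ℝ) : ‖Complex.exp (-Complex.I * x) - 1 + Complex.I * x‖ ≤ 3 * x ^ 2 := by
  have h1 : ‖Complex.exp (-Complex.I * x)‖ = 1 := by
    rw [show -Complex.I * (x : ℂ) = ((-x : ℝ) : ℂ) * Complex.I by push_cast; ring,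
      Complex.norm_exp_ofReal_mul_I]
  have hn : ‖-Complex.I * (x : ℂ)‖ = |x| := by simp
  by_cases hx : |x| ≤ 1
  · have := Complex.norm_exp_sub_one_sub_id_le (x := -Complex.I * x) (by rw [hn]; exact hx)
    rw [hn, sq_abs] at this
    have e : Complex.exp (-Complex.I * x) - 1 + Complex.I * x =
      Complex.exp (-Complex.I * x) - 1 - -Complex.I * x := by ring
    rw [e]
    nlinarith [sq_nonneg x]
  · push Not at hx
    have h2 : ‖Complex.I * (x : ℂ)‖ = |x| := by simp
    have h3 := norm_add_le (Complex.exp (-Complex.I * x) - 1) (Complex.I * x)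
    have h4 := norm_sub_le (Complex.exp (-Complex.I * x)) 1
    rw [h1, norm_one] at h4
    rw [h2] at h3
    rw [← sq_abs x]
    nlinarith

lemma norm_exp_sub_one_le (x : ℝ) : ‖Complex.exp (-Complex.I * x) - 1‖ ≤ |x| := by
  have := Real.norm_exp_I_mul_ofReal_sub_one_le (x := -x)
  rw [norm_neg, Real.norm_eq_abs] at this
  convert this using 4
  push_cast; ring

/-- The error after the first step. -/
lemma errCoef_one (hN : 0 < N) (he : Even N) {L dt : ℝ}
    (hc : c = (2 * Real.pi / L) ^ 3) {m : ℤ} (hm : m ∈ idx N) :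
    errCoef N L p dt u 1 m =
      errCoef N L p dt u 0 m * (1 / 2 * (Complex.exp (-Complex.I * (dt * (c * m ^ 3) : ℝ)) +
        (1 - Complex.I * (dt * (c * m ^ 3) : ℝ)))) +
      (dt / 2 * (1 + Complex.exp (-Complex.I * (dt * (c * m ^ 3) : ℝ)))) *
        (dft N (nonlin N L p fun l => u 0 (node N l)) m - fc (cubic c v 0) m) +
      (fc (u 0) m * (1 / 2) * (Complex.exp (-Complex.I * (dt * (c * m ^ 3) : ℝ)) - 1 +
          Complex.I * (dt * (c * m ^ 3) : ℝ)) +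
        fc (cubic c v 0) m * (dt / 2) * (Complex.exp (-Complex.I * (dt * (c * m ^ 3) : ℝ)) - 1) -
        (fc (u dt) m - fc (u 0) m - dt * rate c u v 0 m)) := by
  have h : dft N (cnadbPer N L p dt (fun l => u 0 (node N l)) 1) m =
      dft N (fun l => u 0 (node N l)) m * (1 / 2) *
          (Complex.exp (-Complex.I * gam L dt m) + (1 - Complex.I * gam L dt m)) +
        dft N (nonlin N L p fun l => u 0 (node N l)) m * (dt / 2) *
          (1 + Complex.exp (-Complex.I * gam L dt m)) := by
    rw [cnadbPer, dft_idft hN he _ hm]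
  have e0 : errCoef N L p dt u 0 m = dft N (fun l => u 0 (node N l)) m - fc (u 0) m := by
    simp [errCoef, cnadbPer]
  rw [errCoef, h, gam_eq hc, e0, rate, Nat.cast_one, one_mul]
  push_cast
  ring

end Scheme

end
end Airy

/-! ### The starting values and the first step. -/

namespace Airy
noncomputable section
open scoped RealInnerProductSpace ComplexConjugate

section Scheme
variable {N r : ℕ} {T p c K : ℝ} {u v : ℝ → ℝ → ℂ}

lemma norm_kop_kerB_le (hN : 0 < N) {A : ℝ} {α : ℤ → ℂ} (h : GridDecay N A α) (x : Vec N) :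
    ‖kop N (kerS α) x + kop N (kerH N α) x + kop N (kerM N (wgt N) α) x‖ ≤
      12 * wsum * A * N * ‖x‖ := by
  have hA := h.nonneg
  have hW := one_le_wsum
  have hN' : (1 : ℝ) ≤ N := by exact_mod_cast hN
  have h1 := norm_kop_le_of_decay (κ := kerS α) (A := N * A) (by positivity)
    (fun m hm n hn => norm_kerS_le h hm hn) x
  have h2 := norm_kop_le_of_decay (κ := kerH N α) (A := N * A) (by positivity)
    (fun m hm n hn => norm_kerH_le h hm hn) x
  have h3 := norm_kop_le_of_decay (κ := kerM N (wgt N) α) (A := 2 * A) (by positivity)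
    (fun m hm n hn => norm_kerM_le wgt_pos wgt_lipschitz h hm hn) x
  have h4 : 3 * wsum * (2 * A) * ‖x‖ ≤ 3 * wsum * (2 * A) * ‖x‖ * N :=
    le_mul_of_one_le_right (by positivity) hN'
  refine (norm_add₃_le).trans ((add_le_add_three h1 h2 h3).trans ?_)
  linarith

lemma Flow.norm_wvec_errCoef_zero_le (F : Flow r T p c K u v) (hT : 0 ≤ T) :
    ∃ C, 0 ≤ C ∧ ∀ N : ℕ, 0 < N → Even N → ∀ L dt : ℝ,
      ‖wvec N (errCoef N L p dt u 0)‖ ≤ C / N ^ (r + 3) := by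
  have hK : 0 ≤ K := by linarith [F.one_le]
  have hW := one_le_wsum
  refine ⟨2 * (K * 4 ^ (r + 4) * wsum), by positivity, fun N hN he L dt => ?_⟩
  have hN' : (0 : ℝ) < N := by exact_mod_cast hN
  refine (norm_wvec_le_of_const hN he (by positivity)
    fun m hm => F.norm_err_zero_le hT hN he hm).trans (le_of_eq ?_)
  rw [pow_succ (N : ℝ) (r + 3)]
  field_simp

lemma norm_exp_neg_I_mul (x : ℝ) : ‖Complex.exp (-Complex.I * x)‖ = 1 := by
  rw [show -Complex.I * (x : ℂ) = ((-x : ℝ) : ℂ) * Complex.I by push_cast; ring,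
    Complex.norm_exp_ofReal_mul_I]

/-- The explicit Euler factor may amplify by a multiple of N², but acts once and on an initial error
of order N^{-(r+4)} per mode. The derivative loss N of the linearised term is paid by the factor Δt.
What remains is the local error, O(Δt²). -/
lemma Flow.norm_wvec_errCoef_one_le (F : Flow r T p c K u v) (hr : 6 ≤ r) (hT : 0 ≤ T) {L : ℝ}
    (hc : c = (2 * Real.pi / L) ^ 3) :
    ∃ C, 0 ≤ C ∧ ∀ N : ℕ, 0 < N → Even N → ∀ dt : ℝ, 0 < dt → dt ≤ T → dt * N ≤ 7 →
      N ^ 2 * ‖wvec N (errCoef N L p dt u 0)‖ ≤ 1 →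
      ‖wvec N (errCoef N L p dt u 1)‖ ≤ C * (1 / N ^ r + dt ^ 2) := by
  have hK : 0 ≤ K := by linarith [F.one_le]
  have hW := one_le_wsum
  obtain ⟨C₁, hC₁, hrem⟩ := F.norm_nonlinear_remainder_le hc
  obtain ⟨A, hA, hgrid⟩ := F.gridDecay hr
  obtain ⟨B, hB⟩ := F.wc_cubic
  obtain ⟨D, hD, hfwd⟩ := F.norm_forward_le hr
  obtain ⟨E, hE, herr⟩ := F.norm_wvec_errCoef_zero_le hT
  have h0T : (0 : ℝ) ∈ Set.Icc 0 T := ⟨le_rfl, hT⟩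
  set E₁ : ℝ := K * 4 ^ (r + 4) * wsum with hE₁
  refine ⟨2 * E₁ * (1 + 7 * |c|) + ((84 * wsum * A + T * C₁) * E + T * C₁) +
    2 * wsum * (3 / 2 * c ^ 2 * K + |c| * |B| / 2 + D), by positivity,
    fun N hN he dt hdt hdtT hCFL hsmall => ?_⟩
  have hN' : (1 : ℝ) ≤ N := by exact_mod_cast hN
  have hN0 : (0 : ℝ) < N := by linarith
  set γ : ℤ → ℝ := fun m => dt * (c * m ^ 3) with hγ
  have hγabs : ∀ m, |γ m| = dt * |c| * |(m : ℝ)| ^ 3 := fun m => by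
    rw [hγ]; simp only [abs_mul, abs_pow, abs_of_pos hdt]; ring
  set g : ℤ → ℂ := fun m => dft N (nonlin N L p fun l => u 0 (node N l)) m - fc (cubic c v 0) m with hg
  set f₁ : ℤ → ℂ := fun m => errCoef N L p dt u 0 m *
    (1 / 2 * (Complex.exp (-Complex.I * γ m) + (1 - Complex.I * γ m))) with hf₁
  set f₂ : ℤ → ℂ := fun m => (dt / 2 * (1 + Complex.exp (-Complex.I * γ m))) * g m with hf₂
  set f₃ : ℤ → ℂ := fun m => fc (u 0) m * (1 / 2) * (Complex.exp (-Complex.I * γ m) - 1 +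
      Complex.I * γ m) + fc (cubic c v 0) m * (dt / 2) * (Complex.exp (-Complex.I * γ m) - 1) -
      (fc (u dt) m - fc (u 0) m - dt * rate c u v 0 m) with hf₃
  have hsplit : wvec N (errCoef N L p dt u 1) = wvec N f₁ + wvec N f₂ + wvec N f₃ := by
    rw [← wvec_add, ← wvec_add]
    exact wvec_congr fun m hm => errCoef_one hN he hc hm
  have b₁ : ‖wvec N f₁‖ ≤ 2 * E₁ * (1 + 7 * |c|) * (1 / N ^ r) := by
    have h : ∀ m ∈ idx N, ‖f₁ m‖ ≤ E₁ / N ^ (r + 4) * ((1 + 7 * |c|) * N ^ 2) := by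
      intro m hm
      have h1 := F.norm_err_zero_le (L := L) (dt := dt) hT hN he hm
      have h2 : ‖(1 / 2 * (Complex.exp (-Complex.I * γ m) + (1 - Complex.I * γ m)) : ℂ)‖ ≤
          1 + |γ m| := by
        have h3 := norm_add_le (Complex.exp (-Complex.I * γ m)) (1 - Complex.I * γ m)
        have h4 := norm_sub_le (1 : ℂ) (Complex.I * γ m)
        have h5 : ‖Complex.I * (γ m : ℂ)‖ = |γ m| := by simp
        rw [norm_exp_neg_I_mul] at h3
        rw [h5, norm_one] at h4
        rw [norm_mul, norm_div, norm_one, Complex.norm_ofNat]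
        linarith [abs_nonneg (γ m)]
      -- |γ_m| is at most Δt|c|N³, and ΔtN ≤ 7 leaves N².
      have h6 : |γ m| ≤ 7 * |c| * N ^ 2 := by
        rw [hγabs]
        have hm' : |(m : ℝ)| ≤ N := by linarith [abs_le_of_mem_idx hm]
        calc dt * |c| * |(m : ℝ)| ^ 3 ≤ dt * |c| * N ^ 3 := by gcongr
          _ = (dt * N) * |c| * N ^ 2 := by ring
          _ ≤ 7 * |c| * N ^ 2 := by gcongr
      rw [hf₁]
      simp only [norm_mul _ (1 / 2 * _ : ℂ)]
      refine mul_le_mul h1 (h2.trans ?_) (norm_nonneg _) (by positivity)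
      nlinarith [one_le_pow₀ hN' (n := 2)]
    refine (norm_wvec_le_of_const hN he (by positivity) h).trans ?_
    have e : 2 * (N : ℝ) * (E₁ / N ^ (r + 4) * ((1 + 7 * |c|) * N ^ 2)) =
        2 * E₁ * (1 + 7 * |c|) * (1 / N ^ (r + 1)) := by
      rw [show r + 4 = (r + 1) + 3 by ring, pow_add (N : ℝ) (r + 1) 3]
      field_simp
    rw [e]
    gcongr
    omega
  have b₂ : ‖wvec N f₂‖ ≤ ((84 * wsum * A + T * C₁) * E + T * C₁) * (1 / N ^ r) := by
    have h1 : ‖wvec N f₂‖ ≤ ‖wvec N fun m => (dt : ℂ) * g m‖ := by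
      refine norm_wvec_mono fun m _ => ?_
      rw [hf₂]
      simp only [norm_mul _ (g m)]
      gcongr
      have h2 := norm_add_le (1 : ℂ) (Complex.exp (-Complex.I * γ m))
      rw [norm_exp_neg_I_mul, norm_one] at h2
      rw [norm_mul, norm_div, Complex.norm_ofNat, Complex.norm_real, Real.norm_of_nonneg hdt.le]
      nlinarith
    have h2 : wvec N (fun m => (dt : ℂ) * g m) = dt • wvec N g := by
      ext m; simp [wvec]; ring
    have e0 : (fun m => dft N (fun l => u 0 (node N l)) m - fc (u 0) m) = errCoef N L p dt u 0 := by
      funext m; simp [errCoef, cnadbPer]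
    have h3 := hrem N hN he 0 h0T (fun l => u 0 (node N l)) (by rw [e0]; exact hsmall)
    rw [e0] at h3
    have e1 := wvec_sub (N := N) g
      (fun m => ∑ n ∈ idx N, gridCoef N c v 0 (m - n) * (Complex.I * n * errCoef N L p dt u 0 n))
    have e2 : ∀ n, dft N (fun l => u 0 (node N l)) n - fc (u 0) n = errCoef N L p dt u 0 n :=
      fun n => congrFun e0 n
    simp only [e2] at h3
    have h4 : ‖wvec N g‖ ≤ C₁ * (‖wvec N (errCoef N L p dt u 0)‖ + 1 / N ^ r) +
        12 * wsum * A * N * ‖wvec N (errCoef N L p dt u 0)‖ := by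
      rw [← kop_kerB_wvec, ← kop_split] at e1
      have h5 := norm_kop_kerB_le hN (hgrid N hN he 0 h0T) (wvec N (errCoef N L p dt u 0))
      rw [sub_eq_iff_eq_add.1 e1.symm]
      exact (norm_add_le _ _).trans (add_le_add h3 h5)
    have h6 : ‖wvec N (errCoef N L p dt u 0)‖ ≤ E * (1 / N ^ r) := by
      refine (herr N hN he L dt).trans ?_
      rw [div_eq_mul_one_div]
      gcongr
      omega
    rw [h2, norm_smul, Real.norm_of_nonneg hdt.le] at h1
    have hP : 0 ≤ 1 / (N : ℝ) ^ r := by positivity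
    set P : ℝ := 1 / (N : ℝ) ^ r
    set x := ‖wvec N (errCoef N L p dt u 0)‖ with hx
    calc _ ≤ dt * ‖wvec N g‖ := h1
      _ ≤ dt * (C₁ * (x + P) + 12 * wsum * A * N * x) := by gcongr
      _ = dt * (C₁ * (x + P)) + (dt * N) * (12 * wsum * A * x) := by ring
      _ ≤ T * (C₁ * (E * P + P)) + 7 * (12 * wsum * A * (E * P)) := by gcongr
      _ = _ := by ring
  have b₃ : ‖wvec N f₃‖ ≤ 2 * wsum * ((3 / 2 * c ^ 2 * K + |c| * |B| / 2 + D) * dt ^ 2) := by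
    refine norm_wvec_le_of_inv_wt hN he (by positivity) fun m _ => ?_
    have hw := wt_pos m
    -- Quadratic smallness in γ costs m⁶, affordable since the coefficients of `u` decay with
    -- exponent 10.
    have k1 : ‖fc (u 0) m * (1 / 2) * (Complex.exp (-Complex.I * γ m) - 1 + Complex.I * γ m)‖ ≤
        3 / 2 * c ^ 2 * K * dt ^ 2 / wt m := by
      have h1 := ((F.wcu 0 h0T).mono (t := 7 + 3) (by omega) le_rfl).decay m
      rw [norm_mul, norm_mul, norm_div, norm_one, Complex.norm_ofNat]
      have h2 := norm_exp_sub_linear_le (γ m)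
      rw [← sq_abs, hγabs] at h2
      calc _ ≤ K / wt m ^ (7 + 3) * (1 / 2) * (3 * (dt * |c| * |(m : ℝ)| ^ 3) ^ 2) := by gcongr
        _ = 3 / 2 * dt ^ 2 * |c| ^ 2 * (|(m : ℝ)| ^ 3 * (|(m : ℝ)| ^ 3 * (K / wt m ^ (7 + 3)))) := by
          ring
        _ ≤ 3 / 2 * dt ^ 2 * |c| ^ 2 * (|(m : ℝ)| ^ 3 * (K / wt m ^ (4 + 3))) := by
          have := mul_abs_cube_div_le (s := 7) hK m
          gcongr
        _ ≤ 3 / 2 * dt ^ 2 * |c| ^ 2 * (K / wt m ^ 4) := by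
          have := mul_abs_cube_div_le (s := 4) hK m
          gcongr
        _ ≤ 3 / 2 * dt ^ 2 * |c| ^ 2 * (K / wt m ^ 1) := by
          have := div_wt_pow_le hK (by norm_num : 1 ≤ 4) m
          gcongr
        _ = _ := by rw [sq_abs, pow_one]; ring
    have k2 : ‖fc (cubic c v 0) m * (dt / 2) * (Complex.exp (-Complex.I * γ m) - 1)‖ ≤
        |c| * |B| / 2 * dt ^ 2 / wt m := by
      have h1 := ((hB 0 h0T).mono (t := 1 + 3) (by omega) (le_abs_self B)).decay m
      rw [norm_mul, norm_mul, norm_div, Complex.norm_ofNat, Complex.norm_real,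
        Real.norm_of_nonneg hdt.le]
      have h2 := norm_exp_sub_one_le (γ m)
      rw [hγabs] at h2
      calc _ ≤ |B| / wt m ^ (1 + 3) * (dt / 2) * (dt * |c| * |(m : ℝ)| ^ 3) := by gcongr
        _ = dt ^ 2 / 2 * |c| * (|(m : ℝ)| ^ 3 * (|B| / wt m ^ (1 + 3))) := by ring
        _ ≤ dt ^ 2 / 2 * |c| * (|B| / wt m ^ 1) := by
          have := mul_abs_cube_div_le (s := 1) (abs_nonneg B) m
          gcongr
        _ = _ := by rw [pow_one]; ring
    have k3 : ‖fc (u dt) m - fc (u 0) m - dt * rate c u v 0 m‖ ≤ D * dt ^ 2 / wt m := by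
      refine (hfwd dt hdt.le hdtT m).trans ?_
      have := div_wt_pow_le (K := D * dt ^ 2) (by positivity) (by norm_num : 1 ≤ 4) m
      rwa [pow_one] at this
    refine (norm_sub_le _ _).trans ((add_le_add ((norm_add_le _ _).trans (add_le_add k1 k2)) k3).trans
      (le_of_eq ?_))
    ring
  rw [hsplit]
  refine (norm_add₃_le).trans ((add_le_add_three b₁ b₂ b₃).trans ?_)
  have hP : 0 ≤ 1 / (N : ℝ) ^ r := by positivity
  set P : ℝ := 1 / (N : ℝ) ^ r
  set a₁ := 2 * E₁ * (1 + 7 * |c|) with ha₁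
  set a₂ := (84 * wsum * A + T * C₁) * E + T * C₁ with ha₂
  set a₃ := 3 / 2 * c ^ 2 * K + |c| * |B| / 2 + D with ha₃
  have h₁ : 0 ≤ a₁ := by positivity
  have h₂ : 0 ≤ a₂ := by positivity
  have h₃ : 0 ≤ a₃ := by positivity
  have : 0 ≤ (a₁ + a₂) * dt ^ 2 + 2 * wsum * a₃ * P := by positivity
  linarith

end Scheme

end
end Airy

/-! ### Choice of constants and the convergence estimate. -/

namespace Airy
noncomputable section
open scoped RealInnerProductSpace ComplexConjugate

section Scheme
variable {N r : ℕ} {T p c K : ℝ} {u v : ℝ → ℝ → ℂ}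

lemma kerS_sub (α β : ℤ → ℂ) (m n : ℤ) :
    kerS α m n - kerS β m n = kerS (fun l => α l - β l) m n := by
  simp only [kerS]; ring

lemma kerQ_sub (α β : ℤ → ℂ) (m n : ℤ) :
    kerQ N c α m n - kerQ N c β m n = kerQ N c (fun l => α l - β l) m n := by
  simp only [kerQ]; split_ifs <;> ring

lemma one_div_le_mesh (hN : 0 < N) : 1 / (N : ℝ) ≤ mesh N := by
  have : (0 : ℝ) < N := by exact_mod_cast hN
  unfold mesh
  gcongr
  linarith [Real.pi_gt_three]

lemma one_div_pow_le_mesh_pow (hN : 0 < N) (s : ℕ) : 1 / (N : ℝ) ^ s ≤ mesh N ^ s := by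
  rw [← one_div_pow]
  exact pow_le_pow_left₀ (by positivity) (one_div_le_mesh hN) s

lemma mul_mesh_le (hN : 0 < N) : N * mesh N ≤ 7 := by
  have : (0 : ℝ) < N := by exact_mod_cast hN
  unfold mesh
  rw [mul_div_cancel₀ _ this.ne']
  linarith [Real.pi_lt_d2]

/-- The abstract stability result with ‖S‖ ≤ s = O(N), ‖Q‖ ≤ q = O(N^{-2}), ‖S + H + M‖ ≤ b₀ = O(N)
and threshold ρ = 1/N². Changes of S in time are O(N Δt), bounded by the step restriction. -/
lemma Flow.norm_wvec_errCoef_le_of_bounds (F : Flow r T p c K u v) (hc0 : 0 < c) {L : ℝ}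
    (hc : c = (2 * Real.pi / L) ^ 3) (hN : 0 < N) (he : Even N) {dt A A₁ k σ : ℝ} {j : ℕ} (hdt : 0 < dt)
    (hA : 0 ≤ A) (hA₁ : 0 ≤ A₁) (hdtN7 : dt * N ≤ 7)
    (hα : ∀ i ≤ j, GridDecay N A (gridCoef N c v (i * dt)))
    (hα' : ∀ i, i + 1 ≤ j → GridDecay N (A₁ * dt)
      (fun l => gridCoef N c v ((i + 1 : ℕ) * dt) l - gridCoef N c v (i * dt) l))
    (hk1 : 1 ≤ k) (hk2 : 21 * wsum * A₁ ≤ k) (hk3 : 96 * wsum * A₁ / c ≤ k) (hk4 : 36 * wsum * A ≤ k)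
    (hk5 : 1152 * wsum ^ 2 * A ^ 2 / c ≤ k) (hkdt : 40 * k * dt ≤ 1 / 2)
    (hs : dt * (3 * wsum * (N * A)) ≤ 1 / 4) (hq : 3 * wsum * (32 / (c * N ^ 2) * A) ≤ 1 / 2)
    (hF : ∀ i, i + 2 ≤ j → ‖wvec N (errCoef N L p dt u (i + 1))‖ ≤ 1 / N ^ 2 →
      ‖wvec N (pert N L p c dt u v (i + 1))‖ ≤ k * ‖wvec N (errCoef N L p dt u (i + 1))‖ + σ)
    (hσ : 0 ≤ σ) (hj : j * dt ≤ T) (hρ : ampl k T * σ ≤ 1 / N ^ 2)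
    (h0 : ‖wvec N (errCoef N L p dt u 0)‖ ≤ σ) (h1 : ‖wvec N (errCoef N L p dt u 1)‖ ≤ σ) (hj0 : 0 < j) :
    ‖wvec N (errCoef N L p dt u j)‖ ≤ ampl k T * σ := by
  have hW := one_le_wsum
  have hN' : (1 : ℝ) ≤ N := by exact_mod_cast hN
  have hN0 : (0 : ℝ) < N := by linarith
  have hWA : 0 ≤ wsum * A := by positivity
  have hWA₁c : 0 ≤ 96 * wsum * A₁ / c := by positivity
  have hWA2 : 0 ≤ 1152 * wsum ^ 2 * A ^ 2 / c := by positivity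
  have hconj : ∀ t l, (starRingEnd ℂ) (gridCoef N c v t l) = gridCoef N c v t (-l) :=
    conj_gridCoef F
  have key := two_step_stability (n := j) (δ := dt) (k := k) (s := 3 * wsum * (N * A))
    (q := 3 * wsum * (32 / (c * N ^ 2) * A)) (b₀ := 12 * wsum * A * N) (σ := σ) (ρ := 1 / N ^ 2) (T := T)
    (D := diag N fun m => dt * (c * m ^ 3))
    (S := fun i => kop N (kerS (gridCoef N c v (i * dt))))
    (H := fun i => kop N (kerH N (gridCoef N c v (i * dt))))
    (M := fun i => kop N (kerM N (wgt N) (gridCoef N c v (i * dt))))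
    (Q := fun i => kop N (kerQ N c (gridCoef N c v (i * dt))))
    (e := fun i => wvec N (errCoef N L p dt u i))
    (F := fun i => wvec N (pert N L p c dt u v i))
    (inner_diag _)
    (fun i _ x y => by simpa using inner_kop (kerS_skew (hconj (i * dt))) x y)
    (fun i _ x y => by simpa using inner_kop (kerQ_symm (hconj (i * dt))) x y)
    (fun i _ => error_equation hN he hc hdt i) hdt.le hk1
    hkdt hs hq
    (by
      calc 3 * wsum * (32 / (c * N ^ 2) * A) * (12 * wsum * A * N) =
          1152 * wsum ^ 2 * A ^ 2 / c / N := by field_simp; ring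
        _ ≤ 1152 * wsum ^ 2 * A ^ 2 / c := div_le_self hWA2 hN'
        _ ≤ k := hk5)
    (fun i hi => norm_kop_le_of_decay (by positivity) fun m hm n hn => norm_kerS_le (hα i hi) hm hn)
    (fun i hi => norm_kop_le_of_decay (by positivity) fun m hm n hn => norm_kerQ_le hc0 hN (hα i hi) hm hn)
    (fun i hi => norm_kop_kerB_le hN (hα i hi))
    (fun i hi x => by
      refine (norm_kop_le_of_decay (A := 2 * A) (by positivity)
        (fun m hm n hn => norm_kerM_le wgt_pos wgt_lipschitz (hα i hi) hm hn) x).trans ?_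
      gcongr
      linarith)
    (fun i hi x => by
      rw [kop_sub_apply]
      simp only [kerS_sub]
      refine (norm_kop_le_of_decay (A := N * (A₁ * dt)) (by positivity)
        (fun m hm n hn => norm_kerS_le (hα' i hi) hm hn) x).trans ?_
      gcongr
      calc 3 * wsum * (N * (A₁ * dt)) = 3 * (wsum * A₁) * (dt * N) := by ring
        _ ≤ 3 * (wsum * A₁) * 7 := by gcongr
        _ ≤ k := by linarith)
    (fun i hi x => by
      rw [kop_sub_apply]
      simp only [kerQ_sub]
      refine (norm_kop_le_of_decay (A := 32 / (c * N ^ 2) * (A₁ * dt)) (by positivity)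
        (fun m hm n hn => norm_kerQ_le hc0 hN (hα' i hi) hm hn) x).trans ?_
      refine mul_le_mul_of_nonneg_right ?_ (norm_nonneg _)
      calc 3 * wsum * (32 / (c * N ^ 2) * (A₁ * dt)) = dt * (96 * wsum * A₁ / c / N ^ 2) := by
            field_simp; ring
        _ ≤ dt * (96 * wsum * A₁ / c) := by
            exact mul_le_mul_of_nonneg_left (div_le_self hWA₁c (one_le_pow₀ hN')) hdt.le
        _ ≤ dt * k := by gcongr)
    (fun i hi x => by
      rw [kop_diag]
      refine (norm_kop_le_of_decay (A := 12 * dt * A) (by positivity)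
        (fun m hm n hn => norm_kerHQ_le hc0 hdt.le hN (hα i hi) hm hn) x).trans ?_
      refine mul_le_mul_of_nonneg_right ?_ (norm_nonneg _)
      calc 3 * wsum * (12 * dt * A) = dt * (36 * wsum * A) := by ring
        _ ≤ dt * k := by gcongr)
    hF
    hσ hj hρ h0 h1 (j - 1) (by omega)
  rw [Nat.sub_add_cancel hj0] at key
  exact key.2

lemma Flow.norm_wvec_errCoef_le (F : Flow r T p c K u v) (hr : 6 ≤ r) (hT : 0 ≤ T) (hc0 : 0 < c) {L : ℝ}
    (hc : c = (2 * Real.pi / L) ^ 3) :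
    ∃ h₀ > 0, ∃ C₀ > 0, ∃ C, 0 ≤ C ∧ ∀ N : ℕ, 0 < N → Even N → ∀ dt : ℝ, 0 < dt →
      mesh N ≤ h₀ → dt / mesh N ≤ C₀ → ∀ j : ℕ, j * dt ≤ T →
        ‖wvec N (errCoef N L p dt u j)‖ ≤ C * (mesh N ^ r + dt ^ 2) := by
  have hW := one_le_wsum
  obtain ⟨A, hA, hgrid⟩ := F.gridDecay hr
  obtain ⟨A₁, hA₁, hgrid'⟩ := F.gridDecay_sub hr
  obtain ⟨C₁, hC₁, hpert⟩ := F.norm_pert_le hr hc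
  obtain ⟨E, hE, herr0⟩ := F.norm_wvec_errCoef_zero_le hT
  obtain ⟨E₁, hE₁, herr1⟩ := F.norm_wvec_errCoef_one_le hr hT hc
  obtain ⟨k, hk⟩ : ∃ k : ℝ, k = 1 + 6 * wsum * A + 21 * wsum * A₁ + 96 * wsum * A₁ / c +
    36 * wsum * A + C₁ + 1152 * wsum ^ 2 * A ^ 2 / c := ⟨_, rfl⟩
  have hWA : 0 ≤ wsum * A := by positivity
  have hWA₁ : 0 ≤ wsum * A₁ := by positivity
  have hWA₁c : 0 ≤ 96 * wsum * A₁ / c := by positivity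
  have hWA2 : 0 ≤ 1152 * wsum ^ 2 * A ^ 2 / c := by positivity
  have hk1 : 1 ≤ k := by linarith
  have hk2 : 21 * wsum * A₁ ≤ k := by linarith
  have hk3 : 96 * wsum * A₁ / c ≤ k := by linarith
  have hk4 : 36 * wsum * A ≤ k := by linarith
  have hk5 : 1152 * wsum ^ 2 * A ^ 2 / c ≤ k := by linarith
  have hk6 : C₁ ≤ k := by linarith
  obtain ⟨S₀, hS₀⟩ : ∃ S₀ : ℝ, S₀ = C₁ + E + E₁ := ⟨_, rfl⟩
  have hS₀0 : 0 ≤ S₀ := by linarith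
  have hS₁ : C₁ ≤ S₀ := by linarith
  have hS₂ : E ≤ S₀ := by linarith
  have hS₃ : E₁ ≤ S₀ := by linarith
  obtain ⟨G, hG⟩ : ∃ G : ℝ, G = ampl k T * S₀ := ⟨_, rfl⟩
  have hG0 : 0 ≤ G := by
    rw [hG]
    have : 0 ≤ ampl k T := Real.sqrt_nonneg _
    positivity
  have hq0 : 0 ≤ 192 * wsum * A / c := by positivity
  have hX : 0 < 192 * wsum * A / c + 80 * k + 80 * G + E + 1 := by linarith
  have hY : 0 < 84 * (wsum * A) + 98 * G + 1 := by linarith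
  -- In `h₀`: 192 gives q ≤ 1/2, 80k gives 40kΔt ≤ 1/2, 80G serves the threshold, and E makes N²
  -- times the initial error at most 1. In `C₀`: 84 gives the leapfrog condition Δt s ≤ 1/4 and 98G
  -- serves the threshold.
  refine ⟨1 / (192 * wsum * A / c + 80 * k + 80 * G + E + 1), by positivity,
    1 / (84 * (wsum * A) + 98 * G + 1), by positivity, G + S₀, by positivity,
    fun N hN he dt hdt hmesh hCFL j hj => ?_⟩
  have hN' : (1 : ℝ) ≤ N := by exact_mod_cast hN
  have hN0 : (0 : ℝ) < N := by linarith
  have hμ := one_div_le_mesh hN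
  have hμ0 : 0 < mesh N := lt_of_lt_of_le (by positivity) hμ
  have hNμ := mul_mesh_le hN
  rw [div_le_iff₀ hμ0] at hCFL
  rw [le_div_iff₀ hX] at hmesh
  set μ := mesh N with hμdef
  have hX1 : ∀ a, a ≤ 192 * wsum * A / c + 80 * k + 80 * G + E + 1 → a * μ ≤ 1 := fun a ha => by
    refine (mul_le_mul_of_nonneg_right ha hμ0.le).trans ?_
    rwa [mul_comm]
  have hμ1 : μ ≤ 1 := by simpa using hX1 1 (by linarith only [hq0, hk1, hG0, hE])
  have hX2 : 80 * G * μ ≤ 1 := hX1 _ (by linarith only [hq0, hk1, hG0, hE])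
  have hX3 : 80 * k * μ ≤ 1 := hX1 _ (by linarith only [hq0, hk1, hG0, hE])
  have hX4 : E * μ ≤ 1 := hX1 _ (by linarith only [hq0, hk1, hG0, hE])
  have hX5 : 192 * wsum * A / c * μ ≤ 1 := hX1 _ (by linarith only [hq0, hk1, hG0, hE])
  set y : ℝ := 1 / (84 * (wsum * A) + 98 * G + 1) with hy
  have hy0 : 0 < y := by positivity
  have hyY : y * (84 * (wsum * A) + 98 * G + 1) = 1 := by rw [hy]; field_simp
  have hY1 : ∀ a, a ≤ 84 * (wsum * A) + 98 * G + 1 → a * y ≤ 1 := fun a ha => by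
    refine (mul_le_mul_of_nonneg_right ha hy0.le).trans ?_
    rw [mul_comm, hyY]
  have hy1 : y ≤ 1 := by simpa using hY1 1 (by linarith only [hWA, hG0])
  have hyG : 98 * G * y ≤ 1 := hY1 _ (by linarith only [hWA, hG0])
  have hyA : 84 * (wsum * A) * y ≤ 1 := hY1 _ (by linarith only [hWA, hG0])
  have hdtN : dt * N ≤ 7 * y := by
    calc dt * N ≤ y * μ * N := by gcongr
      _ = y * (N * μ) := by ring
      _ ≤ y * 7 := by gcongr
      _ = 7 * y := mul_comm _ _
  have hdtN7 : dt * N ≤ 7 := by linarith only [hdtN, hy1]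
  have hdtμ : dt ≤ μ := hCFL.trans (mul_le_of_le_one_left hμ0.le hy1)
  have hP : 1 / (N : ℝ) ^ r ≤ μ ^ r := one_div_pow_le_mesh_pow hN r
  have hP0 : 0 ≤ 1 / (N : ℝ) ^ r := by positivity
  obtain ⟨σ, hσ⟩ : ∃ σ : ℝ, σ = S₀ * (μ ^ r + dt ^ 2) := ⟨_, rfl⟩
  have hτ0 : 0 ≤ μ ^ r + dt ^ 2 := by positivity
  have hσ0 : 0 ≤ σ := by rw [hσ]; positivity
  have he0 : ‖wvec N (errCoef N L p dt u 0)‖ ≤ E * (1 / N ^ r) := by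
    refine (herr0 N hN he L dt).trans ?_
    rw [div_eq_mul_one_div]
    gcongr
    omega
  have hle : ∀ a, 0 ≤ a → a ≤ S₀ → a * (1 / N ^ r + dt ^ 2) ≤ σ := by
    intro a ha haS
    rw [hσ]; gcongr
  have he0σ : ‖wvec N (errCoef N L p dt u 0)‖ ≤ σ := by
    refine he0.trans (le_trans ?_ (hle E hE hS₂))
    gcongr
    exact le_add_of_nonneg_right (sq_nonneg dt)
  have hfin : ∀ x, x ≤ ampl k T * σ → x ≤ (G + S₀) * (μ ^ r + dt ^ 2) := by
    intro x hx
    refine hx.trans ?_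
    rw [hσ, ← mul_assoc, ← hG]
    gcongr
    exact le_add_of_nonneg_right hS₀0
  -- For j = 0 nothing ensures Δt ≤ T, so the first step is out of reach; the initial estimate
  -- suffices.
  rcases Nat.eq_zero_or_pos j with rfl | hj0
  · refine he0σ.trans ?_
    rw [hσ]
    gcongr
    exact le_add_of_nonneg_left hG0
  have hj1 : (1 : ℝ) ≤ j := by exact_mod_cast hj0
  have hdtT : dt ≤ T := (le_mul_of_one_le_left hdt.le hj1).trans hj
  have htime : ∀ i ≤ j, (i : ℝ) * dt ∈ Set.Icc 0 T := by
    intro i hi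
    have : (i : ℝ) ≤ j := by exact_mod_cast hi
    exact ⟨by positivity, le_trans (by gcongr) hj⟩
  have hE0small : N ^ 2 * ‖wvec N (errCoef N L p dt u 0)‖ ≤ 1 := by
    calc N ^ 2 * ‖wvec N (errCoef N L p dt u 0)‖ ≤ N ^ 2 * (E / N ^ (r + 3)) := by
          gcongr; exact herr0 N hN he L dt
      _ ≤ N ^ 2 * (E / N ^ 3) := by gcongr; omega
      _ = E * (1 / N) := by field_simp
      _ ≤ E * μ := by gcongr
      _ ≤ 1 := hX4
  have he1σ : ‖wvec N (errCoef N L p dt u 1)‖ ≤ σ :=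
    (herr1 N hN he dt hdt hdtT hdtN7 hE0small).trans (hle E₁ hE₁ hS₃)
  -- The critical balance. As r ≥ 3, N²h^r = O(h) is small with h. But N²Δt² has no spare power and
  -- is small only through the ratio Δt/h, whence 49y. The number 40 exceeds (2π)².
  have hρ : ampl k T * σ ≤ 1 / N ^ 2 := by
    rw [hσ, ← mul_assoc, ← hG, le_div_iff₀ (by positivity)]
    have h1 : μ ^ r ≤ μ ^ 3 := pow_le_pow_of_le_one hμ0.le hμ1 (by omega)
    have h2 : μ ^ 3 * N ^ 2 ≤ 40 * μ := by
      have h3 : N * μ ≤ 6.284 := by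
        rw [hμdef, mesh, mul_div_cancel₀ _ hN0.ne']
        linarith only [Real.pi_lt_d4]
      have h4 : 0 ≤ N * μ := by positivity
      have h5 : (N * μ) ^ 2 ≤ 40 := (pow_le_pow_left₀ h4 h3 2).trans (by norm_num)
      calc μ ^ 3 * N ^ 2 = (N * μ) ^ 2 * μ := by ring
        _ ≤ 40 * μ := by gcongr
    have h6 : dt ^ 2 * N ^ 2 ≤ 49 * y := by
      have h7 : 0 ≤ dt * N := by positivity
      calc dt ^ 2 * N ^ 2 = (dt * N) * (dt * N) := by ring
        _ ≤ (7 * y) * 7 := by gcongr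
        _ = 49 * y := by ring
    calc G * (μ ^ r + dt ^ 2) * N ^ 2 ≤ G * (μ ^ 3 + dt ^ 2) * N ^ 2 := by gcongr
      _ = G * (μ ^ 3 * N ^ 2 + dt ^ 2 * N ^ 2) := by ring
      _ ≤ G * (40 * μ + 49 * y) := by gcongr
      _ ≤ 1 := by
        linarith only [hX2, hyG]
  have hα : ∀ i ≤ j, GridDecay N A (gridCoef N c v (i * dt)) := fun i hi => hgrid N hN he _ (htime i hi)
  have hα' : ∀ i, i + 1 ≤ j → GridDecay N (A₁ * dt)
      (fun l => gridCoef N c v ((i + 1 : ℕ) * dt) l - gridCoef N c v (i * dt) l) := by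
    intro i hi
    have := hgrid' N hN he _ (htime (i + 1) hi) _ (htime i (by omega))
    rwa [show ((i + 1 : ℕ) : ℝ) * dt - i * dt = dt by push_cast; ring, abs_of_pos hdt] at this
  refine hfin _ (F.norm_wvec_errCoef_le_of_bounds hc0 hc hN he hdt hA hA₁ hdtN7 hα hα' hk1 hk2
    hk3 hk4 hk5 ?_ ?_ ?_ ?_ hσ0 hj hρ he0σ he1σ hj0)
  · have h2 : 80 * k * dt ≤ 80 * k * μ := by gcongr
    linarith only [h2, hX3]
  · calc dt * (3 * wsum * (N * A)) = 3 * (wsum * A) * (dt * N) := by ring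
      _ ≤ 3 * (wsum * A) * (7 * y) := by gcongr
      _ ≤ 1 / 4 := by linarith only [hyA]
  · have h1 : 1 / (N : ℝ) ^ 2 ≤ μ := by
      refine le_trans ?_ hμ
      gcongr
      exact le_self_pow₀ hN' (by norm_num)
    calc 3 * wsum * (32 / (c * N ^ 2) * A) = 192 * wsum * A / c * (1 / N ^ 2) / 2 := by field_simp; ring
      _ ≤ 192 * wsum * A / c * μ / 2 := by gcongr
      _ ≤ 1 / 2 := by linarith only [hX5]
  · intro i hi hsm
    have h1 : N ^ 2 * ‖wvec N (errCoef N L p dt u (i + 1))‖ ≤ 1 := by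
      rwa [le_div_iff₀ (by positivity), mul_comm] at hsm
    refine (hpert N hN he dt hdt i (htime (i + 2) hi).2 h1).trans
      (add_le_add ?_ (hle C₁ hC₁ hS₁))
    gcongr

lemma norm_sub_sq_le (a b : ℂ) : ‖a - b‖ ^ 2 ≤ 2 * ‖a‖ ^ 2 + 2 * ‖b‖ ^ 2 := by
  have h := norm_sub_le a b
  have h0 := norm_nonneg (a - b)
  nlinarith [sq_nonneg (‖a‖ - ‖b‖)]

/-- Parseval returns to the grid. `errCoef` refers to exact Fourier coefficients, so the aliasing
error of the exact solution is added; the weight, being at least 1, is dropped. -/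
lemma Flow.l2norm_error_le (F : Flow r T p c K u v) {L dt : ℝ} (hN : 0 < N) (he : Even N) {j : ℕ}
    (hj : (j : ℝ) * dt ∈ Set.Icc 0 T) :
    l2norm N (fun k => cnadbPer N L p dt (fun l => u 0 (node N l)) j k - u (j * dt) (node N k)) ≤
      4 * (‖wvec N (errCoef N L p dt u j)‖ + K * 4 ^ (r + 4) * wsum / N ^ r) := by
  have hK : 0 ≤ K := by linarith [F.one_le]
  have hW := one_le_wsum
  have hN' : (1 : ℝ) ≤ N := by exact_mod_cast hN
  have hN0 : (0 : ℝ) < N := by linarith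
  obtain ⟨E, hE⟩ : ∃ E : ℝ, E = K * 4 ^ (r + 4) * wsum := ⟨_, rfl⟩
  have hE0 : 0 ≤ E := by rw [hE]; positivity
  rw [l2norm_eq hN he, ← hE]
  simp only [dft_sub]
  refine Real.sqrt_le_iff.2 ⟨by positivity, ?_⟩
  have h1 : ∀ m ∈ idx N, ‖dft N (cnadbPer N L p dt (fun l => u 0 (node N l)) j) m -
      dft N (fun k => u (j * dt) (node N k)) m‖ ^ 2 ≤
      2 * ‖errCoef N L p dt u j m‖ ^ 2 + 2 * (E / N ^ (r + 4)) ^ 2 := by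
    intro m hm
    have h2 := (F.wcu _ hj).norm_dft_sub_fc_le (by omega) hN he hm
    have h3 := norm_sub_sq_le (errCoef N L p dt u j m)
      (dft N (fun k => u (j * dt) (node N k)) m - fc (u (j * dt)) m)
    rw [errCoef, sub_sub_sub_cancel_right, ← errCoef] at h3
    refine h3.trans ?_
    rw [hE]
    gcongr
  have h4 := Finset.sum_le_sum h1
  rw [Finset.sum_add_distrib, ← Finset.mul_sum, Finset.sum_const, card_idx he, nsmul_eq_mul] at h4
  have h5 := sum_norm_sq_le_norm_wvec_sq (N := N) (errCoef N L p dt u j)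
  have h6 : (N : ℝ) * (2 * (E / N ^ (r + 4)) ^ 2) ≤ 2 * (E / N ^ r) ^ 2 := by
    have : E / (N : ℝ) ^ (r + 4) ≤ E / N ^ (r + 1) := by gcongr; norm_num
    calc (N : ℝ) * (2 * (E / N ^ (r + 4)) ^ 2) ≤ N * (2 * (E / N ^ (r + 1)) ^ 2) := by gcongr
      _ = 2 * (E / N ^ r) ^ 2 / N := by rw [pow_succ (N : ℝ) r]; field_simp
      _ ≤ 2 * (E / N ^ r) ^ 2 := div_le_self (by positivity) hN'
  obtain ⟨a, ha⟩ : ∃ a : ℝ, a = E / N ^ r := ⟨_, rfl⟩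
  have ha0 : 0 ≤ a := by rw [ha]; positivity
  rw [← ha] at h6 ⊢
  have hx := norm_nonneg (wvec N (errCoef N L p dt u j))
  set x := ‖wvec N (errCoef N L p dt u j)‖
  have hpi : 2 * Real.pi ≤ 8 := by linarith [Real.pi_le_four]
  calc _ ≤ 2 * Real.pi * (2 * x ^ 2 + 2 * a ^ 2) := by
        refine mul_le_mul_of_nonneg_left (h4.trans ?_) (by positivity)
        linarith
    _ ≤ 8 * (2 * x ^ 2 + 2 * a ^ 2) := by gcongr
    _ ≤ (4 * (x + a)) ^ 2 := by nlinarith [mul_nonneg hx ha0]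

end Scheme

end
end Airy

/-! ### The convergence theorem. -/

theorem mainTheorem3 (r : ℕ) (hr : 6 ≤ r) (T : ℝ) (hT : 0 < T) (p : ℝ) (L : ℝ → ℝ)
    (θ : ℝ → ℝ → ℝ) (hsol : Airy.IsRegularSolution r T p L θ) :
    ∃ h₀ > 0, ∃ C₀ > 0, ∃ C : ℝ, ∀ N : ℕ, 0 < N → Even N → ∀ dt : ℝ, 0 < dt →
      Airy.mesh N ≤ h₀ → dt / Airy.mesh N ≤ C₀ →
      ∀ j : ℕ, j * dt ≤ T →
        Airy.l2norm N
            (fun k => Airy.cnadb N (L 0) p dt (θ 0) j k - (θ (j * dt) (Airy.node N k) : ℂ)) ≤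
          C * (Airy.mesh N ^ r + dt ^ 2) := by
  obtain ⟨K, F⟩ := hsol.flow hr hT
  have hL := hsol.length_pos 0 ⟨le_rfl, hT.le⟩
  have hc : 0 < (2 * Real.pi / L 0) ^ 3 := by positivity
  have hK : 0 ≤ K := by linarith [F.one_le]
  have hW := Airy.one_le_wsum
  obtain ⟨h₀, hh₀, C₀, hC₀, C, hC, h⟩ := F.norm_wvec_errCoef_le hr hT.le hc rfl
  refine ⟨h₀, hh₀, C₀, hC₀, 4 * (C + K * 4 ^ (r + 4) * Airy.wsum),
    fun N hN he dt hdt hmesh hCFL j hj => ?_⟩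
  have h1 := F.l2norm_error_le (L := L 0) hN he (j := j) (dt := dt) ⟨by positivity, hj⟩
  -- The linear part pα is the same in the approximation and in the solution, so the error is that
  -- of the periodic parts.
  have e : (fun k => Airy.cnadb N (L 0) p dt (θ 0) j k - (θ (j * dt) (Airy.node N k) : ℂ)) =
      fun k => Airy.cnadbPer N (L 0) p dt
        (fun l => ((θ 0 (Airy.node N l) - p * Airy.node N l : ℝ) : ℂ)) j k -
        ((θ (j * dt) (Airy.node N k) - p * Airy.node N k : ℝ) : ℂ) := by
    funext k
    rw [Airy.cnadb]
    push_cast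
    ring
  rw [e]
  refine h1.trans ?_
  have h2 := h N hN he dt hdt hmesh hCFL j hj
  have h3 := Airy.one_div_pow_le_mesh_pow hN r
  have h4 : K * 4 ^ (r + 4) * Airy.wsum / N ^ r ≤
      K * 4 ^ (r + 4) * Airy.wsum * (Airy.mesh N ^ r + dt ^ 2) := by
    rw [div_eq_mul_one_div]
    gcongr
    exact h3.trans (le_add_of_nonneg_right (sq_nonneg dt))
  calc _ ≤ 4 * (C * (Airy.mesh N ^ r + dt ^ 2) +
        K * 4 ^ (r + 4) * Airy.wsum * (Airy.mesh N ^ r + dt ^ 2)) := by gcongr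
    _ = _ := by ring
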